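/- Let $V=\mathbb R^7$ with standard basis $e_1,\dots,e_7$ and dual basis $e^1,\dots,e^7$, write $e^{ij\cdots}=e^i\wedge e^j\wedge\cdots$, and put $$\omega_0=\sqrt2\,(e^{167}+e^{235})-e^4\wedge(e^{15}-e^{26}-e^{37}),\qquad \langle\cdot,\cdot\rangle=2(e^1\cdot e^5+e^2\cdot e^6+e^3\cdot e^7)-(e^4)^2 .$$ Let $\mathfrak g_2^*\subset\mathfrak{gl}(V)$ be the Lie algebra of the stabiliser of $\omega_0$ in $GL(V)$. For a Lie subalgebra $\mathfrak h\subset\mathfrak g_2^*$ let $\mathcal K(\mathfrak h)$ be the space of all $\mathfrak h$-valued two-forms $R$ on $V$ with $R(x,y)z+R(y,z)x+R(z,x)y=0$ for all $x,y,z\in V$. Call $\mathfrak h$ a Berger algebra if it is spanned by all $R(x,y)$, $R\in\mathcal K(\mathfrak h)$, $x,y\in V$; call it indecomposable if $V$ has no proper non-zero $\mathfrak h$-invariant subspace on which $\langle\cdot,\cdot\rangle$ is non-degenerate; and call it of Type I if the socle of $V$ (the sum of all irreducible $\mathfrak h$-invariant subspaces) is one-dimensional. For $A=\begin{pmatrix}a_1&a_2\\a_3&a_4\end{pmatrix}\in\mathfrak{gl}(2,\mathbb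 R)$, $v\in\mathbb R$, $u=(u_1,u_2)^\top$ and $y=(y_1,y_2)^\top\in\mathbb R^2$ let $$h(A,v,u,y)=\begin{pmatrix} \operatorname{tr}A&-u_2&u_1&\sqrt2\,v&0&-y_1&-y_2\\ 0&a_1&a_2&\sqrt2\,u_1&y_1&0&v\\ 0&a_3&a_4&\sqrt2\,u_2&y_2&-v&0\\ 0&0&0&0&\sqrt2\,v&\sqrt2\,u_1&\sqrt2\,u_2\\ 0&0&0&0&-\operatorname{tr}A&0&0\\ 0&0&0&0&u_2&-a_1&-a_3\\ 0&0&0&0&-u_1&-a_2&-a_4\end{pmatrix}.$$ Let $\mathfrak h^I$ be the Lie algebra of all $h(A,v,u,y)$ and $\mathfrak m$ the ideal of all $h(0,v,u,y)$. Identify $A$ with $h(A,0,0,0)$, so that $\mathfrak h^I=\mathfrak{gl}(2,\mathbb R)\ltimes\mathfrak m$. For $i,j\in\{0,1\}$ and $k\in\{0,1,2\}$ let $\mathfrak m(i,j,k)$ be the space of all $h(0,v,(u_1,0)^\top,y)$ with $v=0$ if $i=0$, with $u_1=0$ if $j=0$, and with $y=0$ if $k=0$, $y\in\mathbb R\cdot(1,0)^\top$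 if $k=1$, $y\in\mathbb R^2$ if $k=2$. Put $C_a=\begin{pmatrix}a&-1\\1&a\end{pmatrix}$, $S=\begin{pmatrix}1&1\\0&1\end{pmatrix}$, $N=\begin{pmatrix}0&1\\0&0\end{pmatrix}$, $\mathfrak d=\{\operatorname{diag}(a,d)\mid a,d\in\mathbb R\}$, $\mathfrak u(1)=\left\{\begin{pmatrix}a&-b\\b&a\end{pmatrix}\,\middle|\, a,b\in\mathbb R\right\}$, $\hat{\mathfrak b}_2=\operatorname{span}\{I,N\}$, $\mathfrak s_\lambda=\operatorname{span}\{\operatorname{diag}(\lambda,\lambda-1),N\}$ for $\lambda\in\mathbb R$, and let $\mathfrak b_2$ be the algebra of upper triangular $2\times2$ matrices. **Theorem.** Let $\mathfrak h\subset\mathfrak g_2^*$ be an indecomposable Berger algebra of Type I. Then there is a basis $b_1,\dots,b_7$ of $V$ with respect to which $\omega_0$ and $\langle\cdot,\cdot\rangle$ have the same coefficients as with respect to $e_1,\dots,e_7$ and such that, with $\mathfrak h$ written in matrices with respect to this basis, $\mathfrak h\subset\mathfrak h^I$ and, for the projection $\mathfrak a$ of $\mathfrak h$ to $\mathfrak{gl}(2,\mathbb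 R)$, one of the following holds: 1. $\mathfrak a$ is one of $0,\ \mathfrak{sl}(2,\mathbb R),\ \mathfrak{gl}(2,\mathbb R),\ \mathfrak u(1),\ \mathfrak b_2,\ \hat{\mathfrak b}_2,\ \mathfrak d,\ \mathbb R\cdot C_a\ (a\in\mathbb R),\ \mathbb R\cdot S$, and $\mathfrak h=\mathfrak a\ltimes\mathfrak m$; 2. $\mathfrak a=\mathfrak s_\lambda$ for some $\lambda\in\mathbb R$ and, with $X=\operatorname{diag}(\lambda,\lambda-1)$, (a) $\mathfrak h=\mathfrak a\ltimes\mathfrak m$, or (b) $\lambda=1$ and $\mathfrak h=\mathbb R\cdot h(X,0,(0,1)^\top,0)\ltimes(\mathbb R\cdot N\ltimes\mathfrak m(1,1,2))$, or (c) $\lambda=2$ and $\mathfrak h=\operatorname{span}\{X,\,h(N,0,(0,1)^\top,0)\}\ltimes\mathfrak m(i,j,2)$ for some $i,j\in\{0,1\}$; 3. $\mathfrak a=\mathbb R\cdot\operatorname{diag}(1,\mu)$ and (a) $\mu\in[-1,1]$ and $\mathfrak h=\mathfrak a\ltimes\mathfrak m$, or (b) $\mu=0$ and $\mathfrak h=\mathbb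 R\cdot h(\operatorname{diag}(1,0),0,(0,1)^\top,0)\ltimes\mathfrak m(1,1,2)$; 4. $\mathfrak a=\mathbb R\cdot N$ and (a) $\mathfrak h=\mathfrak a\ltimes\mathfrak m$, or (b) $\mathfrak h=\mathbb R\cdot h(N,0,(0,1)^\top,0)\ltimes\mathfrak m(1,j,2)$ for some $j\in\{0,1\}$. -/

import Mathlib

attribute [local instance] LieRing.ofAssociativeRing

noncomputable section

namespace GTwoStar

/-! ### The three-form, the metric and the Lie algebra of their stabiliser

Coordinates are numbered `0, …, 6`; they stand for the indices `1, …, 7`. -/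

/-- The space `ℝ⁷`. -/
abbrev V : Type := Fin 7 → ℝ

/-- `2 × 2` matrices, with commutator bracket: `𝔤𝔩(2, ℝ)`. -/
abbrev M2 : Type := Matrix (Fin 2) (Fin 2) ℝ

/-- `7 × 7` matrices, with commutator bracket. -/
abbrev M7 : Type := Matrix (Fin 7) (Fin 7) ℝ

/-- The elementary three-form `eⁱ ∧ eʲ ∧ eᵏ`. -/
def wedge (i j k : Fin 7) (x y z : V) : ℝ :=
  Matrix.det !![x i, x j, x k; y i, y j, y k; z i, z j, z k]

/-- `ω₀ = √2 (e¹⁶⁷ + e²³⁵) - e⁴ ∧ (e¹⁵ - e²⁶ - e³⁷)`. -/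
def omega (x y z : V) : ℝ :=
  Real.sqrt 2 * (wedge 0 5 6 x y z + wedge 1 2 4 x y z)
    - (wedge 3 0 4 x y z - wedge 3 1 5 x y z - wedge 3 2 6 x y z)

/-- The metric `2 (e¹·e⁵ + e²·e⁶ + e³·e⁷) - (e⁴)²` of signature `(4,3)`
(the dot is the symmetric product, so `2 e¹·e⁵ = e¹ ⊗ e⁵ + e⁵ ⊗ e¹`). -/
def ip : LinearMap.BilinForm ℝ V :=
  LinearMap.mk₂ ℝ
    (fun x y => (x 0 * y 4 + x 4 * y 0) + (x 1 * y 5 + x 5 * y 1)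
      + (x 2 * y 6 + x 6 * y 2) - x 3 * y 3)
    (by intro x x' y; simp only [Pi.add_apply]; ring)
    (by intro c x y; simp only [Pi.smul_apply, smul_eq_mul]; ring)
    (by intro x y y'; simp only [Pi.add_apply]; ring)
    (by intro c x y; simp only [Pi.smul_apply, smul_eq_mul]; ring)

theorem omega_add (x x' y z : V) : omega (x + x') y z = omega x y z + omega x' y z := by
  simp [omega, wedge, Matrix.det_fin_three]; ring

theorem omega_smul (c : ℝ) (x y z : V) : omega (c • x) y z = c * omega x y z := by
  simp [omega, wedge, Matrix.det_fin_three]; ring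

theorem omega_swap₁ (x y z : V) : omega y x z = - omega x y z := by
  simp [omega, wedge, Matrix.det_fin_three]; ring

theorem omega_swap₂ (x y z : V) : omega z y x = - omega x y z := by
  simp [omega, wedge, Matrix.det_fin_three]; ring

theorem omega_add₂ (x y y' z : V) : omega x (y + y') z = omega x y z + omega x y' z := by
  rw [omega_swap₁ (y + y'), omega_add, omega_swap₁ y, omega_swap₁ y']; ring

theorem omega_add₃ (x y z z' : V) : omega x y (z + z') = omega x y z + omega x y z' := by
  rw [omega_swap₂ (z + z'), omega_add, omega_swap₂ z, omega_swap₂ z']; ring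

theorem omega_smul₂ (c : ℝ) (x y z : V) : omega x (c • y) z = c * omega x y z := by
  rw [omega_swap₁ (c • y), omega_smul, omega_swap₁ y]; ring

theorem omega_smul₃ (c : ℝ) (x y z : V) : omega x y (c • z) = c * omega x y z := by
  rw [omega_swap₂ (c • z), omega_smul, omega_swap₂ z]; ring

/-- The Lie algebra `𝔤₂*` of the stabiliser of `ω₀` in `GL(7, ℝ)`. -/
def g2star : LieSubalgebra ℝ (Module.End ℝ V) where
  carrier := {X | ∀ x y z : V, omega (X x) y z + omega x (X y) z + omega x y (X z) = 0}
  add_mem' := by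
    intro X Y hX hY x y z
    have h1 := hX x y z
    have h2 := hY x y z
    simp only [LinearMap.add_apply, omega_add, omega_add₂, omega_add₃]
    linarith
  zero_mem' := by
    intro x y z
    simp [omega, wedge, Matrix.det_fin_three]
  smul_mem' := by
    intro c X hX x y z
    have h1 := hX x y z
    simp only [LinearMap.smul_apply, omega_smul, omega_smul₂, omega_smul₃]
    rw [← mul_add, ← mul_add, h1, mul_zero]
  lie_mem' := by
    intro X Y hX hY x y z
    have e : ∀ w : V, ⁅X, Y⁆ w = X (Y w) + (-1 : ℝ) • Y (X w) := by
      intro w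
      simp [LieRing.of_associative_ring_bracket, sub_eq_add_neg]
    have a1 := hX (Y x) y z
    have a2 := hX x (Y y) z
    have a3 := hX x y (Y z)
    have b1 := hY (X x) y z
    have b2 := hY x (X y) z
    have b3 := hY x y (X z)
    simp only [e, omega_add, omega_add₂, omega_add₃, omega_smul, omega_smul₂, omega_smul₃]
    linarith

/-! ### Indecomposability, socle, type, Berger algebras -/

/-- `ℝ⁷` has no proper non-zero `𝔥`-invariant subspace on which the metric is non-degenerate. -/
def IsIndecomposable (h : LieSubalgebra ℝ (Module.End ℝ V)) : Prop :=
  ∀ W : LieSubmodule ℝ h V,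
    (ip.restrict (W : Submodule ℝ V)).Nondegenerate → W = ⊥ ∨ W = ⊤

/-- The socle of the natural representation: the sum of all its irreducible
subrepresentations, that is, its largest semisimple subrepresentation. -/
def socle (h : LieSubalgebra ℝ (Module.End ℝ V)) : LieSubmodule ℝ h V :=
  sSup {W : LieSubmodule ℝ h V | IsAtom W}

/-- `𝔥` is of Type I: its socle is one-dimensional. -/
def IsTypeI (h : LieSubalgebra ℝ (Module.End ℝ V)) : Prop :=
  Module.finrank ℝ (socle h) = 1

/-- `R ∈ 𝒦(𝔥)`: `R` is an `𝔥`-valued two-form that satisfies the first Bianchi identity. -/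
def IsCurvature (h : LieSubalgebra ℝ (Module.End ℝ V))
    (R : V →ₗ[ℝ] V →ₗ[ℝ] Module.End ℝ V) : Prop :=
  (∀ x, R x x = 0) ∧ (∀ x y, R x y ∈ h) ∧
    ∀ x y z, R x y z + R y z x + R z x y = 0

/-- `𝔥` is a Berger algebra: it is spanned by the values `R(x, y)` of all `R ∈ 𝒦(𝔥)`. -/
def IsBerger (h : LieSubalgebra ℝ (Module.End ℝ V)) : Prop :=
  h.toSubmodule = Submodule.span ℝ {X | ∃ R, IsCurvature h R ∧ ∃ x y, X = R x y}

/-! ### Adapted bases and the matrices `h(A, v, u, y)` -/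

/-- A basis in which the three-form and the metric have the same standard form as in the
standard basis of `ℝ⁷`. -/
def IsAdapted (b : Module.Basis (Fin 7) ℝ V) : Prop :=
  (∀ i j k, omega (b i) (b j) (b k)
      = omega (Pi.single i 1) (Pi.single j 1) (Pi.single k 1)) ∧
    ∀ i j, ip (b i) (b j) = ip (Pi.single i 1) (Pi.single j 1)

/-- The matrices of the elements of `𝔥` with respect to the basis `b`. -/
def matrices (h : LieSubalgebra ℝ (Module.End ℝ V)) (b : Module.Basis (Fin 7) ℝ V) :
    Submodule ℝ M7 :=
  h.toSubmodule.map (LinearMap.toMatrix b b).toLinearMap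

/-- The matrix `h(A, v, u, y)`. -/
def hMat (A : M2) (v : ℝ) (u y : Fin 2 → ℝ) : M7 :=
  !![A.trace, -u 1, u 0, Real.sqrt 2 * v, 0, -y 0, -y 1;
     0, A 0 0, A 0 1, Real.sqrt 2 * u 0, y 0, 0, v;
     0, A 1 0, A 1 1, Real.sqrt 2 * u 1, y 1, -v, 0;
     0, 0, 0, 0, Real.sqrt 2 * v, Real.sqrt 2 * u 0, Real.sqrt 2 * u 1;
     0, 0, 0, 0, -A.trace, 0, 0;
     0, 0, 0, 0, u 1, -A 0 0, -A 1 0;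
     0, 0, 0, 0, -u 0, -A 0 1, -A 1 1]

/-- `h(A, v, u, y)` as a linear function of `(A, v, u, y)`. -/
def hLin : (M2 × ℝ × (Fin 2 → ℝ) × (Fin 2 → ℝ)) →ₗ[ℝ] M7 where
  toFun p := hMat p.1 p.2.1 p.2.2.1 p.2.2.2
  map_add' := by
    intro p q
    ext i j
    fin_cases i <;> fin_cases j <;> simp [hMat, Matrix.trace_fin_two] <;> ring
  map_smul' := by
    intro c p
    ext i j
    fin_cases i <;> fin_cases j <;> simp [hMat, Matrix.trace_fin_two] <;> ring

/-- `𝔥ᴵ`, the algebra of all `h(A, v, u, y)`; it is `𝔭₁ = 𝔤𝔩(2, ℝ) ⋉ 𝔪`. -/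
def hI : Submodule ℝ M7 := LinearMap.range hLin

/-- The projection to `𝔤𝔩(2, ℝ)` of (the intersection with `𝔥ᴵ` of) a space of matrices. -/
def proj (k : Submodule ℝ M7) : Submodule ℝ M2 :=
  (k.comap hLin).map (LinearMap.fst ℝ M2 (ℝ × (Fin 2 → ℝ) × (Fin 2 → ℝ)))

/-- A space of `2 × 2` matrices as a space of `7 × 7` matrices, by `A ↦ h(A, 0, 0, 0)`. -/
def emb (a : Submodule ℝ M2) : Submodule ℝ M7 :=
  a.map (hLin ∘ₗ LinearMap.inl ℝ M2 (ℝ × (Fin 2 → ℝ) × (Fin 2 → ℝ)))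

/-- `𝔪`, the algebra of all `h(0, v, u, y)`. -/
def mAll : Submodule ℝ M7 :=
  LinearMap.range (hLin ∘ₗ LinearMap.inr ℝ M2 (ℝ × (Fin 2 → ℝ) × (Fin 2 → ℝ)))

/-- `𝔪(i,0,0)`. -/
def mV : Fin 2 → Submodule ℝ M7
  | 0 => ⊥
  | 1 => Submodule.span ℝ {hMat 0 1 0 0}

/-- `𝔪(0,j,0)`. -/
def mU : Fin 2 → Submodule ℝ M7
  | 0 => ⊥
  | 1 => Submodule.span ℝ {hMat 0 0 ![1, 0] 0}

/-- `𝔪(0,0,k)`. -/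
def mY : Fin 3 → Submodule ℝ M7
  | 0 => ⊥
  | 1 => Submodule.span ℝ {hMat 0 0 0 ![1, 0]}
  | 2 => Submodule.span ℝ {hMat 0 0 0 ![1, 0], hMat 0 0 0 ![0, 1]}

/-- `𝔪(i,j,k) = 𝔪(i,0,0) ⊕ 𝔪(0,j,0) ⊕ 𝔪(0,0,k)`. -/
def m (i j : Fin 2) (k : Fin 3) : Submodule ℝ M7 := mV i ⊔ mU j ⊔ mY k

/-- `𝔨 = 𝔮 ⋉ 𝔫`: as a vector space `𝔨` is the direct sum of `𝔮` and `𝔫`, where `𝔮` is closed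
under the commutator bracket and `𝔫` is an ideal of `𝔨`. -/
def IsSemidirect (k q n : Submodule ℝ M7) : Prop :=
  k = q ⊔ n ∧ Disjoint q n ∧ (∀ X ∈ q, ∀ Y ∈ q, ⁅X, Y⁆ ∈ q) ∧
    ∀ X ∈ k, ∀ Y ∈ n, ⁅X, Y⁆ ∈ n

/-! ### Subalgebras of `𝔤𝔩(2, ℝ)` -/

/-- The matrix `C_a`. -/
def C (a : ℝ) : M2 := !![a, -1; 1, a]

/-- The matrix `S`. -/
def S : M2 := !![1, 1; 0, 1]

/-- The matrix `N`. -/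
def N : M2 := !![0, 1; 0, 0]

/-- The matrix `diag(a, d)`. -/
def dg (a d : ℝ) : M2 := !![a, 0; 0, d]

/-- The line `ℝ · A`. -/
def line (A : M2) : Submodule ℝ M2 := Submodule.span ℝ {A}

/-- `𝔰𝔩(2, ℝ)`. -/
def sl2 : Submodule ℝ M2 := LinearMap.ker (Matrix.traceLinearMap (Fin 2) ℝ ℝ)

/-- The diagonal matrices. -/
def d : Submodule ℝ M2 := Submodule.span ℝ {dg 1 0, dg 0 1}

/-- `𝔲(1)`: the matrices with rows `(a, -b)` and `(b, a)`. -/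
def u1 : Submodule ℝ M2 := Submodule.span ℝ {dg 1 1, C 0}

/-- The span of the identity and `N`. -/
def b2hat : Submodule ℝ M2 := Submodule.span ℝ {1, N}

/-- `𝔰_t`, the span of `diag(t, t - 1)` and `N`. -/
def s (t : ℝ) : Submodule ℝ M2 := Submodule.span ℝ {dg t (t - 1), N}

/-- The upper triangular matrices. -/
def b2 : Submodule ℝ M2 := Submodule.span ℝ {dg 1 0, dg 0 1, N}

end GTwoStar

end

noncomputable section

open Matrix

namespace GTwoStar

/-! The socle of `V` is a line. It is null: a non-null line is non-degenerate, and indecomposability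
would make it all of `V`. The stabiliser of the three-form and the metric is transitive on null
lines (`exists_sameOrbit_of_isotropic`), so in some adapted basis the socle is `ℝ e₁`, and the
elements of `𝔤₂*` that preserve this line lie in `𝔥ᴵ` (`mem_hI_of_derivation`). From then on Type I
is used in one form only: every non-zero invariant subspace contains `e₁` (`IsHIForm.single_mem`).

Let `𝔞` be the projection to `𝔤𝔩(2, ℝ)`. The Levi factor `GL(2, ℝ)` acts on it by conjugation, so
`𝔞` may be taken from a list of representatives (`exists_isConjugate_isStandard`). What remains is
the position of the algebra over `𝔞`. Let `U ⊆ ℝ²` be the space of `u`-components of its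
intersection with `𝔪`. If `U = ℝ²`, brackets generate `𝔪`. In general the `u`-component is a cocycle
on `𝔞` with values in `ℝ²/U`. If it is a coboundary and `U ≠ ℝ²`, there is an invariant plane or
line inside the span of `e₁, e₂, e₃` that misses `e₁`, a contradiction. Hence a coboundary implies
that `𝔪` is contained in the algebra (`IsHIForm.mAll_le_of_coboundary`). This settles `𝔞 = 0`, `1 ∈
𝔞`, lines spanned by invertible matrices, and `𝔰𝔩(2, ℝ)`.

The remaining projections are `ℝ · diag(1,0)`, `ℝ · N` and `𝔰_λ`. If `𝔪` is not contained in the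
algebra, then `U ⊆ ℝ · (1,0)` and `u₂` is a non-zero linear function of the `𝔞`-part, which a
scaling normalises. For `𝔰_λ` the relation `[X, N] = N` leaves only `λ = 1` and `λ = 2`. For
`diag(1,0)` and `𝔰₁` brackets alone produce `𝔪(1,1,2)`. For `N` and `𝔰₂` the Berger condition is
needed: a curvature tensor with non-zero component along `N`, respectively `X`, forces by the
Bianchi identity (`IsCurv.relations`) enough elements to generate `𝔪(1,0,2)`, respectively
`𝔪(0,0,2)`. -/

/-! ### Matrices of the algebra with respect to adapted bases -/

/-- The linear map `φ` preserves the three-form and the metric. -/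
def Preserves (φ : V →ₗ[ℝ] V) : Prop :=
  (∀ x y z, omega (φ x) (φ y) (φ z) = omega x y z) ∧ ∀ x y, ip (φ x) (φ y) = ip x y

theorem Preserves.comp {φ ψ : V →ₗ[ℝ] V} (hφ : Preserves φ) (hψ : Preserves ψ) :
    Preserves (φ ∘ₗ ψ) :=
  ⟨fun x y z => by simp [hφ.1, hψ.1], fun x y => by simp [hφ.2, hψ.2]⟩

theorem Preserves.symm {φ : V ≃ₗ[ℝ] V} (hφ : Preserves φ.toLinearMap) :
    Preserves φ.symm.toLinearMap := by
  refine ⟨fun x y z => ?_, fun x y => ?_⟩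
  · have := hφ.1 (φ.symm x) (φ.symm y) (φ.symm z)
    simpa using this.symm
  · have := hφ.2 (φ.symm x) (φ.symm y)
    simpa using this.symm

/-- Conjugation of a matrix with a linear automorphism. -/
def conjEnd (φ : V ≃ₗ[ℝ] V) : M7 →ₗ[ℝ] Module.End ℝ V :=
  φ.conj.toLinearMap ∘ₗ (Matrix.toLin' : M7 ≃ₗ[ℝ] _).toLinearMap

theorem conjEnd_apply (φ : V ≃ₗ[ℝ] V) (M : M7) (x : V) :
    conjEnd φ M (φ x) = φ (M *ᵥ x) := by
  simp [conjEnd, LinearEquiv.conj_apply]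

theorem conjEnd_surjective (φ : V ≃ₗ[ℝ] V) : Function.Surjective (conjEnd φ) :=
  φ.conj.surjective.comp (Matrix.toLin' : M7 ≃ₗ[ℝ] _).surjective

/-- `k` is the space of matrices of `h` with respect to some adapted basis. -/
def IsForm (h : LieSubalgebra ℝ (Module.End ℝ V)) (k : Submodule ℝ M7) : Prop :=
  ∃ φ : V ≃ₗ[ℝ] V, Preserves φ.toLinearMap ∧ k = h.toSubmodule.comap (conjEnd φ)

/-- The adapted basis is the image of the standard basis under `φ`. Keeping the automorphism instead
of the basis turns a change of basis into a composition. -/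
theorem IsForm.exists_basis {h : LieSubalgebra ℝ (Module.End ℝ V)} {k : Submodule ℝ M7}
    (hk : IsForm h k) : ∃ b, IsAdapted b ∧ k = matrices h b := by
  obtain ⟨φ, hφ, rfl⟩ := hk
  refine ⟨(Pi.basisFun ℝ (Fin 7)).map φ, ⟨fun i j k => ?_, fun i j => ?_⟩, ?_⟩
  · have := hφ.1 (Pi.single i 1) (Pi.single j 1) (Pi.single k 1)
    simpa using this
  · have := hφ.2 (Pi.single i 1) (Pi.single j 1)
    simpa using this
  · have key : ∀ M : M7, LinearMap.toMatrix ((Pi.basisFun ℝ (Fin 7)).map φ)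
        ((Pi.basisFun ℝ (Fin 7)).map φ) (conjEnd φ M) = M := by
      intro M
      ext i j
      rw [LinearMap.toMatrix_apply]
      simp [conjEnd_apply]
    ext M
    simp only [matrices, Submodule.mem_comap, Submodule.mem_map]
    constructor
    · intro hM
      exact ⟨_, hM, key M⟩
    · rintro ⟨X, hX, rfl⟩
      obtain ⟨M, rfl⟩ := conjEnd_surjective φ X
      have := key M
      simp only [LinearEquiv.coe_coe, this]
      exact hX

/-- Conjugation by an invertible matrix. -/
def conjMat (P Q : M7) : M7 →ₗ[ℝ] M7 :=
  LinearMap.mulLeft ℝ P ∘ₗ LinearMap.mulRight ℝ Q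

theorem conjMat_apply (P Q M : M7) : conjMat P Q M = P * M * Q := by
  simp [conjMat, mul_assoc]

theorem IsForm.conj {h : LieSubalgebra ℝ (Module.End ℝ V)} {k : Submodule ℝ M7}
    (hk : IsForm h k) {P Q : M7} (hP : Preserves P.mulVecLin) (hPQ : P * Q = 1) (hQP : Q * P = 1) :
    IsForm h (k.comap (conjMat P Q)) := by
  obtain ⟨φ, hφ, rfl⟩ := hk
  let e : V ≃ₗ[ℝ] V := Matrix.toLin'OfInv hQP hPQ
  refine ⟨e.trans φ, ?_, ?_⟩
  · exact Preserves.comp (φ := φ.toLinearMap) (ψ := P.mulVecLin) hφ hP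
  · ext M
    simp only [Submodule.mem_comap]
    have : conjEnd φ (conjMat P Q M) = conjEnd (e.trans φ) M := by
      refine LinearMap.ext fun x => ?_
      obtain ⟨y, rfl⟩ := (e.trans φ).surjective x
      have h1 := conjEnd_apply (e.trans φ) M y
      have h2 := conjEnd_apply φ (conjMat P Q M) (e y)
      rw [h1, LinearEquiv.trans_apply, h2, conjMat_apply]
      have h4 : ∀ z, e z = P *ᵥ z := fun z => rfl
      simp only [LinearEquiv.trans_apply, h4, Matrix.mulVec_mulVec]
      rw [mul_assoc, hQP, mul_one]
    rw [this]

section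
variable {h : LieSubalgebra ℝ (Module.End ℝ V)} {k : Submodule ℝ M7}

theorem IsForm.lie_mem (hk : IsForm h k) {M M' : M7} (hM : M ∈ k) (hM' : M' ∈ k) :
    ⁅M, M'⁆ ∈ k := by
  obtain ⟨φ, hφ, rfl⟩ := hk
  have : conjEnd φ ⁅M, M'⁆ = ⁅conjEnd φ M, conjEnd φ M'⁆ := by
    refine LinearMap.ext fun x => ?_
    obtain ⟨y, rfl⟩ := φ.surjective x
    simp [LieRing.of_associative_ring_bracket, conjEnd_apply,
      ← Matrix.mulVec_mulVec]
  simp only [Submodule.mem_comap] at *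
  rw [this]
  exact h.lie_mem hM hM'

theorem IsForm.derivation (hk : IsForm h k) (h_sub : h ≤ g2star) {M : M7} (hM : M ∈ k)
    (x y z : V) : omega (M *ᵥ x) y z + omega x (M *ᵥ y) z + omega x y (M *ᵥ z) = 0 := by
  obtain ⟨φ, hφ, rfl⟩ := hk
  have h1 := h_sub hM (φ x) (φ y) (φ z)
  simp only [conjEnd_apply] at h1
  have h2 := hφ.1
  simp only [LinearEquiv.coe_coe] at h2
  simpa only [h2] using h1

/-- The coefficients with respect to a basis of a curvature tensor with values in `k`. -/
structure IsCurv (k : Submodule ℝ M7) (r : Fin 7 → Fin 7 → M7) : Prop where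
  mem : ∀ i j, r i j ∈ k
  skew : ∀ i j, r i j = - r j i
  bianchi : ∀ i j l a, r i j a l + r j l a i + r l i a j = 0

/-- Dual form of the Berger condition: the values of the curvature tensors span the algebra, so a
linear form is determined by them. Applied contrapositively to a matrix entry, it produces a
curvature tensor for which that entry does not vanish. -/
theorem IsForm.eq_zero_of_curv (hk : IsForm h k) (h_berger : IsBerger h) (f : M7 →ₗ[ℝ] ℝ)
    (hf : ∀ r, IsCurv k r → ∀ i j, f (r i j) = 0) : ∀ M ∈ k, f M = 0 := by
  obtain ⟨φ, hφ, rfl⟩ := hk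
  let ψ : Module.End ℝ V →ₗ[ℝ] M7 :=
    (LinearMap.toMatrix' : _ ≃ₗ[ℝ] M7).toLinearMap ∘ₗ φ.symm.conj.toLinearMap
  have hψ : ∀ M, ψ (conjEnd φ M) = M := by
    intro M
    simp only [ψ, conjEnd, LinearMap.comp_apply, LinearEquiv.coe_coe]
    have : φ.symm.conj (φ.conj (Matrix.toLin' M)) = Matrix.toLin' M := by
      ext; simp [LinearEquiv.conj_apply]
    rw [this]; simp
  have hψ' : ∀ X, conjEnd φ (ψ X) = X := by
    intro X
    obtain ⟨M, rfl⟩ := conjEnd_surjective φ X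
    rw [hψ]
  have hψv : ∀ X x, ψ X *ᵥ x = φ.symm (X (φ x)) := by
    intro X x
    have := conjEnd_apply φ (ψ X) x
    rw [hψ'] at this
    rw [this]; simp
  suffices H : ∀ X ∈ h.toSubmodule, f (ψ X) = 0 by
    intro M hM
    have := H _ hM
    rwa [hψ] at this
  rw [h_berger]
  intro X hX
  have : Submodule.span ℝ {X | ∃ R, IsCurvature h R ∧ ∃ x y, X = R x y} ≤
      LinearMap.ker (f ∘ₗ ψ) := by
    rw [Submodule.span_le]
    rintro _ ⟨R, ⟨h1, h2, h3⟩, x, y, rfl⟩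
    have hsk : ∀ x y, R x y = - R y x := by
      intro x y
      have := h1 (x + y)
      simp only [map_add, LinearMap.add_apply, h1, zero_add, add_zero] at this
      exact eq_neg_of_add_eq_zero_right this
    have hc : IsCurv (h.toSubmodule.comap (conjEnd φ))
        (fun i j => ψ (R (φ (Pi.single i 1)) (φ (Pi.single j 1)))) := by
      refine ⟨fun i j => ?_, fun i j => ?_, fun i j l a => ?_⟩
      · rw [Submodule.mem_comap, hψ']; exact h2 _ _
      · rw [hsk, map_neg]
      · have h4 : ∀ (M : M7) (i j : Fin 7), M i j = (M *ᵥ Pi.single j 1) i := by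
          intro M i j; simp
        simp only [h4 _ a, hψv]
        have := h3 (φ (Pi.single i 1)) (φ (Pi.single j 1)) (φ (Pi.single l 1))
        rw [← Pi.add_apply, ← Pi.add_apply, ← map_add, ← map_add, this]
        simp
    have h0 := hf _ hc
    -- The form `f ∘ ψ ∘ R` is bilinear, so its vanishing can be tested on the vectors `φ eᵢ`.
    have hB : (LinearMap.compr₂ R (f ∘ₗ ψ)).compl₁₂ φ.toLinearMap φ.toLinearMap = 0 := by
      refine (Pi.basisFun ℝ (Fin 7)).ext fun i => (Pi.basisFun ℝ (Fin 7)).ext fun j => ?_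
      have := h0 i j
      simpa using this
    have := LinearMap.congr_fun₂ hB (φ.symm x) (φ.symm y)
    simpa using this
  exact this hX

end

/-! ### Linear automorphisms that preserve the three-form -/

theorem mulVec7 (M : M7) (x : V) (i : Fin 7) : (M *ᵥ x) i = M i 0 * x 0 + M i 1 * x 1 +
    M i 2 * x 2 + M i 3 * x 3 + M i 4 * x 4 + M i 5 * x 5 + M i 6 * x 6 := by
  simp [Matrix.mulVec, dotProduct, Fin.sum_univ_seven]

theorem omega_eq (x y z : V) : omega x y z =
    √2 * (x 0 * (y 5 * z 6 - y 6 * z 5) - x 5 * (y 0 * z 6 - y 6 * z 0)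
      + x 6 * (y 0 * z 5 - y 5 * z 0) + (x 1 * (y 2 * z 4 - y 4 * z 2)
      - x 2 * (y 1 * z 4 - y 4 * z 1) + x 4 * (y 1 * z 2 - y 2 * z 1)))
    - ((x 3 * (y 0 * z 4 - y 4 * z 0) - x 0 * (y 3 * z 4 - y 4 * z 3)
      + x 4 * (y 3 * z 0 - y 0 * z 3))
    - (x 3 * (y 1 * z 5 - y 5 * z 1) - x 1 * (y 3 * z 5 - y 5 * z 3)
      + x 5 * (y 3 * z 1 - y 1 * z 3))
    - (x 3 * (y 2 * z 6 - y 6 * z 2) - x 2 * (y 3 * z 6 - y 6 * z 3)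
      + x 6 * (y 3 * z 2 - y 2 * z 3))) := by
  simp [omega, wedge, Matrix.det_fin_three]; ring

theorem ip_eq (x y : V) : ip x y = (x 0 * y 4 + x 4 * y 0) + (x 1 * y 5 + x 5 * y 1)
    + (x 2 * y 6 + x 6 * y 2) - x 3 * y 3 := rfl

/-- The matrices below carry `√2` only in the row and the column of `e₄`. Writing the
`e₄`-coordinate as `√2 * b` pairs the square roots, which leaves polynomial identities. -/
theorem exists_eq_sqrt_two_mul (a : ℝ) : ∃ b, a = √2 * b :=
  ⟨a / √2, by field_simp⟩

theorem sqrt_two_sq : √2 ^ 2 = 2 := by simp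

theorem sqrt_two_mul_mul (a b : ℝ) : √2 * a * (√2 * b) = 2 * a * b := by
  have : √2 * √2 = 2 := by simp
  linear_combination a * b * this

/-- The unipotent matrix with parameter `t` in the direction of `v`. -/
def expV (t : ℝ) : M7 :=
  !![1, 0, 0, √2 * t, t ^ 2, 0, 0;
     0, 1, 0, 0, 0, 0, t;
     0, 0, 1, 0, 0, -t, 0;
     0, 0, 0, 1, √2 * t, 0, 0;
     0, 0, 0, 0, 1, 0, 0;
     0, 0, 0, 0, 0, 1, 0;
     0, 0, 0, 0, 0, 0, 1]

theorem expV_mulVec (t : ℝ) (x : V) : (expV t) *ᵥ x =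
    ![x 0 + (√2 * t) * x 3 + (t ^ 2) * x 4, x 1 + t * x 6, x 2 + (-t) * x 5, x 3 + (√2 * t) * x 4, x 4, x 5, x 6] := by
  ext i
  rw [mulVec7]
  fin_cases i <;> simp [expV]

theorem preserves_expV (t : ℝ) : Preserves (expV t).mulVecLin := by
  constructor
  · intro x y z
    obtain ⟨a, ha⟩ := exists_eq_sqrt_two_mul (x 3)
    obtain ⟨b, hb⟩ := exists_eq_sqrt_two_mul (y 3)
    obtain ⟨c, hc⟩ := exists_eq_sqrt_two_mul (z 3)
    simp only [omega_eq, Matrix.mulVecLin_apply, expV_mulVec, ha, hb, hc, sqrt_two_mul_mul,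
      Matrix.cons_val]
    ring
  · intro x y
    obtain ⟨a, ha⟩ := exists_eq_sqrt_two_mul (x 3)
    obtain ⟨b, hb⟩ := exists_eq_sqrt_two_mul (y 3)
    simp only [ip_eq, Matrix.mulVecLin_apply, expV_mulVec, ha, hb, Matrix.cons_val,
      sqrt_two_mul_mul]
    ring_nf
    simp only [sqrt_two_sq]
    ring

theorem expV_mul_neg (t : ℝ) : expV t * expV (-t) = 1 := by
  refine Matrix.toLin'.injective (LinearMap.ext fun x => ?_)
  simp only [Matrix.toLin'_apply, ← Matrix.mulVec_mulVec, expV_mulVec, Matrix.one_mulVec]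
  ext i
  fin_cases i <;> simp
  ring_nf
  simp only [sqrt_two_sq]
  ring

/-- The unipotent matrix with parameter `t` in the direction of `u₁`. -/
def expU₁ (t : ℝ) : M7 :=
  !![1, 0, t, 0, 0, 0, 0;
     0, 1, 0, √2 * t, 0, t ^ 2, 0;
     0, 0, 1, 0, 0, 0, 0;
     0, 0, 0, 1, 0, √2 * t, 0;
     0, 0, 0, 0, 1, 0, 0;
     0, 0, 0, 0, 0, 1, 0;
     0, 0, 0, 0, -t, 0, 1]

theorem expU₁_mulVec (t : ℝ) (x : V) : (expU₁ t) *ᵥ x =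
    ![x 0 + t * x 2, x 1 + (√2 * t) * x 3 + (t ^ 2) * x 5, x 2, x 3 + (√2 * t) * x 5, x 4, x 5, (-t) * x 4 + x 6] := by
  ext i
  rw [mulVec7]
  fin_cases i <;> simp [expU₁]

theorem preserves_expU₁ (t : ℝ) : Preserves (expU₁ t).mulVecLin := by
  constructor
  · intro x y z
    obtain ⟨a, ha⟩ := exists_eq_sqrt_two_mul (x 3)
    obtain ⟨b, hb⟩ := exists_eq_sqrt_two_mul (y 3)
    obtain ⟨c, hc⟩ := exists_eq_sqrt_two_mul (z 3)
    simp only [omega_eq, Matrix.mulVecLin_apply, expU₁_mulVec, ha, hb, hc, sqrt_two_mul_mul,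
      Matrix.cons_val]
    ring
  · intro x y
    obtain ⟨a, ha⟩ := exists_eq_sqrt_two_mul (x 3)
    obtain ⟨b, hb⟩ := exists_eq_sqrt_two_mul (y 3)
    simp only [ip_eq, Matrix.mulVecLin_apply, expU₁_mulVec, ha, hb, Matrix.cons_val,
      sqrt_two_mul_mul]
    ring_nf
    simp only [sqrt_two_sq]
    ring

theorem expU₁_mul_neg (t : ℝ) : expU₁ t * expU₁ (-t) = 1 := by
  refine Matrix.toLin'.injective (LinearMap.ext fun x => ?_)
  simp only [Matrix.toLin'_apply, ← Matrix.mulVec_mulVec, expU₁_mulVec, Matrix.one_mulVec]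
  ext i
  fin_cases i <;> simp
  ring_nf
  simp only [sqrt_two_sq]
  ring

/-- The unipotent matrix with parameter `t` in the direction of `u₂`. -/
def expU₂ (t : ℝ) : M7 :=
  !![1, -t, 0, 0, 0, 0, 0;
     0, 1, 0, 0, 0, 0, 0;
     0, 0, 1, √2 * t, 0, 0, t ^ 2;
     0, 0, 0, 1, 0, 0, √2 * t;
     0, 0, 0, 0, 1, 0, 0;
     0, 0, 0, 0, t, 1, 0;
     0, 0, 0, 0, 0, 0, 1]

theorem expU₂_mulVec (t : ℝ) (x : V) : (expU₂ t) *ᵥ x =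
    ![x 0 + (-t) * x 1, x 1, x 2 + (√2 * t) * x 3 + (t ^ 2) * x 6, x 3 + (√2 * t) * x 6, x 4, t * x 4 + x 5, x 6] := by
  ext i
  rw [mulVec7]
  fin_cases i <;> simp [expU₂]

theorem preserves_expU₂ (t : ℝ) : Preserves (expU₂ t).mulVecLin := by
  constructor
  · intro x y z
    obtain ⟨a, ha⟩ := exists_eq_sqrt_two_mul (x 3)
    obtain ⟨b, hb⟩ := exists_eq_sqrt_two_mul (y 3)
    obtain ⟨c, hc⟩ := exists_eq_sqrt_two_mul (z 3)
    simp only [omega_eq, Matrix.mulVecLin_apply, expU₂_mulVec, ha, hb, hc, sqrt_two_mul_mul,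
      Matrix.cons_val]
    ring
  · intro x y
    obtain ⟨a, ha⟩ := exists_eq_sqrt_two_mul (x 3)
    obtain ⟨b, hb⟩ := exists_eq_sqrt_two_mul (y 3)
    simp only [ip_eq, Matrix.mulVecLin_apply, expU₂_mulVec, ha, hb, Matrix.cons_val,
      sqrt_two_mul_mul]
    ring_nf
    simp only [sqrt_two_sq]
    ring

theorem expU₂_mul_neg (t : ℝ) : expU₂ t * expU₂ (-t) = 1 := by
  refine Matrix.toLin'.injective (LinearMap.ext fun x => ?_)
  simp only [Matrix.toLin'_apply, ← Matrix.mulVec_mulVec, expU₂_mulVec, Matrix.one_mulVec]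
  ext i
  fin_cases i <;> simp
  ring_nf
  simp only [sqrt_two_sq]
  ring

/-- The unipotent matrix with parameter `t` in the direction of `y₁`. -/
def expY₁ (t : ℝ) : M7 :=
  !![1, 0, 0, 0, 0, -t, 0;
     0, 1, 0, 0, t, 0, 0;
     0, 0, 1, 0, 0, 0, 0;
     0, 0, 0, 1, 0, 0, 0;
     0, 0, 0, 0, 1, 0, 0;
     0, 0, 0, 0, 0, 1, 0;
     0, 0, 0, 0, 0, 0, 1]

theorem expY₁_mulVec (t : ℝ) (x : V) : (expY₁ t) *ᵥ x =
    ![x 0 + (-t) * x 5, x 1 + t * x 4, x 2, x 3, x 4, x 5, x 6] := by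
  ext i
  rw [mulVec7]
  fin_cases i <;> simp [expY₁]

theorem preserves_expY₁ (t : ℝ) : Preserves (expY₁ t).mulVecLin := by
  constructor
  · intro x y z
    obtain ⟨a, ha⟩ := exists_eq_sqrt_two_mul (x 3)
    obtain ⟨b, hb⟩ := exists_eq_sqrt_two_mul (y 3)
    obtain ⟨c, hc⟩ := exists_eq_sqrt_two_mul (z 3)
    simp only [omega_eq, Matrix.mulVecLin_apply, expY₁_mulVec, ha, hb, hc, Matrix.cons_val]
    ring
  · intro x y
    obtain ⟨a, ha⟩ := exists_eq_sqrt_two_mul (x 3)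
    obtain ⟨b, hb⟩ := exists_eq_sqrt_two_mul (y 3)
    simp only [ip_eq, Matrix.mulVecLin_apply, expY₁_mulVec, ha, hb, Matrix.cons_val]
    ring

theorem expY₁_mul_neg (t : ℝ) : expY₁ t * expY₁ (-t) = 1 := by
  refine Matrix.toLin'.injective (LinearMap.ext fun x => ?_)
  simp only [Matrix.toLin'_apply, ← Matrix.mulVec_mulVec, expY₁_mulVec, Matrix.one_mulVec]
  ext i
  fin_cases i <;> simp

/-- The unipotent matrix with parameter `t` in the direction of `y₂`. -/
def expY₂ (t : ℝ) : M7 :=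
  !![1, 0, 0, 0, 0, 0, -t;
     0, 1, 0, 0, 0, 0, 0;
     0, 0, 1, 0, t, 0, 0;
     0, 0, 0, 1, 0, 0, 0;
     0, 0, 0, 0, 1, 0, 0;
     0, 0, 0, 0, 0, 1, 0;
     0, 0, 0, 0, 0, 0, 1]

theorem expY₂_mulVec (t : ℝ) (x : V) : (expY₂ t) *ᵥ x =
    ![x 0 + (-t) * x 6, x 1, x 2 + t * x 4, x 3, x 4, x 5, x 6] := by
  ext i
  rw [mulVec7]
  fin_cases i <;> simp [expY₂]

theorem preserves_expY₂ (t : ℝ) : Preserves (expY₂ t).mulVecLin := by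
  constructor
  · intro x y z
    obtain ⟨a, ha⟩ := exists_eq_sqrt_two_mul (x 3)
    obtain ⟨b, hb⟩ := exists_eq_sqrt_two_mul (y 3)
    obtain ⟨c, hc⟩ := exists_eq_sqrt_two_mul (z 3)
    simp only [omega_eq, Matrix.mulVecLin_apply, expY₂_mulVec, ha, hb, hc, Matrix.cons_val]
    ring
  · intro x y
    obtain ⟨a, ha⟩ := exists_eq_sqrt_two_mul (x 3)
    obtain ⟨b, hb⟩ := exists_eq_sqrt_two_mul (y 3)
    simp only [ip_eq, Matrix.mulVecLin_apply, expY₂_mulVec, ha, hb, Matrix.cons_val]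
    ring

theorem expY₂_mul_neg (t : ℝ) : expY₂ t * expY₂ (-t) = 1 := by
  refine Matrix.toLin'.injective (LinearMap.ext fun x => ?_)
  simp only [Matrix.toLin'_apply, ← Matrix.mulVec_mulVec, expY₂_mulVec, Matrix.one_mulVec]
  ext i
  fin_cases i <;> simp

/-- A symmetry of order three of the three-form. -/
def rot : M7 :=
  !![0, 0, 0, 0, 0, 1, 0;
     0, 0, 1, 0, 0, 0, 0;
     0, 0, 0, 0, 1, 0, 0;
     0, 0, 0, 1, 0, 0, 0;
     0, 1, 0, 0, 0, 0, 0;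
     0, 0, 0, 0, 0, 0, 1;
     1, 0, 0, 0, 0, 0, 0]

theorem rot_mulVec (x : V) : rot *ᵥ x =
    ![x 5, x 2, x 4, x 3, x 1, x 6, x 0] := by
  ext i
  rw [mulVec7]
  fin_cases i <;> simp [rot]

theorem preserves_rot : Preserves rot.mulVecLin := by
  constructor
  · intro x y z
    simp only [omega_eq, Matrix.mulVecLin_apply, rot_mulVec, Matrix.cons_val]
    ring
  · intro x y
    simp only [ip_eq, Matrix.mulVecLin_apply, rot_mulVec, Matrix.cons_val]
    ring

/-- A symmetry of order two of the three-form. -/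
def flip : M7 :=
  !![0, 0, 0, 0, 1, 0, 0;
     0, 0, 0, 0, 0, 1, 0;
     0, 0, 0, 0, 0, 0, 1;
     0, 0, 0, -1, 0, 0, 0;
     1, 0, 0, 0, 0, 0, 0;
     0, 1, 0, 0, 0, 0, 0;
     0, 0, 1, 0, 0, 0, 0]

theorem flip_mulVec (x : V) : flip *ᵥ x =
    ![x 4, x 5, x 6, -x 3, x 0, x 1, x 2] := by
  ext i
  rw [mulVec7]
  fin_cases i <;> simp [flip]

theorem preserves_flip : Preserves flip.mulVecLin := by
  constructor
  · intro x y z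
    simp only [omega_eq, Matrix.mulVecLin_apply, flip_mulVec, Matrix.cons_val]
    ring
  · intro x y
    simp only [ip_eq, Matrix.mulVecLin_apply, flip_mulVec, Matrix.cons_val]
    ring

theorem rot_mul_rot_mul_rot : rot * (rot * rot) = 1 := by
  refine Matrix.toLin'.injective (LinearMap.ext fun x => ?_)
  simp only [Matrix.toLin'_apply, ← Matrix.mulVec_mulVec, rot_mulVec, Matrix.one_mulVec]
  ext i
  fin_cases i <;> simp

theorem flip_mul_flip : flip * flip = 1 := by
  refine Matrix.toLin'.injective (LinearMap.ext fun x => ?_)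
  simp only [Matrix.toLin'_apply, ← Matrix.mulVec_mulVec, flip_mulVec, Matrix.one_mulVec]
  ext i
  fin_cases i <;> simp

/-- The matrix with which an element of `GL(2, ℝ)` with entries `p, q, r, s` and
inverse determinant `c` acts. -/
def levi (p q r s c : ℝ) : M7 :=
  !![p * s - q * r, 0, 0, 0, 0, 0, 0;
     0, p, q, 0, 0, 0, 0;
     0, r, s, 0, 0, 0, 0;
     0, 0, 0, 1, 0, 0, 0;
     0, 0, 0, 0, c, 0, 0;
     0, 0, 0, 0, 0, c * s, -(c * r);
     0, 0, 0, 0, 0, -(c * q), c * p]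

theorem levi_mulVec (p q r s c : ℝ) (x : V) : levi p q r s c *ᵥ x =
    ![(p * s - q * r) * x 0, p * x 1 + q * x 2, r * x 1 + s * x 2, x 3, c * x 4,
      c * s * x 5 - c * r * x 6, -(c * q) * x 5 + c * p * x 6] := by
  ext i
  rw [mulVec7]
  fin_cases i <;> simp [levi]
  ring

/-- `GL(2, ℝ)` acts on `e₁` by the determinant, on the span of `e₂, e₃` by the natural
representation, trivially on `e₄`, and on `e₅` and the span of `e₆, e₇` by the dual representations.
Each summand of the three-form and of the metric is then either a pairing with a dual or a product
of a determinant and its inverse. -/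
theorem preserves_levi {p q r s c : ℝ} (hc : (p * s - q * r) * c = 1) :
    Preserves (levi p q r s c).mulVecLin := by
  constructor
  · intro x y z
    simp only [omega_eq, Matrix.mulVecLin_apply, levi_mulVec, Matrix.cons_val]
    linear_combination (((p * s - q * r) * c + 1) *
      (√2 * (x 0 * (y 5 * z 6 - y 6 * z 5) - x 5 * (y 0 * z 6 - y 6 * z 0)
      + x 6 * (y 0 * z 5 - y 5 * z 0))) + √2 * (x 1 * (y 2 * z 4 - y 4 * z 2)
      - x 2 * (y 1 * z 4 - y 4 * z 1) + x 4 * (y 1 * z 2 - y 2 * z 1))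
      - ((x 3 * (y 0 * z 4 - y 4 * z 0) - x 0 * (y 3 * z 4 - y 4 * z 3)
      + x 4 * (y 3 * z 0 - y 0 * z 3))
      - (x 3 * (y 1 * z 5 - y 5 * z 1) - x 1 * (y 3 * z 5 - y 5 * z 3)
      + x 5 * (y 3 * z 1 - y 1 * z 3))
      - (x 3 * (y 2 * z 6 - y 6 * z 2) - x 2 * (y 3 * z 6 - y 6 * z 3)
      + x 6 * (y 3 * z 2 - y 2 * z 3)))) * hc
  · intro x y
    simp only [ip_eq, Matrix.mulVecLin_apply, levi_mulVec, Matrix.cons_val]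
    linear_combination ((x 0 * y 4 + x 4 * y 0) + (x 1 * y 5 + x 5 * y 1)
      + (x 2 * y 6 + x 6 * y 2)) * hc

theorem levi_mul_levi {p q r s c : ℝ} (hc : (p * s - q * r) * c = 1) :
    levi p q r s c * levi (c * s) (-(c * q)) (-(c * r)) (c * p) (p * s - q * r) = 1 := by
  refine Matrix.toLin'.injective (LinearMap.ext fun x => ?_)
  simp only [Matrix.toLin'_apply, ← Matrix.mulVec_mulVec, levi_mulVec, Matrix.one_mulVec]
  ext i
  fin_cases i <;> simp
  · linear_combination ((p * s - q * r) * c + 1) * x 0 * hc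
  · linear_combination x 1 * hc
  · linear_combination x 2 * hc
  · linear_combination x 4 * hc
  · linear_combination ((p * s - q * r) * c + 1) * x 5 * hc
  · linear_combination ((p * s - q * r) * c + 1) * x 6 * hc

/-! ### Null vectors -/

/-- The vectors `x` and `y` are in the same orbit of the stabiliser of the three-form. -/
def SameOrbit (x y : V) : Prop :=
  ∃ φ : V ≃ₗ[ℝ] V, Preserves φ.toLinearMap ∧ φ x = y

theorem SameOrbit.refl (x : V) : SameOrbit x x :=
  ⟨LinearEquiv.refl ℝ V, ⟨fun _ _ _ => rfl, fun _ _ => rfl⟩, rfl⟩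

theorem SameOrbit.trans {x y z : V} : SameOrbit x y → SameOrbit y z → SameOrbit x z := by
  rintro ⟨φ, hφ, rfl⟩ ⟨ψ, hψ, rfl⟩
  exact ⟨φ.trans ψ, Preserves.comp hψ hφ, rfl⟩

theorem SameOrbit.ip_self {x y : V} (h : SameOrbit x y) : ip y y = ip x x := by
  obtain ⟨φ, hφ, rfl⟩ := h
  exact hφ.2 x x

theorem sameOrbit_mulVec {P Q : M7} (hP : Preserves P.mulVecLin) (hPQ : P * Q = 1) (x : V) :
    SameOrbit x (P *ᵥ x) :=
  ⟨Matrix.toLin'OfInv (mul_eq_one_comm.1 hPQ) hPQ, hP, rfl⟩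

/-- Coordinate `4` serves as a pivot: the unipotent matrices clear the coordinates `5, 6, 3, 1, 2`,
and in this order no step disturbs an earlier one. Nullity then gives the vanishing of coordinate
`0`. -/
theorem exists_sameOrbit_of_apply_four_ne_zero {x : V} (hx : x 4 ≠ 0) (h0 : ip x x = 0) :
    ∃ c : ℝ, c ≠ 0 ∧ SameOrbit x (Pi.single 4 c) := by
  have h1 : ∃ y, SameOrbit x y ∧ y 4 = x 4 ∧ y 5 = 0 :=
    ⟨_, sameOrbit_mulVec (preserves_expU₂ (-(x 5 / x 4))) (expU₂_mul_neg _) x,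
      by simp [expU₂_mulVec], by simp [expU₂_mulVec]; field_simp; simp⟩
  obtain ⟨y, hy, y4, y5⟩ := h1
  have h2 : ∃ z, SameOrbit x z ∧ z 4 = x 4 ∧ z 5 = 0 ∧ z 6 = 0 :=
    ⟨_, hy.trans (sameOrbit_mulVec (preserves_expU₁ (y 6 / x 4)) (expU₁_mul_neg _) y),
      by simp [expU₁_mulVec, y4], by simp [expU₁_mulVec, y5],
      by simp [expU₁_mulVec, y4]; field_simp; simp⟩
  obtain ⟨z, hz, z4, z5, z6⟩ := h2
  have h3 : ∃ w, SameOrbit x w ∧ w 4 = x 4 ∧ w 5 = 0 ∧ w 6 = 0 ∧ w 3 = 0 := by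
    refine ⟨_, hz.trans (sameOrbit_mulVec (preserves_expV (-(z 3 / (√2 * x 4)))) (expV_mul_neg _) z),
      by simp [expV_mulVec, z4], by simp [expV_mulVec, z5], by simp [expV_mulVec, z6], ?_⟩
    simp [expV_mulVec, z4]; field_simp; simp
  obtain ⟨w, hw, w4, w5, w6, w3⟩ := h3
  have h4 : ∃ u, SameOrbit x u ∧ u 4 = x 4 ∧ u 5 = 0 ∧ u 6 = 0 ∧ u 3 = 0 ∧ u 1 = 0 := by
    refine ⟨_, hw.trans (sameOrbit_mulVec (preserves_expY₁ (-(w 1 / x 4))) (expY₁_mul_neg _) w),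
      by simp [expY₁_mulVec, w4], by simp [expY₁_mulVec, w5], by simp [expY₁_mulVec, w6],
      by simp [expY₁_mulVec, w3], ?_⟩
    simp [expY₁_mulVec, w4]; field_simp; simp
  obtain ⟨u, hu, u4, u5, u6, u3, u1⟩ := h4
  have h5 : ∃ u', SameOrbit x u' ∧ u' 4 = x 4 ∧ u' 5 = 0 ∧ u' 6 = 0 ∧ u' 3 = 0 ∧ u' 1 = 0 ∧
      u' 2 = 0 := by
    refine ⟨_, hu.trans (sameOrbit_mulVec (preserves_expY₂ (-(u 2 / x 4))) (expY₂_mul_neg _) u),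
      by simp [expY₂_mulVec, u4], by simp [expY₂_mulVec, u5], by simp [expY₂_mulVec, u6],
      by simp [expY₂_mulVec, u3], by simp [expY₂_mulVec, u1], ?_⟩
    simp [expY₂_mulVec, u4]; field_simp; simp
  obtain ⟨t, ht, t4, t5, t6, t3, t1, t2⟩ := h5
  have h6 := ht.ip_self
  rw [h0, ip_eq, t5, t6, t3, t4] at h6
  have t0 : t 0 = 0 := by
    have : t 0 * x 4 = 0 := by linarith
    exact (mul_eq_zero.1 this).resolve_right hx
  refine ⟨x 4, hx, ?_⟩
  have : t = Pi.single 4 (x 4) := by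
    ext i
    fin_cases i <;> simp [t0, t1, t2, t3, t4, t5, t6]
  rwa [this] at ht

/-- All null lines are in the same orbit. -/
theorem exists_sameOrbit_of_isotropic {x : V} (hx : x ≠ 0) (h0 : ip x x = 0) :
    ∃ c : ℝ, c ≠ 0 ∧ SameOrbit x (Pi.single 0 c) := by
  have hflip : ∀ x, SameOrbit x (flip *ᵥ x) := sameOrbit_mulVec preserves_flip flip_mul_flip
  have hrot : ∀ x, SameOrbit x (rot *ᵥ x) := sameOrbit_mulVec preserves_rot rot_mul_rot_mul_rot
  suffices H : ∃ y, SameOrbit x y ∧ y 4 ≠ 0 by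
    obtain ⟨y, hxy, hy⟩ := H
    obtain ⟨c, hc, hyc⟩ := exists_sameOrbit_of_apply_four_ne_zero hy (by rw [hxy.ip_self, h0])
    refine ⟨c, hc, hxy.trans (hyc.trans ?_)⟩
    have h1 := hflip (Pi.single 4 c)
    have h2 : flip *ᵥ Pi.single 4 c = (Pi.single 0 c : V) := by
      rw [flip_mulVec]
      ext i
      fin_cases i <;> simp
    rwa [h2] at h1
  -- If coordinate `4` vanishes on the whole orbit, so does coordinate `0`, by `flip`. The powers of
  -- `rot` move every other coordinate except `3` into one of these two places, and nullity disposes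
  -- of coordinate `3`.
  by_contra! H
  have h1 : ∀ y, SameOrbit x y → y 4 = 0 ∧ y 0 = 0 := by
    intro y hy
    refine ⟨H y hy, ?_⟩
    have := H _ (hy.trans (hflip y))
    simpa [flip_mulVec] using this
  have h2 := h1 x (SameOrbit.refl x)
  have h3 := h1 _ (hrot x)
  have h4 := h1 _ ((hrot x).trans (hrot _))
  simp only [rot_mulVec, Matrix.cons_val] at h3 h4
  apply hx
  have h5 : x 3 = 0 := by
    rw [ip_eq, h2.1, h2.2, h3.1, h3.2, h4.1, h4.2] at h0
    have : x 3 * x 3 = 0 := by linarith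
    exact mul_self_eq_zero.1 this
  ext i
  fin_cases i <;> simp [h2, h3, h4, h5]

/-! ### The socle -/

/-- If a generator were not null, the socle would be non-degenerate, hence equal to `V`, which has
dimension 7. By finite dimension a non-zero invariant subspace contains an irreducible one, which is
part of the socle and therefore equal to it. -/
theorem exists_socle_generator {h : LieSubalgebra ℝ (Module.End ℝ V)} (h_type : IsTypeI h)
    (h_indec : IsIndecomposable h) :
    ∃ l : V, l ≠ 0 ∧ ip l l = 0 ∧ (∀ X ∈ h, ∃ c : ℝ, X l = c • l) ∧
      ∀ W : Submodule ℝ V, (∀ X ∈ h, ∀ x ∈ W, X x ∈ W) → W ≠ ⊥ → l ∈ W := by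
  obtain ⟨⟨l, hl⟩, hl0, hspan⟩ := finrank_eq_one_iff'.1 h_type
  have hl0' : l ≠ 0 := fun h0 => hl0 (Subtype.ext h0)
  have hspan' : ∀ x ∈ socle h, ∃ c : ℝ, c • l = x := by
    intro x hx
    obtain ⟨c, hc⟩ := hspan ⟨x, hx⟩
    exact ⟨c, congrArg Subtype.val hc⟩
  refine ⟨l, hl0', ?_, ?_, ?_⟩
  · by_contra hne
    have hnd : (ip.restrict (socle h : Submodule ℝ V)).Nondegenerate := by
      have key : ∀ x ∈ socle h, (ip x l = 0 ∨ ip l x = 0) → x = 0 := by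
        intro x hx h0
        obtain ⟨c, rfl⟩ := hspan' x hx
        simp only [map_smul, LinearMap.smul_apply, smul_eq_mul, mul_eq_zero, or_self, hne,
          or_false] at h0
        simp [h0]
      exact ⟨fun x hx => Subtype.ext (key _ x.2 (Or.inl (hx ⟨l, hl⟩))),
        fun x hx => Subtype.ext (key _ x.2 (Or.inr (hx ⟨l, hl⟩)))⟩
    rcases h_indec _ hnd with h1 | h1
    · rw [h1] at hl
      exact hl0' (by simpa using hl)
    · have h2 : Module.finrank ℝ (socle h) = 7 := by
        rw [h1]
        have : Module.finrank ℝ (⊤ : Submodule ℝ V) = 7 := by simp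
        exact this
      rw [IsTypeI] at h_type
      omega
  · intro X hX
    obtain ⟨c, hc⟩ := hspan' _ ((socle h).lie_mem (x := ⟨X, hX⟩) hl)
    exact ⟨c, hc.symm⟩
  · intro W hW hne
    let W' : LieSubmodule ℝ h V := { W with lie_mem := fun {X x} hx => hW X.1 X.2 x hx }
    have hne' : W' ≠ ⊥ := by
      intro h0
      apply hne
      rw [Submodule.eq_bot_iff]
      intro x hx
      have : x ∈ W' := hx
      rw [h0] at this
      simpa using this
    obtain ⟨A, hA, hAW⟩ := (eq_bot_or_exists_atom_le W').resolve_left hne'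
    have hAs : A ≤ socle h := le_sSup hA
    obtain ⟨x, hx, hx0⟩ := (Submodule.ne_bot_iff (A : Submodule ℝ V)).1 (by simpa using hA.1)
    obtain ⟨c, rfl⟩ := hspan' x (hAs hx)
    have hc : c ≠ 0 := fun h0 => hx0 (by simp [h0])
    have : c⁻¹ • c • l ∈ A := A.smul_mem _ hx
    rw [smul_smul, inv_mul_cancel₀ hc, one_smul] at this
    exact hAW this

theorem sqrt_two_mul_sqrt_two_mul (a : ℝ) : √2 * (√2 * a) = 2 * a := by
  linear_combination a * sqrt_two_sq

set_option maxHeartbeats 800000 in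
set_option linter.unusedSimpArgs false in
/-- The elements of `𝔤₂*` that preserve the line spanned by the first basis vector lie
in `𝔥ᴵ`. -/
theorem mem_hI_of_derivation {M : M7}
    (hM : ∀ x y z : V, omega (M *ᵥ x) y z + omega x (M *ᵥ y) z + omega x y (M *ᵥ z) = 0)
    (hcol : ∀ i, i ≠ 0 → M i 0 = 0) : M ∈ hI := by
  have hD := fun i j k : Fin 7 => hM (Pi.single i 1) (Pi.single j 1) (Pi.single k 1)
  have hs : √2 ≠ 0 := by simp
  have c1 := hcol 1 (by decide)
  have c2 := hcol 2 (by decide)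
  have c3 := hcol 3 (by decide)
  have c4 := hcol 4 (by decide)
  have c5 := hcol 5 (by decide)
  have c6 := hcol 6 (by decide)
  clear hM hcol
  -- Rescaling the row and the column of `e₄` makes all equations below linear with rational
  -- coefficients.
  obtain ⟨w0, hw0⟩ := exists_eq_sqrt_two_mul (M 0 3)
  obtain ⟨w1, hw1⟩ := exists_eq_sqrt_two_mul (M 1 3)
  obtain ⟨w2, hw2⟩ := exists_eq_sqrt_two_mul (M 2 3)
  obtain ⟨w4, hw4⟩ := exists_eq_sqrt_two_mul (M 4 3)
  obtain ⟨w5, hw5⟩ := exists_eq_sqrt_two_mul (M 5 3)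
  obtain ⟨w6, hw6⟩ := exists_eq_sqrt_two_mul (M 6 3)
  obtain ⟨z1, hz1⟩ := exists_eq_sqrt_two_mul (M 3 1)
  obtain ⟨z2, hz2⟩ := exists_eq_sqrt_two_mul (M 3 2)
  obtain ⟨z4, hz4⟩ := exists_eq_sqrt_two_mul (M 3 4)
  obtain ⟨z5, hz5⟩ := exists_eq_sqrt_two_mul (M 3 5)
  obtain ⟨z6, hz6⟩ := exists_eq_sqrt_two_mul (M 3 6)
  -- The digits name the three basis vectors on which the derivation identity is evaluated.
  have e013 : - M 4 1 = 0 := by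
    have := hD 0 1 3
    simp [omega_eq, Pi.single_apply, c1, c2, c3, c4, c5, c6, hw0, hw1, hw2, hw4, hw5, hw6,
      hz1, hz2, hz4, hz5, hz6, sqrt_two_mul_sqrt_two_mul] at this
    linarith
  have e014 : z1 = 0 := by
    have := hD 0 1 4
    simp [omega_eq, Pi.single_apply, c1, c2, c3, c4, c5, c6, hw0, hw1, hw2, hw4, hw5, hw6,
      hz1, hz2, hz4, hz5, hz6, sqrt_two_mul_sqrt_two_mul] at this
    linarith
  have e015 : - M 6 1 = 0 := by
    have := hD 0 1 5
    simp [omega_eq, Pi.single_apply, c1, c2, c3, c4, c5, c6, hw0, hw1, hw2, hw4, hw5, hw6,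
      hz1, hz2, hz4, hz5, hz6, sqrt_two_mul_sqrt_two_mul] at this
    linarith
  have e016 : M 5 1 = 0 := by
    have := hD 0 1 6
    simp [omega_eq, Pi.single_apply, c1, c2, c3, c4, c5, c6, hw0, hw1, hw2, hw4, hw5, hw6,
      hz1, hz2, hz4, hz5, hz6, sqrt_two_mul_sqrt_two_mul] at this
    linarith
  have e023 : - M 4 2 = 0 := by
    have := hD 0 2 3
    simp [omega_eq, Pi.single_apply, c1, c2, c3, c4, c5, c6, hw0, hw1, hw2, hw4, hw5, hw6,
      hz1, hz2, hz4, hz5, hz6, sqrt_two_mul_sqrt_two_mul] at this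
    linarith
  have e024 : z2 = 0 := by
    have := hD 0 2 4
    simp [omega_eq, Pi.single_apply, c1, c2, c3, c4, c5, c6, hw0, hw1, hw2, hw4, hw5, hw6,
      hz1, hz2, hz4, hz5, hz6, sqrt_two_mul_sqrt_two_mul] at this
    linarith
  have e025 : - M 6 2 = 0 := by
    have := hD 0 2 5
    simp [omega_eq, Pi.single_apply, c1, c2, c3, c4, c5, c6, hw0, hw1, hw2, hw4, hw5, hw6,
      hz1, hz2, hz4, hz5, hz6, sqrt_two_mul_sqrt_two_mul] at this
    linarith
  have e026 : M 5 2 = 0 := by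
    have := hD 0 2 6
    simp [omega_eq, Pi.single_apply, c1, c2, c3, c4, c5, c6, hw0, hw1, hw2, hw4, hw5, hw6,
      hz1, hz2, hz4, hz5, hz6, sqrt_two_mul_sqrt_two_mul] at this
    linarith
  have e034 : M 0 0 + M 3 3 + M 4 4 = 0 := by
    have := hD 0 3 4
    simp [omega_eq, Pi.single_apply, c1, c2, c3, c4, c5, c6, hw0, hw1, hw2, hw4, hw5, hw6,
      hz1, hz2, hz4, hz5, hz6, sqrt_two_mul_sqrt_two_mul] at this
    linarith
  have e035 : - 2 * w6 + M 4 5 = 0 := by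
    have := hD 0 3 5
    simp [omega_eq, Pi.single_apply, c1, c2, c3, c4, c5, c6, hw0, hw1, hw2, hw4, hw5, hw6,
      hz1, hz2, hz4, hz5, hz6, sqrt_two_mul_sqrt_two_mul] at this
    linarith
  have e036 : 2 * w5 + M 4 6 = 0 := by
    have := hD 0 3 6
    simp [omega_eq, Pi.single_apply, c1, c2, c3, c4, c5, c6, hw0, hw1, hw2, hw4, hw5, hw6,
      hz1, hz2, hz4, hz5, hz6, sqrt_two_mul_sqrt_two_mul] at this
    linarith
  have e045 : - M 6 4 - z5 = 0 := by
    have := hD 0 4 5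
    simp [omega_eq, Pi.single_apply, c1, c2, c3, c4, c5, c6, hw0, hw1, hw2, hw4, hw5, hw6,
      hz1, hz2, hz4, hz5, hz6, sqrt_two_mul_sqrt_two_mul] at this
    exact mul_left_cancel₀ hs (by linear_combination this)
  have e046 : M 5 4 - z6 = 0 := by
    have := hD 0 4 6
    simp [omega_eq, Pi.single_apply, c1, c2, c3, c4, c5, c6, hw0, hw1, hw2, hw4, hw5, hw6,
      hz1, hz2, hz4, hz5, hz6, sqrt_two_mul_sqrt_two_mul] at this
    exact mul_left_cancel₀ hs (by linear_combination this)
  have e056 : M 0 0 + M 5 5 + M 6 6 = 0 := by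
    have := hD 0 5 6
    simp [omega_eq, Pi.single_apply, c1, c2, c3, c4, c5, c6, hw0, hw1, hw2, hw4, hw5, hw6,
      hz1, hz2, hz4, hz5, hz6, sqrt_two_mul_sqrt_two_mul] at this
    exact mul_left_cancel₀ hs (by linear_combination this)
  have e123 : - M 6 1 + M 5 2 + 2 * w4 = 0 := by
    have := hD 1 2 3
    simp [omega_eq, Pi.single_apply, c1, c2, c3, c4, c5, c6, hw0, hw1, hw2, hw4, hw5, hw6,
      hz1, hz2, hz4, hz5, hz6, sqrt_two_mul_sqrt_two_mul] at this
    linarith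
  have e124 : M 1 1 + M 2 2 + M 4 4 = 0 := by
    have := hD 1 2 4
    simp [omega_eq, Pi.single_apply, c1, c2, c3, c4, c5, c6, hw0, hw1, hw2, hw4, hw5, hw6,
      hz1, hz2, hz4, hz5, hz6, sqrt_two_mul_sqrt_two_mul] at this
    exact mul_left_cancel₀ hs (by linear_combination this)
  have e125 : - z2 + M 4 5 = 0 := by
    have := hD 1 2 5
    simp [omega_eq, Pi.single_apply, c1, c2, c3, c4, c5, c6, hw0, hw1, hw2, hw4, hw5, hw6,
      hz1, hz2, hz4, hz5, hz6, sqrt_two_mul_sqrt_two_mul] at this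
    exact mul_left_cancel₀ hs (by linear_combination this)
  have e126 : z1 + M 4 6 = 0 := by
    have := hD 1 2 6
    simp [omega_eq, Pi.single_apply, c1, c2, c3, c4, c5, c6, hw0, hw1, hw2, hw4, hw5, hw6,
      hz1, hz2, hz4, hz5, hz6, sqrt_two_mul_sqrt_two_mul] at this
    exact mul_left_cancel₀ hs (by linear_combination this)
  have e134 : M 0 1 + 2 * w2 - M 5 4 = 0 := by
    have := hD 1 3 4
    simp [omega_eq, Pi.single_apply, c1, c2, c3, c4, c5, c6, hw0, hw1, hw2, hw4, hw5, hw6,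
      hz1, hz2, hz4, hz5, hz6, sqrt_two_mul_sqrt_two_mul] at this
    linarith
  have e135 : - M 1 1 - M 3 3 - M 5 5 = 0 := by
    have := hD 1 3 5
    simp [omega_eq, Pi.single_apply, c1, c2, c3, c4, c5, c6, hw0, hw1, hw2, hw4, hw5, hw6,
      hz1, hz2, hz4, hz5, hz6, sqrt_two_mul_sqrt_two_mul] at this
    linarith
  have e136 : - M 2 1 - M 5 6 = 0 := by
    have := hD 1 3 6
    simp [omega_eq, Pi.single_apply, c1, c2, c3, c4, c5, c6, hw0, hw1, hw2, hw4, hw5, hw6,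
      hz1, hz2, hz4, hz5, hz6, sqrt_two_mul_sqrt_two_mul] at this
    linarith
  have e145 : - z4 - M 2 5 = 0 := by
    have := hD 1 4 5
    simp [omega_eq, Pi.single_apply, c1, c2, c3, c4, c5, c6, hw0, hw1, hw2, hw4, hw5, hw6,
      hz1, hz2, hz4, hz5, hz6, sqrt_two_mul_sqrt_two_mul] at this
    exact mul_left_cancel₀ hs (by linear_combination this)
  have e146 : - M 2 6 = 0 := by
    have := hD 1 4 6
    simp [omega_eq, Pi.single_apply, c1, c2, c3, c4, c5, c6, hw0, hw1, hw2, hw4, hw5, hw6,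
      hz1, hz2, hz4, hz5, hz6, sqrt_two_mul_sqrt_two_mul] at this
    linarith
  have e156 : M 0 1 + z6 = 0 := by
    have := hD 1 5 6
    simp [omega_eq, Pi.single_apply, c1, c2, c3, c4, c5, c6, hw0, hw1, hw2, hw4, hw5, hw6,
      hz1, hz2, hz4, hz5, hz6, sqrt_two_mul_sqrt_two_mul] at this
    exact mul_left_cancel₀ hs (by linear_combination this)
  have e234 : M 0 2 - 2 * w1 - M 6 4 = 0 := by
    have := hD 2 3 4
    simp [omega_eq, Pi.single_apply, c1, c2, c3, c4, c5, c6, hw0, hw1, hw2, hw4, hw5, hw6,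
      hz1, hz2, hz4, hz5, hz6, sqrt_two_mul_sqrt_two_mul] at this
    linarith
  have e235 : - M 1 2 - M 6 5 = 0 := by
    have := hD 2 3 5
    simp [omega_eq, Pi.single_apply, c1, c2, c3, c4, c5, c6, hw0, hw1, hw2, hw4, hw5, hw6,
      hz1, hz2, hz4, hz5, hz6, sqrt_two_mul_sqrt_two_mul] at this
    linarith
  have e236 : - M 2 2 - M 3 3 - M 6 6 = 0 := by
    have := hD 2 3 6
    simp [omega_eq, Pi.single_apply, c1, c2, c3, c4, c5, c6, hw0, hw1, hw2, hw4, hw5, hw6,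
      hz1, hz2, hz4, hz5, hz6, sqrt_two_mul_sqrt_two_mul] at this
    linarith
  have e245 : M 1 5 = 0 := by
    have := hD 2 4 5
    simp [omega_eq, Pi.single_apply, c1, c2, c3, c4, c5, c6, hw0, hw1, hw2, hw4, hw5, hw6,
      hz1, hz2, hz4, hz5, hz6, sqrt_two_mul_sqrt_two_mul] at this
    linarith
  have e246 : - z4 + M 1 6 = 0 := by
    have := hD 2 4 6
    simp [omega_eq, Pi.single_apply, c1, c2, c3, c4, c5, c6, hw0, hw1, hw2, hw4, hw5, hw6,
      hz1, hz2, hz4, hz5, hz6, sqrt_two_mul_sqrt_two_mul] at this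
    exact mul_left_cancel₀ hs (by linear_combination this)
  have e256 : M 0 2 - z5 = 0 := by
    have := hD 2 5 6
    simp [omega_eq, Pi.single_apply, c1, c2, c3, c4, c5, c6, hw0, hw1, hw2, hw4, hw5, hw6,
      hz1, hz2, hz4, hz5, hz6, sqrt_two_mul_sqrt_two_mul] at this
    exact mul_left_cancel₀ hs (by linear_combination this)
  have e345 : M 1 4 + M 0 5 = 0 := by
    have := hD 3 4 5
    simp [omega_eq, Pi.single_apply, c1, c2, c3, c4, c5, c6, hw0, hw1, hw2, hw4, hw5, hw6,
      hz1, hz2, hz4, hz5, hz6, sqrt_two_mul_sqrt_two_mul] at this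
    linarith
  have e346 : M 2 4 + M 0 6 = 0 := by
    have := hD 3 4 6
    simp [omega_eq, Pi.single_apply, c1, c2, c3, c4, c5, c6, hw0, hw1, hw2, hw4, hw5, hw6,
      hz1, hz2, hz4, hz5, hz6, sqrt_two_mul_sqrt_two_mul] at this
    linarith
  have e356 : 2 * w0 + M 2 5 - M 1 6 = 0 := by
    have := hD 3 5 6
    simp [omega_eq, Pi.single_apply, c1, c2, c3, c4, c5, c6, hw0, hw1, hw2, hw4, hw5, hw6,
      hz1, hz2, hz4, hz5, hz6, sqrt_two_mul_sqrt_two_mul] at this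
    linarith
  have e456 : M 0 4 = 0 := by
    have := hD 4 5 6
    simp [omega_eq, Pi.single_apply, c1, c2, c3, c4, c5, c6, hw0, hw1, hw2, hw4, hw5, hw6,
      hz1, hz2, hz4, hz5, hz6, sqrt_two_mul_sqrt_two_mul] at this
    linarith
  clear hD
  obtain rfl : w0 = M 1 6 := by linarith
  obtain rfl : w1 = M 0 2 := by linarith
  obtain rfl : w2 = -M 0 1 := by linarith
  obtain rfl : w4 = 0 := by linarith
  obtain rfl : w5 = 0 := by linarith
  obtain rfl : w6 = 0 := by linarith
  obtain rfl : z1 = 0 := by linarith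
  obtain rfl : z2 = 0 := by linarith
  obtain rfl : z4 = M 1 6 := by linarith
  obtain rfl : z5 = M 0 2 := by linarith
  obtain rfl : z6 = -M 0 1 := by linarith
  have m00 : M 0 0 = M 1 1 + M 2 2 := by linarith
  have m33 : M 3 3 = 0 := by linarith
  have m44 : M 4 4 = -(M 1 1 + M 2 2) := by linarith
  have m55 : M 5 5 = -M 1 1 := by linarith
  have m56 : M 5 6 = -M 2 1 := by linarith
  have m65 : M 6 5 = -M 1 2 := by linarith
  have m66 : M 6 6 = -M 2 2 := by linarith
  have m04 : M 0 4 = 0 := by linarith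
  have m05 : M 0 5 = -M 1 4 := by linarith
  have m06 : M 0 6 = -M 2 4 := by linarith
  have m15 : M 1 5 = 0 := by linarith
  have m25 : M 2 5 = -M 1 6 := by linarith
  have m26 : M 2 6 = 0 := by linarith
  have m41 : M 4 1 = 0 := by linarith
  have m42 : M 4 2 = 0 := by linarith
  have m45 : M 4 5 = 0 := by linarith
  have m46 : M 4 6 = 0 := by linarith
  have m51 : M 5 1 = 0 := by linarith
  have m52 : M 5 2 = 0 := by linarith
  have m54 : M 5 4 = -M 0 1 := by linarith
  have m61 : M 6 1 = 0 := by linarith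
  have m62 : M 6 2 = 0 := by linarith
  have m64 : M 6 4 = -M 0 2 := by linarith
  refine ⟨(!![M 1 1, M 1 2; M 2 1, M 2 2], M 1 6, ![M 0 2, - M 0 1], ![M 1 4, M 2 4]), ?_⟩
  ext i j
  fin_cases i <;> fin_cases j <;>
    simp [hLin, hMat, Matrix.trace_fin_two, c1, c2, c3, c4, c5, c6, hw0, hw1, hw2, hw4, hw5, hw6,
      hz1, hz2, hz4, hz5, hz6, m00, m33, m44, m55, m56, m65, m66, m04, m05, m06, m15, m25, m26, m41, m42, m45, m46, m51, m52, m54, m61, m62, m64]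

/-! ### Reduction to subalgebras of `𝔥ᴵ` -/

section
variable {h : LieSubalgebra ℝ (Module.End ℝ V)} {k : Submodule ℝ M7}

theorem apply_zero_of_mem_hI {M : M7} (hM : M ∈ hI) {i : Fin 7} (hi : i ≠ 0) : M i 0 = 0 := by
  obtain ⟨p, rfl⟩ := hM
  fin_cases i <;> first | exact absurd rfl hi | simp [hLin, hMat]

theorem mulVec_single_of_mem_hI {M : M7} (hM : M ∈ hI) :
    M *ᵥ Pi.single 0 1 = M 0 0 • (Pi.single 0 1 : V) := by
  ext i
  by_cases hi : i = 0
  · subst hi; simp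
  · simp [hi, apply_zero_of_mem_hI hM hi]

/-- `k` is the space of matrices of `h` with respect to an adapted basis and it is contained
in `𝔥ᴵ`. -/
structure IsHIForm (h : LieSubalgebra ℝ (Module.End ℝ V)) (k : Submodule ℝ M7) : Prop where
  form : IsForm h k
  le : k ≤ hI

/-- The inverse of an automorphism that takes the socle generator to a multiple of `e₁` gives an
adapted basis whose first vector spans the socle. -/
theorem exists_isHIForm (h_sub : h ≤ g2star) (h_indec : IsIndecomposable h)
    (h_type : IsTypeI h) : ∃ k, IsHIForm h k := by
  obtain ⟨l, hl0, hl, hinv, -⟩ := exists_socle_generator h_type h_indec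
  obtain ⟨c, hc, φ, hφ, hφl⟩ := exists_sameOrbit_of_isotropic hl0 hl
  have hk : IsForm h (h.toSubmodule.comap (conjEnd φ.symm)) := ⟨φ.symm, hφ.symm, rfl⟩
  refine ⟨_, hk, fun M hM => mem_hI_of_derivation (hk.derivation h_sub hM) fun i hi => ?_⟩
  obtain ⟨d, hd⟩ := hinv _ hM
  have h1 := conjEnd_apply φ.symm M (φ l)
  rw [LinearEquiv.symm_apply_apply, hd] at h1
  have h2 : M *ᵥ φ l = d • φ l := by rw [← map_smul, h1]; simp
  rw [hφl] at h2
  have h3 := congrFun h2 i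
  have h4 : (Pi.single 0 c : V) = c • Pi.single 0 1 := by rw [← Pi.single_smul]; simp
  rw [h4, Matrix.mulVec_smul] at h3
  simpa [hi, hc] using h3

/-- Inclusion in `𝔥ᴵ` makes `ℝ e₁` invariant, so it contains the socle generator and is spanned by
it. The property therefore survives every later change of basis that stays inside `𝔥ᴵ`. -/
theorem IsHIForm.single_mem (hk : IsHIForm h k) (h_indec : IsIndecomposable h)
    (h_type : IsTypeI h) (W : Submodule ℝ V) (hW : ∀ M ∈ k, ∀ x ∈ W, M *ᵥ x ∈ W) (hne : W ≠ ⊥) :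
    Pi.single 0 1 ∈ W := by
  obtain ⟨l, hl0, -, -, hmem⟩ := exists_socle_generator h_type h_indec
  obtain ⟨⟨φ, hφ, rfl⟩, hle⟩ := hk
  have aux : ∀ U : Submodule ℝ V,
      (∀ M ∈ h.toSubmodule.comap (conjEnd φ), ∀ x ∈ U, M *ᵥ x ∈ U) → U ≠ ⊥ → φ.symm l ∈ U := by
    intro U hU hU0
    have h1 : l ∈ U.map φ.toLinearMap := by
      refine hmem _ ?_ ?_
      · rintro X hX _ ⟨x, hx, rfl⟩
        obtain ⟨M, rfl⟩ := conjEnd_surjective φ X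
        exact ⟨M *ᵥ x, hU M hX x hx, (conjEnd_apply φ M x).symm⟩
      · rw [Ne, Submodule.map_eq_bot_iff]
        · exact hU0
    obtain ⟨x, hx, rfl⟩ := h1
    simpa using hx
  have h0 : φ.symm l ≠ 0 := by simpa using hl0
  have h1 := aux W hW hne
  have h2 : φ.symm l ∈ Submodule.span ℝ {(Pi.single 0 1 : V)} := by
    refine aux _ ?_ (by simp)
    intro M hM x hx
    obtain ⟨c, rfl⟩ := Submodule.mem_span_singleton.1 hx
    rw [Matrix.mulVec_smul, mulVec_single_of_mem_hI (hle hM)]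
    exact Submodule.smul_mem _ _ (Submodule.smul_mem _ _ (Submodule.mem_span_singleton_self _))
  obtain ⟨c, hc⟩ := Submodule.mem_span_singleton.1 h2
  have hc0 : c ≠ 0 := by
    rintro rfl
    exact h0 (by rw [← hc, zero_smul])
  rw [← hc] at h1
  have := W.smul_mem c⁻¹ h1
  rwa [smul_smul, inv_mul_cancel₀ hc0, one_smul] at this

/-- `P` and `Q` both preserve the line `ℝ e₁`, and for elements of `𝔤₂*` the invariance of this line
suffices to lie in `𝔥ᴵ`. -/
theorem IsHIForm.conj (hk : IsHIForm h k) (h_sub : h ≤ g2star) {P Q : M7}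
    (hP : Preserves P.mulVecLin) (hPQ : P * Q = 1) (hP0 : ∀ i, i ≠ 0 → P i 0 = 0)
    (hQ0 : ∀ i, i ≠ 0 → Q i 0 = 0) : IsHIForm h (k.comap (conjMat P Q)) := by
  have hQP := mul_eq_one_comm.1 hPQ
  have hk' := hk.form.conj hP hPQ hQP
  refine ⟨hk', fun M hM => mem_hI_of_derivation (hk'.derivation h_sub hM) fun i hi => ?_⟩
  have hX := fun i hi => apply_zero_of_mem_hI (i := i) (hk.le hM) hi
  generalize hXM : conjMat P Q M = X at hX
  have hcol : ∀ (A B : M7), (∀ i, i ≠ 0 → A i 0 = 0) → (∀ i, i ≠ 0 → B i 0 = 0) →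
      ∀ i, i ≠ 0 → (A * B) i 0 = 0 := by
    intro A B hA hB i hi
    rw [Matrix.mul_apply]
    refine Finset.sum_eq_zero fun j _ => ?_
    by_cases hj : j = 0
    · subst hj; rw [hA i hi, zero_mul]
    · rw [hB j hj, mul_zero]
  have hM' : M = Q * X * P := by
    rw [← hXM, conjMat_apply]
    simp only [← mul_assoc, hQP, one_mul]
    rw [mul_assoc, hQP, mul_one]
  rw [hM']
  exact hcol _ _ (hcol _ _ hQ0 hX) hP0 i hi

end

/-! ### The matrices `h(A, v, u, y)` in coordinates -/

/-- The matrix `h(A, v, u, y)` in terms of the entries of its arguments. -/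
def hc (a b c d v p q y z : ℝ) : M7 := hMat !![a, b; c, d] v ![p, q] ![y, z]

theorem hMat_eq_hc (A : M2) (v : ℝ) (u y : Fin 2 → ℝ) : hMat A v u y =
    hc (A 0 0) (A 0 1) (A 1 0) (A 1 1) v (u 0) (u 1) (y 0) (y 1) := by
  simp [hc, hMat, Matrix.trace_fin_two]

theorem hc_eq (a b c d v p q y z : ℝ) : hc a b c d v p q y z =
  !![a + d, -q, p, √2 * v, 0, -y, -z;
     0, a, b, √2 * p, y, 0, v;
     0, c, d, √2 * q, z, -v, 0;
     0, 0, 0, 0, √2 * v, √2 * p, √2 * q;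
     0, 0, 0, 0, -(a + d), 0, 0;
     0, 0, 0, 0, q, -a, -c;
     0, 0, 0, 0, -p, -b, -d] := by
  simp [hc, hMat, Matrix.trace_fin_two]

theorem exists_hc_of_mem_hI {M : M7} (hM : M ∈ hI) :
    ∃ a b c d v p q y z, M = hc a b c d v p q y z := by
  obtain ⟨x, rfl⟩ := hM
  exact ⟨_, _, _, _, _, _, _, _, _, hMat_eq_hc _ _ _ _⟩

theorem hc_inj {a b c d v p q y z a' b' c' d' v' p' q' y' z' : ℝ}
    (H : hc a b c d v p q y z = hc a' b' c' d' v' p' q' y' z') :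
    a = a' ∧ b = b' ∧ c = c' ∧ d = d' ∧ v = v' ∧ p = p' ∧ q = q' ∧ y = y' ∧ z = z' := by
  rw [hc_eq, hc_eq] at H
  have e := fun i j => congrFun (congrFun H i) j
  have e1 := e 1 1
  have e2 := e 1 2
  have e3 := e 2 1
  have e4 := e 2 2
  have e5 := e 1 6
  have e6 := e 0 2
  have e7 := e 0 1
  have e8 := e 1 4
  have e9 := e 2 4
  simp at e1 e2 e3 e4 e5 e6 e7 e8 e9
  exact ⟨e1, e2, e3, e4, e5, e6, e7, e8, e9⟩

theorem hc_add (a b c d v p q y z a' b' c' d' v' p' q' y' z' : ℝ) :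
    hc a b c d v p q y z + hc a' b' c' d' v' p' q' y' z' =
      hc (a + a') (b + b') (c + c') (d + d') (v + v') (p + p') (q + q') (y + y') (z + z') := by
  have := hLin.map_add (!![a, b; c, d], v, ![p, q], ![y, z])
    (!![a', b'; c', d'], v', ![p', q'], ![y', z'])
  simpa [hLin, hc] using this.symm

theorem smul_hc (t a b c d v p q y z : ℝ) : t • hc a b c d v p q y z =
    hc (t * a) (t * b) (t * c) (t * d) (t * v) (t * p) (t * q) (t * y) (t * z) := by
  have := hLin.map_smul t (!![a, b; c, d], v, ![p, q], ![y, z])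
  simpa [hLin, hc] using this.symm

theorem mul7 (M M' : M7) (i j : Fin 7) : (M * M') i j = M i 0 * M' 0 j + M i 1 * M' 1 j +
    M i 2 * M' 2 j + M i 3 * M' 3 j + M i 4 * M' 4 j + M i 5 * M' 5 j + M i 6 * M' 6 j := by
  simp [Matrix.mul_apply, Fin.sum_univ_seven]

/-- The bracket is graded, with `A`, `u`, `v`, `y` in degrees 0, 1, 2, 3: two `u`-parts pair to `v`
by their determinant, and `v` times `u` lands in `y`. The later arguments about generation are
computations with this formula. -/
theorem hc_lie (a b c d v p q y z a' b' c' d' v' p' q' y' z' : ℝ) :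
    ⁅hc a b c d v p q y z, hc a' b' c' d' v' p' q' y' z'⁆ =
      hc (b * c' - b' * c) (a * b' + b * d' - a' * b - b' * d) (c * a' + d * c' - c' * a - d' * c)
        (c * b' - c' * b) ((a + d) * v' - (a' + d') * v + 2 * (p * q' - q * p'))
        (a * p' + b * q' - a' * p - b' * q) (c * p' + d * q' - c' * p - d' * q)
        ((2 * a + d) * y' + b * z' - (2 * a' + d') * y - b' * z + 3 * (v' * p - v * p'))
        (c * y' + (a + 2 * d) * z' - c' * y - (a' + 2 * d') * z + 3 * (v' * q - v * q')) := by
  ext i j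
  rw [LieRing.of_associative_ring_bracket, Matrix.sub_apply, mul7, mul7]
  simp only [hc_eq]
  fin_cases i <;> fin_cases j <;> simp [sqrt_two_mul_mul] <;> ring

theorem conjMat_eq_of_mul_eq {P Q M M' : M7} (hPQ : P * Q = 1) (H : P * M = M' * P) :
    conjMat P Q M = M' := by
  rw [conjMat_apply, H, mul_assoc, hPQ, mul_one]

theorem conj_expV (t a b c d v p q y z : ℝ) :
    conjMat (expV t) (expV (-t)) (hc a b c d v p q y z) =
      hc a b c d (v - (a + d) * t) p q (y - 3 * t * p) (z - 3 * t * q) := by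
  refine conjMat_eq_of_mul_eq (expV_mul_neg t) ?_
  ext i j
  rw [mul7, mul7]
  simp only [hc_eq, expV]
  fin_cases i <;> fin_cases j <;> simp [sqrt_two_mul_mul] <;> ring

theorem conj_expU₁ (t a b c d v p q y z : ℝ) :
    conjMat (expU₁ t) (expU₁ (-t)) (hc a b c d v p q y z) =
      hc a b c d (v + 2 * t * q - c * t ^ 2) (p - a * t) (q - c * t)
        (y + 3 * t * v + 3 * t ^ 2 * q - c * t ^ 3) z := by
  refine conjMat_eq_of_mul_eq (expU₁_mul_neg t) ?_
  ext i j
  rw [mul7, mul7]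
  simp only [hc_eq, expU₁]
  fin_cases i <;> fin_cases j <;> simp [sqrt_two_mul_mul] <;> ring

theorem conj_expU₂ (t a b c d v p q y z : ℝ) :
    conjMat (expU₂ t) (expU₂ (-t)) (hc a b c d v p q y z) =
      hc a b c d (v - 2 * t * p + b * t ^ 2) (p - b * t) (q - d * t)
        y (z + 3 * t * v - 3 * t ^ 2 * p + b * t ^ 3) := by
  refine conjMat_eq_of_mul_eq (expU₂_mul_neg t) ?_
  ext i j
  rw [mul7, mul7]
  simp only [hc_eq, expU₂]
  fin_cases i <;> fin_cases j <;> simp [sqrt_two_mul_mul] <;> ring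

theorem conj_levi {p q r s e : ℝ} (he : (p * s - q * r) * e = 1) (a b c d v u₁ u₂ y₁ y₂ : ℝ) :
    conjMat (levi p q r s e) (levi (e * s) (-(e * q)) (-(e * r)) (e * p) (p * s - q * r))
        (hc a b c d v u₁ u₂ y₁ y₂) =
      hc (e * ((p * a + q * c) * s - (p * b + q * d) * r))
        (e * ((p * b + q * d) * p - (p * a + q * c) * q))
        (e * ((r * a + s * c) * s - (r * b + s * d) * r))
        (e * ((r * b + s * d) * p - (r * a + s * c) * q))
        ((p * s - q * r) * v) (p * u₁ + q * u₂) (r * u₁ + s * u₂)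
        ((p * s - q * r) * (p * y₁ + q * y₂)) ((p * s - q * r) * (r * y₁ + s * y₂)) := by
  refine conjMat_eq_of_mul_eq (levi_mul_levi he) ?_
  ext i j
  rw [mul7, mul7]
  simp only [hc_eq, levi]
  fin_cases i <;> fin_cases j <;> simp <;> try ring1
  · linear_combination -((p * s - q * r) * (a + d)) * he
  · linear_combination -(-((p * s - q * r) * y₁)) * he
  · linear_combination -(-((p * s - q * r) * y₂)) * he
  · linear_combination -(p * a + q * c) * he
  · linear_combination -(p * b + q * d) * he
  · linear_combination -(p * y₁ + q * y₂) * he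
  · linear_combination -(q * v) * he
  · linear_combination -(p * v) * he
  · linear_combination -(r * a + s * c) * he
  · linear_combination -(r * b + s * d) * he
  · linear_combination -(r * y₁ + s * y₂) * he
  · linear_combination -(s * v) * he
  · linear_combination -(r * v) * he
  · linear_combination -(√2 * v) * he
  · linear_combination -(√2 * u₁) * he
  · linear_combination -(√2 * u₂) * he
  · linear_combination -(e * (-d + -a)) * he
  · linear_combination -(-(e * s * a) + e * r * b) * he
  · linear_combination -(-(e * s * c) + e * r * d) * he
  · linear_combination -(e * q * a + -(e * p * b)) * he
  · linear_combination -(e * q * c + -(e * p * d)) * he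

section
variable {h : LieSubalgebra ℝ (Module.End ℝ V)} {k : Submodule ℝ M7}

theorem IsHIForm.exists_hc (hk : IsHIForm h k) {M : M7} (hM : M ∈ k) :
    ∃ a b c d v p q y z, M = hc a b c d v p q y z ∧ hc a b c d v p q y z ∈ k := by
  obtain ⟨a, b, c, d, v, p, q, y, z, rfl⟩ := exists_hc_of_mem_hI (hk.le hM)
  exact ⟨a, b, c, d, v, p, q, y, z, rfl, hM⟩

theorem IsHIForm.lie_mem (hk : IsHIForm h k) {M M' : M7} (hM : M ∈ k) (hM' : M' ∈ k) :
    ⁅M, M'⁆ ∈ k :=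
  hk.form.lie_mem hM hM'

/-! ### Changes of the adapted basis -/

theorem IsHIForm.exists_expV (hk : IsHIForm h k) (h_sub : h ≤ g2star) (t : ℝ) :
    ∃ k', IsHIForm h k' ∧ ∀ a b c d v p q y z, hc a b c d v p q y z ∈ k' ↔
      hc a b c d (v - (a + d) * t) p q (y - 3 * t * p) (z - 3 * t * q) ∈ k := by
  refine ⟨_, hk.conj h_sub (preserves_expV t) (expV_mul_neg t) ?_ ?_, ?_⟩
  · intro i hi; fin_cases i <;> first | exact absurd rfl hi | simp [expV]
  · intro i hi; fin_cases i <;> first | exact absurd rfl hi | simp [expV]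
  · intros; rw [Submodule.mem_comap, conj_expV]

theorem IsHIForm.exists_expU₁ (hk : IsHIForm h k) (h_sub : h ≤ g2star) (t : ℝ) :
    ∃ k', IsHIForm h k' ∧ ∀ a b c d v p q y z, hc a b c d v p q y z ∈ k' ↔
      hc a b c d (v + 2 * t * q - c * t ^ 2) (p - a * t) (q - c * t)
        (y + 3 * t * v + 3 * t ^ 2 * q - c * t ^ 3) z ∈ k := by
  refine ⟨_, hk.conj h_sub (preserves_expU₁ t) (expU₁_mul_neg t) ?_ ?_, ?_⟩
  · intro i hi; fin_cases i <;> first | exact absurd rfl hi | simp [expU₁]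
  · intro i hi; fin_cases i <;> first | exact absurd rfl hi | simp [expU₁]
  · intros; rw [Submodule.mem_comap, conj_expU₁]

theorem IsHIForm.exists_expU₂ (hk : IsHIForm h k) (h_sub : h ≤ g2star) (t : ℝ) :
    ∃ k', IsHIForm h k' ∧ ∀ a b c d v p q y z, hc a b c d v p q y z ∈ k' ↔
      hc a b c d (v - 2 * t * p + b * t ^ 2) (p - b * t) (q - d * t)
        y (z + 3 * t * v - 3 * t ^ 2 * p + b * t ^ 3) ∈ k := by
  refine ⟨_, hk.conj h_sub (preserves_expU₂ t) (expU₂_mul_neg t) ?_ ?_, ?_⟩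
  · intro i hi; fin_cases i <;> first | exact absurd rfl hi | simp [expU₂]
  · intro i hi; fin_cases i <;> first | exact absurd rfl hi | simp [expU₂]
  · intros; rw [Submodule.mem_comap, conj_expU₂]

theorem IsHIForm.exists_levi (hk : IsHIForm h k) (h_sub : h ≤ g2star) {P Q : M2}
    (hPQ : P * Q = 1) : ∃ k', IsHIForm h k' ∧ ∀ A v u y, hMat A v u y ∈ k' ↔
      hMat (P * A * Q) (P.det * v) (P *ᵥ u) (P.det • P *ᵥ y) ∈ k := by
  have hdet : P.det * Q.det = 1 := by rw [← Matrix.det_mul, hPQ, Matrix.det_one]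
  -- `levi` is given by the entries of `P` and its inverse determinant, so `Q` has to be expressed
  -- through these.
  have hQ : Q = Q.det • P.adjugate := by
    calc Q = Q.det • (P.det • Q) := by rw [smul_smul, mul_comm, hdet, one_smul]
      _ = Q.det • ((P.adjugate * P) * Q) := by rw [Matrix.adjugate_mul]; simp
      _ = Q.det • P.adjugate := by rw [mul_assoc, hPQ, mul_one]
  generalize Q.det = e at hdet hQ
  subst hQ
  rw [Matrix.det_fin_two] at *
  refine ⟨_, hk.conj h_sub (preserves_levi hdet) (levi_mul_levi hdet) ?_ ?_, ?_⟩
  · intro i hi; fin_cases i <;> first | exact absurd rfl hi | simp [levi]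
  · intro i hi; fin_cases i <;> first | exact absurd rfl hi | simp [levi]
  · intro A v u y
    rw [Submodule.mem_comap, hMat_eq_hc, conj_levi hdet, hMat_eq_hc]
    simp only [Matrix.mul_apply, Fin.sum_univ_two, Matrix.adjugate_fin_two, Matrix.smul_apply,
      Matrix.mulVec, dotProduct, Pi.smul_apply, smul_eq_mul, Matrix.of_apply, Matrix.cons_val]
    have : ∀ M M' : M7, M = M' → (M ∈ k ↔ M' ∈ k) := by rintro M _ rfl; rfl
    apply this
    congr 1 <;> ring

/-! ### Consequences of Type I -/

theorem hc_mulVec (a b c d v p q y z : ℝ) (x : V) : hc a b c d v p q y z *ᵥ x =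
    ![(a + d) * x 0 - q * x 1 + p * x 2 + √2 * v * x 3 - y * x 5 - z * x 6,
      a * x 1 + b * x 2 + √2 * p * x 3 + y * x 4 + v * x 6,
      c * x 1 + d * x 2 + √2 * q * x 3 + z * x 4 - v * x 5,
      √2 * v * x 4 + √2 * p * x 5 + √2 * q * x 6, -(a + d) * x 4,
      q * x 4 - a * x 5 - c * x 6, -p * x 4 - b * x 5 - d * x 6] := by
  ext i
  rw [mulVec7, hc_eq]
  fin_cases i <;> simp <;> ring

/-- The equations in `H` express that the line through `l e₁ + w₁ e₂ + w₂ e₃` is invariant, and this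
line does not contain `e₁`. -/
theorem IsHIForm.not_forall_eigenvector (hk : IsHIForm h k) (h_indec : IsIndecomposable h)
    (h_type : IsTypeI h) {w₁ w₂ : ℝ} (hw : w₁ ≠ 0 ∨ w₂ ≠ 0) (l : ℝ)
    (H : ∀ a b c d v p q y z, hc a b c d v p q y z ∈ k → ∃ μ : ℝ, a * w₁ + b * w₂ = μ * w₁ ∧
      c * w₁ + d * w₂ = μ * w₂ ∧ p * w₂ - q * w₁ + (a + d) * l = μ * l) : False := by
  have h1 := hk.single_mem h_indec h_type (Submodule.span ℝ {![l, w₁, w₂, 0, 0, 0, 0]}) ?_ ?_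
  · obtain ⟨t, ht⟩ := Submodule.mem_span_singleton.1 h1
    have e0 := congrFun ht 0
    have e1 := congrFun ht 1
    have e2 := congrFun ht 2
    simp at e0 e1 e2
    rcases hw with hw | hw <;> simp_all
  · intro M hM x hx
    obtain ⟨t, rfl⟩ := Submodule.mem_span_singleton.1 hx
    obtain ⟨a, b, c, d, v, p, q, y, z, rfl, hM⟩ := hk.exists_hc hM
    obtain ⟨μ, h1, h2, h3⟩ := H _ _ _ _ _ _ _ _ _ hM
    rw [Matrix.mulVec_smul]
    refine Submodule.smul_mem _ _ (Submodule.mem_span_singleton.2 ⟨μ, ?_⟩)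
    rw [hc_mulVec]
    ext i
    fin_cases i <;> simp <;> linarith
  · rw [Ne, Submodule.span_singleton_eq_bot]
    intro h0
    have e1 := congrFun h0 1
    have e2 := congrFun h0 2
    simp at e1 e2
    simp_all

/-- The equations in `H` express that the plane spanned by `e₂ + l₁ e₁` and `e₃ + l₂ e₁` is
invariant, and this plane does not contain `e₁`. -/
theorem IsHIForm.not_forall_coboundary (hk : IsHIForm h k) (h_indec : IsIndecomposable h)
    (h_type : IsTypeI h) (l₁ l₂ : ℝ)
    (H : ∀ a b c d v p q y z, hc a b c d v p q y z ∈ k →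
      p = b * l₁ - a * l₂ ∧ q = d * l₁ - c * l₂) : False := by
  have h1 := hk.single_mem h_indec h_type
    (Submodule.span ℝ {![l₁, 1, 0, 0, 0, 0, 0], ![l₂, 0, 1, 0, 0, 0, 0]}) ?_ ?_
  · obtain ⟨s, t, ht⟩ := Submodule.mem_span_pair.1 h1
    have e0 := congrFun ht 0
    have e1 := congrFun ht 1
    have e2 := congrFun ht 2
    simp at e0 e1 e2
    simp_all
  · intro M hM x hx
    obtain ⟨s, t, rfl⟩ := Submodule.mem_span_pair.1 hx
    obtain ⟨a, b, c, d, v, p, q, y, z, rfl, hM⟩ := hk.exists_hc hM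
    obtain ⟨rfl, rfl⟩ := H _ _ _ _ _ _ _ _ _ hM
    refine Submodule.mem_span_pair.2 ⟨s * a + t * b, s * c + t * d, ?_⟩
    rw [hc_mulVec]
    ext i
    fin_cases i <;> simp <;> ring
  · intro h0
    have : (![l₁, 1, 0, 0, 0, 0, 0] : V) ∈ (⊥ : Submodule ℝ V) := by
      rw [← h0]; exact Submodule.subset_span (by simp)
    have e1 := congrFun ((Submodule.mem_bot ℝ).1 this) 1
    simp at e1

/-! ### The intersection with `𝔪` -/

theorem hc_mem_mAll (v p q y z : ℝ) : hc 0 0 0 0 v p q y z ∈ mAll := by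
  refine ⟨(v, ![p, q], ![y, z]), ?_⟩
  simp [hLin, hMat_eq_hc]

theorem exists_hc_of_mem_mAll {M : M7} (hM : M ∈ mAll) :
    ∃ v p q y z, M = hc 0 0 0 0 v p q y z := by
  obtain ⟨x, rfl⟩ := hM
  refine ⟨x.1, x.2.1 0, x.2.1 1, x.2.2 0, x.2.2 1, ?_⟩
  simp [hLin, hMat_eq_hc]

/-- With `δ` the determinant of the two `u`-parts, the bracket has `v`-component `2δ` and no
`u`-component. Bracketing it with the given elements puts multiples of their `u`-parts, and nothing
else, into `y`. This yields all of `y`, then `v`, then `u`. -/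
theorem IsHIForm.mAll_le_of_independent (hk : IsHIForm h k) {v p q y z v' p' q' y' z' : ℝ}
    (h1 : hc 0 0 0 0 v p q y z ∈ k) (h2 : hc 0 0 0 0 v' p' q' y' z' ∈ k)
    (hne : p * q' - q * p' ≠ 0) : mAll ≤ k := by
  obtain ⟨i, hi⟩ : ∃ i, (p * q' - q * p') * i = 1 := ⟨_, mul_inv_cancel₀ hne⟩
  generalize hδ : p * q' - q * p' = δ at hi
  have h3 : hc 0 0 0 0 (2 * δ) 0 0 (3 * (v' * p - v * p')) (3 * (v' * q - v * q')) ∈ k := by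
    have := hk.lie_mem h1 h2
    rw [hc_lie] at this
    convert this using 1
    subst hδ
    congr 1 <;> ring
  have h4 : ∀ {v'' p'' q'' y'' z''}, hc 0 0 0 0 v'' p'' q'' y'' z'' ∈ k →
      hc 0 0 0 0 0 0 0 (δ * p'') (δ * q'') ∈ k := by
    intro v'' p'' q'' y'' z'' h''
    have := k.smul_mem (-1 / 6) (hk.lie_mem h3 h'')
    rw [hc_lie, smul_hc] at this
    convert this using 1
    congr 1 <;> ring
  have hY : ∀ r s, hc 0 0 0 0 0 0 0 r s ∈ k := by
    intro r s
    have := k.add_mem (k.smul_mem ((r * q' - s * p') * i * i) (h4 h1))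
      (k.smul_mem ((s * p - r * q) * i * i) (h4 h2))
    rw [smul_hc, smul_hc, hc_add] at this
    convert this using 1
    congr 1
    iterate 7 ring
    · linear_combination -(r * (δ * i + 1)) * hi - r * i ^ 2 * δ * hδ
    · linear_combination -(s * (δ * i + 1)) * hi - s * i ^ 2 * δ * hδ
  have hV : ∀ t, hc 0 0 0 0 t 0 0 0 0 ∈ k := by
    intro t
    have := k.add_mem (k.smul_mem (t / 2 * i) h3)
      (hY (-(t / 2 * i * (3 * (v' * p - v * p')))) (-(t / 2 * i * (3 * (v' * q - v * q')))))
    rw [smul_hc, hc_add] at this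
    convert this using 1
    congr 1
    iterate 4 ring
    · linear_combination -t * hi
    all_goals ring
  intro M hM
  obtain ⟨v₀, r, s, y₀, z₀, rfl⟩ := exists_hc_of_mem_mAll hM
  have := k.add_mem (k.smul_mem ((r * q' - s * p') * i) h1)
    (k.smul_mem ((s * p - r * q) * i) h2)
  rw [smul_hc, smul_hc, hc_add] at this
  have := k.add_mem (k.add_mem this (hV (v₀ - ((r * q' - s * p') * i * v +
    (s * p - r * q) * i * v')))) (hY (y₀ - ((r * q' - s * p') * i * y
    + (s * p - r * q) * i * y')) (z₀ - ((r * q' - s * p') * i * z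
    + (s * p - r * q) * i * z')))
  rw [hc_add, hc_add] at this
  convert this using 1
  congr 1
  iterate 5 ring
  · linear_combination -r * hi - r * i * hδ
  · linear_combination -s * hi - s * i * hδ
  all_goals ring

/-- The cases are the dimensions 2, 0 and 1 of the space `U` of `u`-components of `k ∩ 𝔪`; in the
last case `(w₁, w₂)` spans `U`. -/
theorem IsHIForm.trichotomy (hk : IsHIForm h k) :
    mAll ≤ k ∨ (∀ v p q y z, hc 0 0 0 0 v p q y z ∈ k → p = 0 ∧ q = 0) ∨
      ∃ w₁ w₂ v y z, (w₁ ≠ 0 ∨ w₂ ≠ 0) ∧ hc 0 0 0 0 v w₁ w₂ y z ∈ k ∧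
        ∀ v p q y z, hc 0 0 0 0 v p q y z ∈ k → p * w₂ = q * w₁ := by
  by_cases h0 : ∀ v p q y z, hc 0 0 0 0 v p q y z ∈ k → p = 0 ∧ q = 0
  · exact Or.inr (Or.inl h0)
  push Not at h0
  obtain ⟨v, w₁, w₂, y, z, hw, hw0⟩ := h0
  by_cases h1 : ∀ v p q y z, hc 0 0 0 0 v p q y z ∈ k → p * w₂ = q * w₁
  · exact Or.inr (Or.inr ⟨w₁, w₂, v, y, z, by tauto, hw, h1⟩)
  push Not at h1
  obtain ⟨v', p', q', y', z', h', hne⟩ := h1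
  exact Or.inl (hk.mAll_le_of_independent h' hw (sub_ne_zero.2 hne))

/-- By `H`, the `u`-component modulo `U` is the coboundary of `u₀ = (p₀, q₀)`. For `U = 0` this
gives an invariant complement of `ℝ e₁` in the span of `e₁, e₂, e₃`; for `U = ℝ w` it gives an
invariant line over `w`. Both contradict Type I. -/
theorem IsHIForm.mAll_le_of_coboundary (hk : IsHIForm h k) (h_indec : IsIndecomposable h)
    (h_type : IsTypeI h) (p₀ q₀ : ℝ)
    (H : ∀ a b c d v p q y z, hc a b c d v p q y z ∈ k → ∃ v' y' z',
      hc 0 0 0 0 v' (p - a * p₀ - b * q₀) (q - c * p₀ - d * q₀) y' z' ∈ k) : mAll ≤ k := by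
  rcases hk.trichotomy with h0 | h0 | ⟨w₁, w₂, v, y, z, hw0, hw, h0⟩
  · exact h0
  · refine (hk.not_forall_coboundary h_indec h_type q₀ (-p₀) ?_).elim
    intro a b c d v p q y z hM
    obtain ⟨v', y', z', h1⟩ := H _ _ _ _ _ _ _ _ _ hM
    have := h0 _ _ _ _ _ h1
    constructor <;> linarith
  · refine (hk.not_forall_eigenvector h_indec h_type hw0 (-(p₀ * w₂ - q₀ * w₁)) ?_).elim
    intro a b c d v p q y z hM
    obtain ⟨v', y', z', h1⟩ := H _ _ _ _ _ _ _ _ _ hM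
    have h2 := h0 _ _ _ _ _ h1
    have h3 := hk.lie_mem hM hw
    rw [hc_lie] at h3
    simp only [mul_zero, zero_mul, sub_zero, add_zero] at h3
    have h4 := h0 _ _ _ _ _ h3
    have h5 : ∃ μ, a * w₁ + b * w₂ = μ * w₁ ∧ c * w₁ + d * w₂ = μ * w₂ := by
      rcases hw0 with hw0 | hw0
      · refine ⟨(a * w₁ + b * w₂) / w₁, by field_simp, ?_⟩
        field_simp; linarith
      · refine ⟨(c * w₁ + d * w₂) / w₂, ?_, by field_simp⟩
        field_simp; linarith
    obtain ⟨μ, h5, h6⟩ := h5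
    exact ⟨μ, h5, h6, by linear_combination h2 - p₀ * h6 + q₀ * h5⟩

end

section
variable {h : LieSubalgebra ℝ (Module.End ℝ V)} {k : Submodule ℝ M7}

/-! ### The projection to `𝔤𝔩(2, ℝ)` -/

theorem mem_proj {A : M2} : A ∈ proj k ↔
    ∃ v p q y z, hc (A 0 0) (A 0 1) (A 1 0) (A 1 1) v p q y z ∈ k := by
  simp only [proj, Submodule.mem_map, Submodule.mem_comap]
  constructor
  · rintro ⟨x, hx, rfl⟩
    refine ⟨x.2.1, x.2.2.1 0, x.2.2.1 1, x.2.2.2 0, x.2.2.2 1, ?_⟩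
    rw [LinearMap.fst_apply, ← hMat_eq_hc]
    exact hx
  · rintro ⟨v, p, q, y, z, hx⟩
    refine ⟨(A, v, ![p, q], ![y, z]), ?_, rfl⟩
    rw [hc, ← Matrix.eta_fin_two] at hx
    exact hx

theorem mem_proj_of {a b c d v p q y z : ℝ} (hM : hc a b c d v p q y z ∈ k) :
    !![a, b; c, d] ∈ proj k :=
  mem_proj.2 ⟨v, p, q, y, z, by simpa using hM⟩

theorem exists_hc_of_mem_proj {a b c d : ℝ} (hA : !![a, b; c, d] ∈ proj k) :
    ∃ v p q y z, hc a b c d v p q y z ∈ k := by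
  simpa using mem_proj.1 hA

theorem mem_emb {a : Submodule ℝ M2} {M : M7} : M ∈ emb a ↔
    ∃ A ∈ a, M = hc (A 0 0) (A 0 1) (A 1 0) (A 1 1) 0 0 0 0 0 := by
  simp only [emb, Submodule.mem_map]
  constructor
  · rintro ⟨A, hA, rfl⟩
    exact ⟨A, hA, hMat_eq_hc _ _ _ _⟩
  · rintro ⟨A, hA, rfl⟩
    exact ⟨A, hA, hMat_eq_hc _ _ _ _⟩

theorem IsHIForm.lie_mem_proj (hk : IsHIForm h k) {A B : M2} (hA : A ∈ proj k)
    (hB : B ∈ proj k) : ⁅A, B⁆ ∈ proj k := by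
  obtain ⟨v, p, q, y, z, hA⟩ := mem_proj.1 hA
  obtain ⟨v', p', q', y', z', hB⟩ := mem_proj.1 hB
  have := hk.lie_mem hA hB
  rw [hc_lie] at this
  convert mem_proj_of this using 1
  ext i j
  rw [LieRing.of_associative_ring_bracket]
  fin_cases i <;> fin_cases j <;> simp [Matrix.mul_apply, Fin.sum_univ_two] <;> ring

theorem IsHIForm.isSemidirect_of_mAll_le (hk : IsHIForm h k) (hm : mAll ≤ k) :
    IsSemidirect k (emb (proj k)) mAll := by
  have hemb : emb (proj k) ≤ k := by
    intro M hM
    obtain ⟨A, hA, rfl⟩ := mem_emb.1 hM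
    obtain ⟨v, p, q, y, z, hA⟩ := mem_proj.1 hA
    have := k.add_mem hA (hm (hc_mem_mAll (-v) (-p) (-q) (-y) (-z)))
    rw [hc_add] at this
    convert this using 1
    congr 1 <;> ring
  refine ⟨le_antisymm ?_ (sup_le hemb hm), ?_, ?_, ?_⟩
  · intro M hM
    obtain ⟨a, b, c, d, v, p, q, y, z, rfl, hM⟩ := hk.exists_hc hM
    refine Submodule.mem_sup.2 ⟨hc a b c d 0 0 0 0 0, mem_emb.2 ⟨_, mem_proj_of hM, by simp⟩,
      _, hc_mem_mAll v p q y z, ?_⟩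
    rw [hc_add]
    simp
  · rw [Submodule.disjoint_def]
    intro M h1 h2
    obtain ⟨A, hA, rfl⟩ := mem_emb.1 h1
    obtain ⟨v, p, q, y, z, h2⟩ := exists_hc_of_mem_mAll h2
    obtain ⟨e1, e2, e3, e4, -⟩ := hc_inj h2
    rw [e1, e2, e3, e4]
    have := smul_hc 0 0 0 0 0 0 0 0 0 0
    rw [zero_smul] at this
    simpa using this.symm
  · intro X hX Y hY
    have hXY := hk.lie_mem (hemb hX) (hemb hY)
    obtain ⟨A, hA, rfl⟩ := mem_emb.1 hX
    obtain ⟨B, hB, rfl⟩ := mem_emb.1 hY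
    rw [hc_lie] at hXY ⊢
    refine mem_emb.2 ⟨_, mem_proj_of hXY, ?_⟩
    simp
  · intro X hX Y hY
    obtain ⟨a, b, c, d, v, p, q, y, z, rfl, -⟩ := hk.exists_hc hX
    obtain ⟨v', p', q', y', z', rfl⟩ := exists_hc_of_mem_mAll hY
    rw [hc_lie]
    convert hc_mem_mAll _ _ _ _ _ using 1
    congr 1
    iterate 4 ring
    all_goals rfl

/-- Only the `u`-part of an element of `k ∩ 𝔪` matters in many arguments; this tidies it up and
forgets the rest. -/
theorem exists_hc_of_eq {a b c d v p q y z p' q' : ℝ} (hM : hc a b c d v p q y z ∈ k)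
    (ha : a = 0) (hb : b = 0) (hc' : c = 0) (hd : d = 0) (hp : p = p') (hq : q = q') :
    ∃ v y z, hc 0 0 0 0 v p' q' y z ∈ k := by
  subst ha hb hc' hd hp hq
  exact ⟨v, y, z, hM⟩

/-! ### Projections for which the algebra contains `𝔪` -/

/-- The bracket with a lift of the identity removes `A` and changes `u` into `u - A u₀`, where `u₀`
is the `u`-component of the lift. -/
theorem IsHIForm.mAll_le_of_one_mem (hk : IsHIForm h k) (h_indec : IsIndecomposable h)
    (h_type : IsTypeI h) (h1 : (1 : M2) ∈ proj k) : mAll ≤ k := by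
  obtain ⟨v₀, p₀, q₀, y₀, z₀, h1⟩ := mem_proj.1 h1
  refine hk.mAll_le_of_coboundary h_indec h_type p₀ q₀ ?_
  intro a b c d v p q y z hM
  have := hk.lie_mem h1 hM
  rw [hc_lie] at this
  simp only [Matrix.one_apply] at this
  norm_num at this
  exact exists_hc_of_eq this (by ring) (by ring) (by ring) (by ring) (by ring) (by ring)

theorem IsHIForm.mAll_le_of_proj_eq_bot (hk : IsHIForm h k) (h_indec : IsIndecomposable h)
    (h_type : IsTypeI h) (h1 : proj k = ⊥) : mAll ≤ k := by
  refine hk.mAll_le_of_coboundary h_indec h_type 0 0 ?_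
  intro a b c d v p q y z hM
  have h2 := mem_proj_of hM
  rw [h1, Submodule.mem_bot] at h2
  have e := fun i j => congrFun (congrFun h2 i) j
  have e1 : a = 0 := by simpa using e 0 0
  have e2 : b = 0 := by simpa using e 0 1
  have e3 : c = 0 := by simpa using e 1 0
  have e4 : d = 0 := by simpa using e 1 1
  subst e1 e2 e3 e4
  exact ⟨v, y, z, by simpa using hM⟩

theorem mem_line {A B : M2} : B ∈ line A ↔ ∃ t : ℝ, t • A = B :=
  Submodule.mem_span_singleton

/-- A cocycle on the line through `A` is determined by its value at `A`, and it is the coboundary of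
`A⁻¹` applied to that value. The variable `i` is the inverse determinant. -/
theorem IsHIForm.mAll_le_of_proj_eq_line (hk : IsHIForm h k) (h_indec : IsIndecomposable h)
    (h_type : IsTypeI h) {A : M2} (h1 : proj k = line A) (hA : A.det ≠ 0) : mAll ≤ k := by
  have h2 : A ∈ proj k := by rw [h1]; exact Submodule.mem_span_singleton_self _
  obtain ⟨v₀, p₀, q₀, y₀, z₀, h2⟩ := mem_proj.1 h2
  rw [Matrix.det_fin_two] at hA
  generalize hα : A 0 0 = α at *
  generalize hβ : A 0 1 = β at *
  generalize hγ : A 1 0 = γ at *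
  generalize hδ : A 1 1 = δ at *
  obtain ⟨i, hi⟩ : ∃ i, (α * δ - β * γ) * i = 1 := ⟨_, mul_inv_cancel₀ hA⟩
  refine hk.mAll_le_of_coboundary h_indec h_type (i * (δ * p₀ - β * q₀))
    (i * (α * q₀ - γ * p₀)) ?_
  intro a b c d v p q y z hM
  have h3 := mem_proj_of hM
  rw [h1, mem_line] at h3
  obtain ⟨t, ht⟩ := h3
  have e := fun i j => congrFun (congrFun ht i) j
  have e1 : t * α = a := by simpa [hα] using e 0 0
  have e2 : t * β = b := by simpa [hβ] using e 0 1
  have e3 : t * γ = c := by simpa [hγ] using e 1 0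
  have e4 : t * δ = d := by simpa [hδ] using e 1 1
  subst e1 e2 e3 e4
  refine ⟨v - t * v₀, y - t * y₀, z - t * z₀, ?_⟩
  have := k.add_mem hM (k.smul_mem (-t) h2)
  rw [smul_hc, hc_add] at this
  convert this using 1
  congr 1
  iterate 4 ring
  · ring
  · linear_combination -t * p₀ * hi
  · linear_combination -t * q₀ * hi
  · ring
  · ring

theorem mem_sl2 {a b c d : ℝ} : !![a, b; c, d] ∈ sl2 ↔ a + d = 0 := by
  simp [sl2, Matrix.trace_fin_two]

/-- The first Whitehead lemma for `ℝ²/U`, done by hand: `(p₁, -q₁)` solves the coboundary equation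
at `H = diag(1,-1)`, and the relations `[H, E] = 2E` and `[H, F] = -2F` show that it solves it at
`E` and `F` modulo `U`. -/
theorem IsHIForm.mAll_le_of_proj_eq_sl2 (hk : IsHIForm h k) (h_indec : IsIndecomposable h)
    (h_type : IsTypeI h) (h1 : proj k = sl2) : mAll ≤ k := by
  have h2 : ∀ a b c d : ℝ, a + d = 0 → ∃ v p q y z, hc a b c d v p q y z ∈ k := by
    intro a b c d hA
    rw [← mem_sl2 (b := b) (c := c), ← h1] at hA
    exact exists_hc_of_mem_proj hA
  obtain ⟨v₁, p₁, q₁, y₁, z₁, hH⟩ := h2 1 0 0 (-1) (by norm_num)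
  obtain ⟨v₂, p₂, q₂, y₂, z₂, hE⟩ := h2 0 1 0 0 (by norm_num)
  obtain ⟨v₃, p₃, q₃, y₃, z₃, hF⟩ := h2 0 0 1 0 (by norm_num)
  have hu : ∀ {v p q y z}, hc 0 0 0 0 v p q y z ∈ k → ∃ v' y' z', hc 0 0 0 0 v' p (-q) y' z' ∈ k := by
    intro v p q y z hM
    have := hk.lie_mem hH hM
    rw [hc_lie] at this
    norm_num at this
    exact ⟨_, _, _, this⟩
  -- `[H, E] - 2E` has `u`-part `(-(p₂ + q₁), -3q₂)`. Since `U` is stable under `diag(1,-1)`, the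
  -- two coordinates can be rescaled independently.
  obtain ⟨v₄, y₄, z₄, h4⟩ : ∃ v' y' z', hc 0 0 0 0 v' (p₂ + q₁) q₂ y' z' ∈ k := by
    have := k.add_mem (hk.lie_mem hH hE) (k.smul_mem (-2) hE)
    rw [hc_lie, smul_hc, hc_add] at this
    norm_num at this
    obtain ⟨_, _, _, h'⟩ := hu this
    have := k.add_mem (k.smul_mem (-2 / 3) this) (k.smul_mem (-1 / 3) h')
    rw [smul_hc, smul_hc, hc_add] at this
    exact exists_hc_of_eq this (by ring) (by ring) (by ring) (by ring) (by ring) (by ring)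
  obtain ⟨v₅, y₅, z₅, h5⟩ : ∃ v' y' z', hc 0 0 0 0 v' p₃ (q₃ - p₁) y' z' ∈ k := by
    have := k.add_mem (hk.lie_mem hH hF) (k.smul_mem 2 hF)
    rw [hc_lie, smul_hc, hc_add] at this
    norm_num at this
    obtain ⟨_, _, _, h'⟩ := hu this
    have := k.add_mem (k.smul_mem (2 / 3) this) (k.smul_mem (-1 / 3) h')
    rw [smul_hc, smul_hc, hc_add] at this
    exact exists_hc_of_eq this (by ring) (by ring) (by ring) (by ring) (by ring) (by ring)
  refine hk.mAll_le_of_coboundary h_indec h_type p₁ (-q₁) ?_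
  intro a b c d v p q y z hM
  have h3 := mem_proj_of hM
  rw [h1, mem_sl2] at h3
  obtain rfl : d = -a := by linarith
  have := k.add_mem (k.add_mem (k.add_mem hM (k.smul_mem (-a) hH))
    (k.add_mem (k.smul_mem (-b) hE) (k.smul_mem (-c) hF)))
    (k.add_mem (k.smul_mem b h4) (k.smul_mem c h5))
  simp only [smul_hc, hc_add] at this
  exact exists_hc_of_eq this (by ring) (by ring) (by ring) (by ring) (by ring) (by ring)

end

section
variable {h : LieSubalgebra ℝ (Module.End ℝ V)} {k : Submodule ℝ M7}

/-! ### Curvature tensors -/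

/-- The scaling of the standard basis that makes the entries of `h(A, v, u, y)` rational. -/
def scale (i : Fin 7) : ℝ := if i = 3 then (√2)⁻¹ else 1

theorem scale_ne_zero (i : Fin 7) : scale i ≠ 0 := by
  unfold scale; split <;> simp

set_option maxHeartbeats 1000000 in
/-- The first Bianchi identity for curvature tensors with values in the algebra of all
`h(A, v, u, y)` with `A = (2x, n; 0, x)` and `u₂ = n`. -/
theorem IsCurv.relations {r : Fin 7 → Fin 7 → M7} (hr : IsCurv k r)
    (hk : ∀ M ∈ k, ∃ x n v u y z, M = hc (2 * x) n 0 x v u n y z) :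
    ∃ p q s t ζ : ℝ,
      (r 4 5 2 2 = p ∧ r 4 6 2 2 = q ∧ r 4 5 1 2 = s ∧ r 4 6 1 2 = t) ∧
      hc 0 0 0 0 0 0 0 p q ∈ k ∧ (∃ y, hc 0 0 0 0 (-2 * q) 0 0 y (-t) ∈ k) ∧
      (∃ y, hc 0 0 0 0 (p - t) (2 * q) 0 y ζ ∈ k) ∧ hc 0 0 0 0 (2 * q) 0 0 s t ∈ k ∧
      (∃ v y z, hc (2 * q) t 0 q v ζ t y z ∈ k) ∧
      (∃ y z, hc 0 (-2 * q) 0 0 (ζ - s) (t - p) (-2 * q) y z ∈ k) ∧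
      (p = 0 → q = 0 → ∀ i j, r i j 2 2 = 0) ∧
      (p = 0 → q = 0 → s = 0 → t = 0 → ∀ i j, r i j 1 2 = 0) := by
  have h0 : ∀ i j, ∃ x n v u y z, (scale i * scale j) • r i j = hc (2 * x) n 0 x v u n y z :=
    fun i j => hk _ (k.smul_mem _ (hr.mem i j))
  choose X n v u y z hX using h0
  have hmem : ∀ i j, hc (2 * X i j) (n i j) 0 (X i j) (v i j) (u i j) (n i j) (y i j) (z i j) ∈ k :=
    fun i j => hX i j ▸ k.smul_mem _ (hr.mem i j)
  -- Skew symmetry rewrites the third term so that, for `i < j < l`, only increasing index pairs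
  -- occur.
  have B : ∀ i j l a,
      scale l * hc (2 * X i j) (n i j) 0 (X i j) (v i j) (u i j) (n i j) (y i j) (z i j) a l
      + scale i * hc (2 * X j l) (n j l) 0 (X j l) (v j l) (u j l) (n j l) (y j l) (z j l) a i
      - scale j * hc (2 * X i l) (n i l) 0 (X i l) (v i l) (u i l) (n i l) (y i l) (z i l) a j
      = 0 := by
    intro i j l a
    rw [← hX, ← hX, ← hX]
    have h1 := hr.bianchi i j l a
    rw [hr.skew l i] at h1
    simp only [Matrix.smul_apply, Matrix.neg_apply, smul_eq_mul] at h1 ⊢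
    linear_combination (scale i * scale j * scale l) * h1
  simp only [hc_eq] at B
  have h22 : ∀ i j, scale i * scale j * r i j 2 2 = X i j := by
    intro i j
    have := congrFun (congrFun (hX i j) 2) 2
    simpa [hc_eq] using this
  have h12 : ∀ i j, scale i * scale j * r i j 1 2 = n i j := by
    intro i j
    have := congrFun (congrFun (hX i j) 1) 2
    simpa [hc_eq] using this
  -- The digits are the three arguments of the Bianchi identity and the row that is read off. This
  -- selection suffices to determine all the components needed.
  have B0155 := B 0 1 5 5
  have B0251 := B 0 2 5 1
  have B0255 := B 0 2 5 5
  have B0454 := B 0 4 5 4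
  have B0455 := B 0 4 5 5
  have B0456 := B 0 4 5 6
  have B0464 := B 0 4 6 4
  have B1255 := B 1 2 5 5
  have B1256 := B 1 2 5 6
  have B1454 := B 1 4 5 4
  have B1455 := B 1 4 5 5
  have B1460 := B 1 4 6 0
  have B1464 := B 1 4 6 4
  have B1465 := B 1 4 6 5
  have B1466 := B 1 4 6 6
  have B1561 := B 1 5 6 1
  have B1562 := B 1 5 6 2
  have B2451 := B 2 4 5 1
  have B2452 := B 2 4 5 2
  have B2454 := B 2 4 5 4
  have B2455 := B 2 4 5 5
  have B2460 := B 2 4 6 0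
  have B2461 := B 2 4 6 1
  have B2462 := B 2 4 6 2
  have B2464 := B 2 4 6 4
  have B2465 := B 2 4 6 5
  have B2466 := B 2 4 6 6
  have B2560 := B 2 5 6 0
  have B2561 := B 2 5 6 1
  have B2562 := B 2 5 6 2
  have B4564 := B 4 5 6 4
  have B4565 := B 4 5 6 5
  have B4566 := B 4 5 6 6
  have B0132 := B 0 1 3 2
  have B0351 := B 0 3 5 1
  have B0362 := B 0 3 6 2
  have B0366 := B 0 3 6 6
  have B1340 := B 1 3 4 0
  have B1352 := B 1 3 5 2
  have B1356 := B 1 3 5 6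
  have B1366 := B 1 3 6 6
  have B2340 := B 2 3 4 0
  have B2351 := B 2 3 5 1
  have B2352 := B 2 3 5 2
  have B2356 := B 2 3 5 6
  have B2366 := B 2 3 6 6
  have B3454 := B 3 4 5 4
  have B3455 := B 3 4 5 5
  have B3465 := B 3 4 6 5
  have B3466 := B 3 4 6 6
  have B3561 := B 3 5 6 1
  have B3562 := B 3 5 6 2
  have B3565 := B 3 5 6 5
  -- Row `3` carries a common factor `√2`, which is divided out here.
  have B0263 := congrArg ((√2)⁻¹ * ·) (B 0 2 6 3)
  have B0363 := congrArg ((√2)⁻¹ * ·) (B 0 3 6 3)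
  have B1343 := congrArg ((√2)⁻¹ * ·) (B 1 3 4 3)
  have B1453 := congrArg ((√2)⁻¹ * ·) (B 1 4 5 3)
  have B1463 := congrArg ((√2)⁻¹ * ·) (B 1 4 6 3)
  have B1563 := congrArg ((√2)⁻¹ * ·) (B 1 5 6 3)
  have B2343 := congrArg ((√2)⁻¹ * ·) (B 2 3 4 3)
  have B2453 := congrArg ((√2)⁻¹ * ·) (B 2 4 5 3)
  have B2463 := congrArg ((√2)⁻¹ * ·) (B 2 4 6 3)
  have B2563 := congrArg ((√2)⁻¹ * ·) (B 2 5 6 3)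
  have B3453 := congrArg ((√2)⁻¹ * ·) (B 3 4 5 3)
  have B3463 := congrArg ((√2)⁻¹ * ·) (B 3 4 6 3)
  have B3563 := congrArg ((√2)⁻¹ * ·) (B 3 5 6 3)
  have B4563 := congrArg ((√2)⁻¹ * ·) (B 4 5 6 3)
  simp [scale]
    at B0155 B0251 B0255 B0454 B0455 B0456 B0464 B1255 B1256 B1454 B1455 B1460 B1464 B1465 B1466
      B1561 B1562 B2451 B2452 B2454 B2455 B2460 B2461 B2462 B2464 B2465 B2466 B2560 B2561
      B2562 B4564 B4565 B4566
  simp [scale]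
    at B0132 B0351 B0362 B0366 B1340 B1352 B1356 B1366 B2340 B2351 B2352 B2356 B2366 B3454 B3455
      B3465 B3466 B3561 B3562 B3565
  simp [scale, mul_add, mul_sub]
    at B0263 B0363 B1343 B1453 B1463 B1563 B2343 B2453 B2463 B2563 B3453 B3463 B3563 B4563
  clear B
  have X01 : X 0 1 = 0 := by linarith only [B0155]
  have n01 : n 0 1 = 0 := by linarith only [B0132]
  have X02 : X 0 2 = 0 := by linarith only [B0255]
  have n02 : n 0 2 = 0 := by linarith only [B0263]
  have X03 : X 0 3 = 0 := by linarith only [B0366]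
  have n03 : n 0 3 = 0 := by linarith only [B0363]
  have X04 : X 0 4 = 0 := by linarith only [B0455, B0251]
  have n04 : n 0 4 = 0 := by linarith only [B0456, B0351]
  have X05 : X 0 5 = 0 := by linarith only [B0454]
  have n05 : n 0 5 = 0 := by linarith only [B0251]
  have X06 : X 0 6 = 0 := by linarith only [B0464]
  have n06 : n 0 6 = 0 := by linarith only [B0362]
  have X12 : X 1 2 = 0 := by linarith only [B1255]
  have n12 : n 1 2 = 0 := by linarith only [B1256]
  have X13 : X 1 3 = 0 := by linarith only [B1366]
  have n13 : n 1 3 = 0 := by linarith only [B1356]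
  have X14 : X 1 4 = 0 := by linarith only [B1563, B1455, B1466]
  have n14 : n 1 4 = 0 := by linarith only [B1463, B1562]
  have X15 : X 1 5 = 0 := by linarith only [B1454]
  have n15 : n 1 5 = 0 := by linarith only [B1352, B1343]
  have X16 : X 1 6 = 0 := by linarith only [B1464]
  have n16 : n 1 6 = 0 := by linarith only [B1465]
  have X23 : X 2 3 = 0 := by linarith only [B2366]
  have n23 : n 2 3 = 0 := by linarith only [B2356]
  have X24 : X 2 4 = 0 := by linarith only [B2563, B2455, B2466]
  have n24 : n 2 4 = 0 := by linarith only [B2463, B2562, B4564]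
  have X25 : X 2 5 = 0 := by linarith only [B2454]
  have n25 : n 2 5 = 0 := by linarith only [B2352, B2343, B3454]
  have X26 : X 2 6 = 0 := by linarith only [B2464]
  have n26 : n 2 6 = 0 := by linarith only [B2465]
  have X34 : X 3 4 = 0 := by linarith only [B3455, B3466, B3563]
  have X35 : X 3 5 = 0 := by linarith only [B3454]
  have n35 : n 3 5 = 0 := by linarith only [B3466, B3455, B3563]
  have X36 : X 3 6 = 0 := by linarith only [B3565]
  have n36 : n 3 6 = 0 := by linarith only [B3465]
  have X56 : X 5 6 = 0 := by linarith only [B4564]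
  have n34 : n 3 4 = 2 * X 4 6 := by linarith only [B4565, B3562, B3463]
  have n56 : n 5 6 = -2 * X 4 6 := by linarith only [B4565]
  have u26 : u 2 6 = 0 := by linarith only [B2455, B2466, B2563]
  have v26 : v 2 6 = 0 := by linarith only [B2562, B4564]
  have y26 : y 2 6 = X 4 5 := by linarith only [B2461, B2452, B2560, B4566]
  have z26 : z 2 6 = X 4 6 := by linarith only [B2462]
  have u14 : u 1 4 = 0 := by linarith only [B1561, B1453, B4564]
  have v14 : v 1 4 = -2 * X 4 6 := by linarith only [B3562, B4565, B3463, B1340]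
  have z14 : z 1 4 = -n 4 6 := by linarith only [B1460]
  have u24 : u 2 4 = 2 * X 4 6 := by linarith only [B2561, B2453, B4565]
  have v24 : v 2 4 = X 4 5 - n 4 6 := by linarith only [B4566, B3561, B3453, B2340]
  have u25 : u 2 5 = 0 := by linarith only [B2351, B3563, B3455, B3466]
  have v25 : v 2 5 = 2 * X 4 6 := by linarith only [B2561, B4565]
  have y25 : y 2 5 = n 4 5 := by linarith only [B2451]
  have z25 : z 2 5 = n 4 6 := by linarith only [B2560, B2461, B2452, B4566]
  have u46 : u 4 6 = z 2 4 := by linarith only [B2460]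
  have u56 : u 5 6 = n 4 6 - X 4 5 := by linarith only [B4566]
  have v56 : v 5 6 = z 2 4 - n 4 5 := by linarith only [B4563, B2460]
  have hs : ∀ i j : Fin 7, i ≠ j → i ≠ 3 → j ≠ 3 → scale i * scale j = 1 := by
    intro i j _ hi hj
    simp [scale, hi, hj]
  have e45 := h22 4 5
  have e46 := h22 4 6
  have f45 := h12 4 5
  have f46 := h12 4 6
  rw [hs 4 5 (by decide) (by decide) (by decide), one_mul] at e45 f45
  rw [hs 4 6 (by decide) (by decide) (by decide), one_mul] at e46 f46
  have hlt : ∀ f : M7 →ₗ[ℝ] ℝ, (∀ i j, i < j → f (r i j) = 0) → ∀ i j, f (r i j) = 0 := by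
    intro f hf i j
    rcases lt_trichotomy i j with hij | rfl | hij
    · exact hf i j hij
    · have := congrArg f (hr.skew i i)
      rw [map_neg] at this
      linarith
    · rw [hr.skew, map_neg, hf j i hij, neg_zero]
  -- These six curvature values become the elements of `k` in the conclusion.
  have m26 := hmem 2 6
  have m14 := hmem 1 4
  have m24 := hmem 2 4
  have m25 := hmem 2 5
  have m46 := hmem 4 6
  have m56 := hmem 5 6
  rw [X26, n26, u26, v26, y26, z26] at m26
  rw [X14, n14, u14, v14, z14] at m14
  rw [X24, n24, u24, v24] at m24
  rw [X25, n25, u25, v25, y25, z25] at m25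
  rw [u46] at m46
  rw [X56, n56, u56, v56] at m56
  simp only [mul_zero] at m26 m14 m24 m25 m56
  refine ⟨X 4 5, X 4 6, n 4 5, n 4 6, z 2 4, ⟨e45, e46, f45, f46⟩, m26, ⟨_, m14⟩, ⟨_, m24⟩, m25,
    ⟨_, _, _, m46⟩, ⟨_, _, m56⟩, ?_, ?_⟩
  · intro X45 X46
    refine hlt (Matrix.entryLinearMap ℝ ℝ 2 2) ?_
    intro i j hij
    have h1 : X i j = 0 := by
      fin_cases i <;> fin_cases j <;> first | exact absurd hij (by decide) | assumption
    have := h22 i j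
    rw [h1] at this
    exact (mul_eq_zero.1 this).resolve_left (mul_ne_zero (scale_ne_zero i) (scale_ne_zero j))
  · intro X45 X46 n45 n46
    rw [X46, mul_zero] at n34 n56
    refine hlt (Matrix.entryLinearMap ℝ ℝ 1 2) ?_
    intro i j hij
    have h1 : n i j = 0 := by
      fin_cases i <;> fin_cases j <;> first | exact absurd hij (by decide) | assumption
    have := h12 i j
    rw [h1] at this
    exact (mul_eq_zero.1 this).resolve_left (mul_ne_zero (scale_ne_zero i) (scale_ne_zero j))

end

section
variable {h : LieSubalgebra ℝ (Module.End ℝ V)} {k : Submodule ℝ M7}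

/-! ### Semidirect decompositions -/

theorem zero_eq_hc : (0 : M7) = hc 0 0 0 0 0 0 0 0 0 := by
  simpa using smul_hc 0 0 0 0 0 0 0 0 0 0

theorem mem_mV {i : Fin 2} {M : M7} :
    M ∈ mV i ↔ ∃ v, (i = 0 → v = 0) ∧ M = hc 0 0 0 0 v 0 0 0 0 := by
  fin_cases i
  · simp [mV, zero_eq_hc]
  · simp only [mV, hMat_eq_hc, Submodule.mem_span_singleton, smul_hc]
    simp [eq_comm]

theorem mem_mU {j : Fin 2} {M : M7} :
    M ∈ mU j ↔ ∃ p, (j = 0 → p = 0) ∧ M = hc 0 0 0 0 0 p 0 0 0 := by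
  fin_cases j
  · simp [mU, zero_eq_hc]
  · simp only [mU, hMat_eq_hc, Submodule.mem_span_singleton, smul_hc]
    simp [eq_comm]

theorem mem_mY_two {M : M7} : M ∈ mY 2 ↔ ∃ y z, M = hc 0 0 0 0 0 0 0 y z := by
  simp only [mY, hMat_eq_hc, Submodule.mem_span_pair, smul_hc, hc_add]
  simp [eq_comm]

theorem mem_m_two {i j : Fin 2} {M : M7} : M ∈ m i j 2 ↔
    ∃ v p y z, (i = 0 → v = 0) ∧ (j = 0 → p = 0) ∧ M = hc 0 0 0 0 v p 0 y z := by
  simp only [m, Submodule.mem_sup, mem_mV, mem_mU, mem_mY_two]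
  constructor
  · rintro ⟨_, ⟨_, ⟨v, hv, rfl⟩, _, ⟨p, hp, rfl⟩, rfl⟩, _, ⟨y, z, rfl⟩, rfl⟩
    exact ⟨v, p, y, z, hv, hp, by simp [hc_add]⟩
  · rintro ⟨v, p, y, z, hv, hp, rfl⟩
    exact ⟨_, ⟨_, ⟨v, hv, rfl⟩, _, ⟨p, hp, rfl⟩, rfl⟩, _, ⟨y, z, rfl⟩, by simp [hc_add]⟩

/-- When all `A`-parts are upper triangular, the conditions `A = 0` and `u₂ = 0` cut out an ideal,
so only a complementary subalgebra has to be supplied. -/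
theorem isSemidirect_of_forall {q n : Submodule ℝ M7} (hlie : ∀ X ∈ k, ∀ Y ∈ k, ⁅X, Y⁆ ∈ k)
    (hk : ∀ X ∈ k, ∃ a b d v p q y z, X = hc a b 0 d v p q y z)
    (hn : ∀ M, M ∈ n ↔ M ∈ k ∧ ∃ v p y z, M = hc 0 0 0 0 v p 0 y z)
    (hqk : q ≤ k) (hq : ∀ X ∈ q, ∀ Y ∈ q, ⁅X, Y⁆ ∈ q)
    (hdec : ∀ M ∈ k, ∃ X ∈ q, ∃ v p y z, M - X = hc 0 0 0 0 v p 0 y z)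
    (hdis : ∀ M ∈ q, ∀ v p y z, M = hc 0 0 0 0 v p 0 y z → M = 0) : IsSemidirect k q n := by
  refine ⟨le_antisymm ?_ (sup_le hqk fun M hM => ((hn M).1 hM).1), ?_, hq, ?_⟩
  · intro M hM
    obtain ⟨X, hX, hMX⟩ := hdec M hM
    exact Submodule.mem_sup.2
      ⟨X, hX, M - X, (hn _).2 ⟨k.sub_mem hM (hqk hX), hMX⟩, add_sub_cancel _ _⟩
  · rw [Submodule.disjoint_def]
    intro M h1 h2
    obtain ⟨-, v, p, y, z, rfl⟩ := (hn M).1 h2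
    exact hdis _ h1 _ _ _ _ rfl
  · intro X hX Y hY
    obtain ⟨hY, v, p, y, z, rfl⟩ := (hn Y).1 hY
    refine (hn _).2 ⟨hlie _ hX _ hY, ?_⟩
    obtain ⟨a, b, d, v', p', q', y', z', rfl⟩ := hk X hX
    rw [hc_lie]
    simp only [zero_mul, mul_zero, sub_zero, add_zero]
    exact ⟨_, _, _, _, rfl⟩

theorem lie_mem_span_singleton {E X Y : M7} (hX : X ∈ Submodule.span ℝ {E})
    (hY : Y ∈ Submodule.span ℝ {E}) : ⁅X, Y⁆ ∈ Submodule.span ℝ {E} := by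
  obtain ⟨s, rfl⟩ := Submodule.mem_span_singleton.1 hX
  obtain ⟨t, rfl⟩ := Submodule.mem_span_singleton.1 hY
  have : ⁅s • E, t • E⁆ = 0 := by
    rw [LieRing.of_associative_ring_bracket]
    simp [mul_comm s t, smul_smul]
  rw [this]
  exact Submodule.zero_mem _

theorem mem_line_dg {M : M2} : M ∈ line (dg 1 0) ↔ ∃ t, M = !![t, 0; 0, 0] := by
  rw [mem_line]
  simp [dg, eq_comm]

theorem mem_line_N {M : M2} : M ∈ line N ↔ ∃ t, M = !![0, t; 0, 0] := by
  rw [mem_line]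
  simp [N, eq_comm]

theorem mem_s {t : ℝ} {M : M2} : M ∈ s t ↔ ∃ x n, M = !![x * t, n; 0, x * (t - 1)] := by
  simp only [s, Submodule.mem_span_pair, dg, N]
  simp [eq_comm]

/-! ### The exceptional algebras -/

/-- Scalar matrices in `GL(2, ℝ)` act through the grading, with weights 1, 2, 3 on `u`, `v`, `y`,
and leave `A` alone. They serve to normalise a non-zero `u₂` to 1. -/
theorem IsHIForm.exists_scale (hk : IsHIForm h k) (h_sub : h ≤ g2star) {t : ℝ} (ht : t ≠ 0) :
    ∃ k', IsHIForm h k' ∧ (∀ a b c d v p q y z, hc a b c d v p q y z ∈ k' ↔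
      hc a b c d (t ^ 2 * v) (t * p) (t * q) (t ^ 3 * y) (t ^ 3 * z) ∈ k) ∧ proj k' = proj k := by
  have hPQ : (!![t, 0; 0, t] : M2) * !![t⁻¹, 0; 0, t⁻¹] = 1 := by
    ext i j
    fin_cases i <;> fin_cases j <;> simp [Matrix.mul_apply, Fin.sum_univ_two, ht]
  obtain ⟨k', hk', H⟩ := hk.exists_levi h_sub hPQ
  have H' : ∀ a b c d v p q y z, hc a b c d v p q y z ∈ k' ↔
      hc a b c d (t ^ 2 * v) (t * p) (t * q) (t ^ 3 * y) (t ^ 3 * z) ∈ k := by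
    intro a b c d v p q y z
    rw [hc, H, hMat_eq_hc]
    have : ∀ M M' : M7, M = M' → (M ∈ k ↔ M' ∈ k) := by rintro M _ rfl; rfl
    apply this
    simp [Matrix.mul_apply, Fin.sum_univ_two, Matrix.mulVec, dotProduct, Matrix.det_fin_two]
    congr 1 <;> field_simp
  refine ⟨k', hk', H', ?_⟩
  ext A
  rw [mem_proj, mem_proj]
  constructor
  · rintro ⟨v, p, q, y, z, hM⟩
    exact ⟨_, _, _, _, _, (H' _ _ _ _ _ _ _ _ _).1 hM⟩
  · rintro ⟨v, p, q, y, z, hM⟩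
    refine ⟨v / t ^ 2, p / t, q / t, y / t ^ 3, z / t ^ 3, (H' _ _ _ _ _ _ _ _ _).2 ?_⟩
    convert hM using 1
    congr 1 <;> field_simp

/-- Because `q₀ ≠ 0`, the operator `ad X - 1` passes from `u₁` to `v` and from `v` to `y₂`. Starting
from `w ≠ 0` it yields elements with `v ≠ 0` and `y₂ ≠ 0`, and the bracket of the first two of these
three elements is a pure `y₁`. -/
theorem IsHIForm.hc_mem_of_dg (hk : IsHIForm h k) {v₀ p₀ q₀ y₀ z₀ v₁ w y₁ z₁ : ℝ}
    (hX : hc 1 0 0 0 v₀ p₀ q₀ y₀ z₀ ∈ k) (hw : hc 0 0 0 0 v₁ w 0 y₁ z₁ ∈ k) (hq : q₀ ≠ 0)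
    (hw0 : w ≠ 0) (v p y z : ℝ) : hc 0 0 0 0 v p 0 y z ∈ k := by
  have hD : ∀ {v p y z}, hc 0 0 0 0 v p 0 y z ∈ k →
      hc 0 0 0 0 (-2 * q₀ * p) 0 0 (y + 3 * (v * p₀ - v₀ * p)) (3 * v * q₀) ∈ k := by
    intro v p y z hM
    have := k.add_mem (hk.lie_mem hX hM) (k.smul_mem (-1) hM)
    rw [hc_lie, smul_hc, hc_add] at this
    convert this using 1
    congr 1 <;> ring
  have h1 := hD hw
  have h2 := hD h1
  have h3 := hk.lie_mem hw h1
  rw [hc_lie] at h3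
  have hy : ∀ y, hc 0 0 0 0 0 0 0 y 0 ∈ k := by
    intro y
    have := k.smul_mem (y / (-6 * q₀ * w ^ 2)) h3
    rw [smul_hc] at this
    convert this using 1
    congr 1
    iterate 7 ring
    · field_simp; ring
    · ring
  have hz : ∀ y z, hc 0 0 0 0 0 0 0 y z ∈ k := by
    intro y z
    have := k.smul_mem (z / (-6 * q₀ ^ 2 * w)) h2
    rw [smul_hc] at this
    have := k.add_mem this (hy (y - z / (-6 * q₀ ^ 2 * w) * (y₁ + 3 * (v₁ * p₀ - v₀ * w) +
      3 * (-2 * q₀ * w * p₀ - v₀ * 0))))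
    rw [hc_add] at this
    convert this using 1
    congr 1
    iterate 8 ring
    · field_simp; ring
  have hv : ∀ v y z, hc 0 0 0 0 v 0 0 y z ∈ k := by
    intro v y z
    have := k.smul_mem (v / (-2 * q₀ * w)) h1
    rw [smul_hc] at this
    have := k.add_mem this (hz (y - v / (-2 * q₀ * w) * (y₁ + 3 * (v₁ * p₀ - v₀ * w)))
      (z - v / (-2 * q₀ * w) * (3 * v₁ * q₀)))
    rw [hc_add] at this
    convert this using 1
    congr 1
    iterate 4 ring
    · field_simp; ring
    all_goals ring
  have := k.add_mem (k.smul_mem (p / w) hw) (hv (v - p / w * v₁) (y - p / w * y₁) (z - p / w * z₁))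
  rw [smul_hc, hc_add] at this
  convert this using 1
  congr 1
  iterate 5 ring
  · field_simp; ring
  all_goals ring

/-- `U` is not contained in `u₁ = 0`, since otherwise the line through `e₃ - p₀ e₁` would be
invariant. As `U` is stable under `diag(1,0)`, it is `ℝ²` or `ℝ · (1,0)`. In the second case `u₂ = a
q₀`, and `q₀ = 0` would make `ℝ e₂` invariant. -/
theorem IsHIForm.classify_dg (hk : IsHIForm h k) (h_sub : h ≤ g2star)
    (h_indec : IsIndecomposable h) (h_type : IsTypeI h) (hproj : proj k = line (dg 1 0)) :
    mAll ≤ k ∨ ∃ k', IsHIForm h k' ∧ proj k' = line (dg 1 0) ∧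
      IsSemidirect k' (Submodule.span ℝ {hMat (dg 1 0) 0 ![0, 1] 0}) (m 1 1 2) := by
  have hA : ∀ {a b c d v p q y z}, hc a b c d v p q y z ∈ k → b = 0 ∧ c = 0 ∧ d = 0 := by
    intro a b c d v p q y z hM
    have := mem_proj_of hM
    rw [hproj, mem_line_dg] at this
    simpa using this
  obtain ⟨v₀, p₀, q₀, y₀, z₀, hX⟩ : ∃ v p q y z, hc 1 0 0 0 v p q y z ∈ k := by
    apply exists_hc_of_mem_proj
    rw [hproj, mem_line_dg]
    exact ⟨1, rfl⟩
  have hsub : ∀ {a v p q y z}, hc a 0 0 0 v p q y z ∈ k → ∃ v' y' z',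
      hc 0 0 0 0 v' (p - a * p₀) (q - a * q₀) y' z' ∈ k := by
    intro a v p q y z hM
    have := k.add_mem hM (k.smul_mem (-a) hX)
    rw [smul_hc, hc_add] at this
    exact exists_hc_of_eq this (by ring) (by ring) (by ring) (by ring) (by ring) (by ring)
  have hcontra : ¬ ∀ v p q y z, hc 0 0 0 0 v p q y z ∈ k → p = 0 := by
    intro h0
    refine hk.not_forall_eigenvector h_indec h_type (w₁ := 0) (w₂ := 1) (by simp) (-p₀) ?_
    intro a b c d v p q y z hM
    obtain ⟨rfl, rfl, rfl⟩ := hA hM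
    obtain ⟨_, _, _, h1⟩ := hsub hM
    have := h0 _ _ _ _ _ h1
    exact ⟨0, by ring, by ring, by linear_combination this⟩
  rcases hk.trichotomy with h0 | h0 | ⟨w₁, w₂, v₁, y₁, z₁, hw0, hw, h0⟩
  · exact Or.inl h0
  · exact (hcontra fun v p q y z hM => (h0 v p q y z hM).1).elim
  right
  have h1 := hk.lie_mem hX hw
  rw [hc_lie] at h1
  simp only [mul_zero, zero_mul, sub_zero, add_zero] at h1
  have h1 := h0 _ _ _ _ _ h1
  have hw2 : w₂ = 0 := by
    by_contra hw2
    have hw1 : w₁ = 0 := by simpa [hw2] using h1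
    subst hw1
    exact hcontra fun v p q y z hM => by simpa [hw2] using h0 v p q y z hM
  subst hw2
  have hw1 : w₁ ≠ 0 := by simpa using hw0
  have hq : ∀ {a v p q y z}, hc a 0 0 0 v p q y z ∈ k → q = a * q₀ := by
    intro a v p q y z hM
    obtain ⟨_, _, _, h2⟩ := hsub hM
    have := h0 _ _ _ _ _ h2
    simp only [mul_zero, zero_eq_mul, hw1, or_false] at this
    linarith
  have hq0 : q₀ ≠ 0 := by
    rintro rfl
    refine hk.not_forall_eigenvector h_indec h_type (w₁ := 1) (w₂ := 0) (by simp) 0 ?_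
    intro a b c d v p q y z hM
    obtain ⟨rfl, rfl, rfl⟩ := hA hM
    exact ⟨a, by ring, by ring, by linear_combination -hq hM⟩
  have hmem := hk.hc_mem_of_dg hX hw hq0 hw1
  have hE : hc 1 0 0 0 0 0 q₀ 0 0 ∈ k := by
    have := k.add_mem hX (hmem (-v₀) (-p₀) (-y₀) (-z₀))
    rw [hc_add] at this
    convert this using 1
    congr 1 <;> ring
  obtain ⟨k', hk', H, hp⟩ := hk.exists_scale h_sub hq0
  rw [hproj] at hp
  refine ⟨k', hk', hp, ?_⟩
  have hmem' : ∀ v p y z, hc 0 0 0 0 v p 0 y z ∈ k' := by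
    intro v p y z
    rw [H, mul_zero]
    exact hmem _ _ _ _
  have hE' : hc 1 0 0 0 0 0 1 0 0 ∈ k' := by
    rw [H]
    simpa using hE
  have hform : ∀ X ∈ k', ∃ a v p y z, X = hc a 0 0 0 v p a y z := by
    intro X hX
    obtain ⟨a, b, c, d, v, p, q, y, z, rfl, hX⟩ := hk'.exists_hc hX
    rw [H] at hX
    obtain ⟨rfl, rfl, rfl⟩ := hA hX
    have := hq hX
    rw [mul_comm] at this
    have := mul_right_cancel₀ hq0 this
    exact ⟨a, v, p, y, z, by rw [this]⟩
  rw [hMat_eq_hc]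
  simp only [dg, Matrix.of_apply, Matrix.cons_val, Pi.zero_apply]
  refine isSemidirect_of_forall (fun X hX Y hY => hk'.lie_mem hX hY) ?_ ?_ ?_
    (fun X hX Y hY => lie_mem_span_singleton hX hY) ?_ ?_
  · intro X hX
    obtain ⟨a, v, p, y, z, rfl⟩ := hform X hX
    exact ⟨_, _, _, _, _, _, _, _, rfl⟩
  · intro M
    rw [mem_m_two]
    constructor
    · rintro ⟨v, p, y, z, -, -, rfl⟩
      exact ⟨hmem' _ _ _ _, v, p, y, z, rfl⟩
    · rintro ⟨-, v, p, y, z, rfl⟩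
      exact ⟨v, p, y, z, by simp, by simp, rfl⟩
  · rw [Submodule.span_singleton_le_iff_mem]
    exact hE'
  · intro M hM
    obtain ⟨a, v, p, y, z, rfl⟩ := hform M hM
    refine ⟨_, Submodule.smul_mem _ a (Submodule.mem_span_singleton_self _), v, p, y, z, ?_⟩
    rw [smul_hc, sub_eq_iff_eq_add, hc_add]
    congr 1 <;> ring
  · intro M hM v p y z h2
    obtain ⟨t, rfl⟩ := Submodule.mem_span_singleton.1 hM
    rw [smul_hc] at h2
    obtain ⟨e1, -⟩ := hc_inj h2
    have : t = 0 := by linarith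
    rw [this, zero_smul]

end

/-! ### Unipotent changes of basis and the projection `ℝ · N` -/

section
variable {h : LieSubalgebra ℝ (Module.End ℝ V)} {k : Submodule ℝ M7}

/-- This and the next two lemmas change a component by a coboundary without changing `A`: they add
`t · tr A` to `v`, or `A (t,0)` or `A (0,t)` to `u`. The effect on components of higher degree is
irrelevant and left unspecified. -/
theorem IsHIForm.exists_expV_proj (hk : IsHIForm h k) (h_sub : h ≤ g2star) (t : ℝ) :
    ∃ k', IsHIForm h k' ∧ proj k' = proj k ∧ ∀ {a b c d v p q y z}, hc a b c d v p q y z ∈ k →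
      ∃ y' z', hc a b c d (v + (a + d) * t) p q y' z' ∈ k' := by
  obtain ⟨k', hk', H⟩ := hk.exists_expV h_sub t
  have H' : ∀ {a b c d v p q y z}, hc a b c d v p q y z ∈ k →
      ∃ y' z', hc a b c d (v + (a + d) * t) p q y' z' ∈ k' := by
    intro a b c d v p q y z hM
    refine ⟨y + 3 * t * p, z + 3 * t * q, (H _ _ _ _ _ _ _ _ _).2 ?_⟩
    convert hM using 1
    congr 1 <;> ring
  refine ⟨k', hk', ?_, H'⟩
  ext A
  rw [mem_proj, mem_proj]
  constructor
  · rintro ⟨v, p, q, y, z, hM⟩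
    exact ⟨_, _, _, _, _, (H _ _ _ _ _ _ _ _ _).1 hM⟩
  · rintro ⟨v, p, q, y, z, hM⟩
    obtain ⟨_, _, hM⟩ := H' hM
    exact ⟨_, _, _, _, _, hM⟩

theorem IsHIForm.exists_expU₁_proj (hk : IsHIForm h k) (h_sub : h ≤ g2star) (t : ℝ) :
    ∃ k', IsHIForm h k' ∧ proj k' = proj k ∧ ∀ {a b c d v p q y z}, hc a b c d v p q y z ∈ k →
      ∃ v' y' z', hc a b c d v' (p + a * t) (q + c * t) y' z' ∈ k' := by
  obtain ⟨k', hk', H⟩ := hk.exists_expU₁ h_sub t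
  have H' : ∀ {a b c d v p q y z}, hc a b c d v p q y z ∈ k →
      ∃ v' y' z', hc a b c d v' (p + a * t) (q + c * t) y' z' ∈ k' := by
    intro a b c d v p q y z hM
    refine ⟨v - 2 * t * (q + c * t) + c * t ^ 2,
      y - 3 * t * (v - 2 * t * (q + c * t) + c * t ^ 2) - 3 * t ^ 2 * (q + c * t) + c * t ^ 3, z,
      (H _ _ _ _ _ _ _ _ _).2 ?_⟩
    convert hM using 1
    congr 1 <;> ring
  refine ⟨k', hk', ?_, H'⟩
  ext A
  rw [mem_proj, mem_proj]
  constructor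
  · rintro ⟨v, p, q, y, z, hM⟩
    exact ⟨_, _, _, _, _, (H _ _ _ _ _ _ _ _ _).1 hM⟩
  · rintro ⟨v, p, q, y, z, hM⟩
    obtain ⟨_, _, _, hM⟩ := H' hM
    exact ⟨_, _, _, _, _, hM⟩

theorem IsHIForm.exists_expU₂_proj (hk : IsHIForm h k) (h_sub : h ≤ g2star) (t : ℝ) :
    ∃ k', IsHIForm h k' ∧ proj k' = proj k ∧ ∀ {a b c d v p q y z}, hc a b c d v p q y z ∈ k →
      ∃ v' y' z', hc a b c d v' (p + b * t) (q + d * t) y' z' ∈ k' := by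
  obtain ⟨k', hk', H⟩ := hk.exists_expU₂ h_sub t
  have H' : ∀ {a b c d v p q y z}, hc a b c d v p q y z ∈ k →
      ∃ v' y' z', hc a b c d v' (p + b * t) (q + d * t) y' z' ∈ k' := by
    intro a b c d v p q y z hM
    refine ⟨v + 2 * t * (p + b * t) - b * t ^ 2, y,
      z - 3 * t * (v + 2 * t * (p + b * t) - b * t ^ 2) + 3 * t ^ 2 * (p + b * t) - b * t ^ 3,
      (H _ _ _ _ _ _ _ _ _).2 ?_⟩
    convert hM using 1
    congr 1 <;> ring
  refine ⟨k', hk', ?_, H'⟩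
  ext A
  rw [mem_proj, mem_proj]
  constructor
  · rintro ⟨v, p, q, y, z, hM⟩
    exact ⟨_, _, _, _, _, (H _ _ _ _ _ _ _ _ _).1 hM⟩
  · rintro ⟨v, p, q, y, z, hM⟩
    obtain ⟨_, _, _, hM⟩ := H' hM
    exact ⟨_, _, _, _, _, hM⟩

/-- An element of `k` with `A = N` and `u₂ ≠ 0` forces the elements of `k ∩ 𝔪` to have
vanishing component `u₂`, unless `k` contains `𝔪`. -/
theorem IsHIForm.second_eq_zero (hk : IsHIForm h k) {v₀ p₀ q₀ y₀ z₀ : ℝ}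
    (hN : hc 0 1 0 0 v₀ p₀ q₀ y₀ z₀ ∈ k) (hm : ¬ mAll ≤ k) :
    ∀ {v p q y z}, hc 0 0 0 0 v p q y z ∈ k → q = 0 := by
  intro v p q y z hM
  rcases hk.trichotomy with h0 | h0 | ⟨w₁, w₂, v₁, y₁, z₁, hw0, hw, h0⟩
  · exact absurd h0 hm
  · exact (h0 _ _ _ _ _ hM).2
  -- `U` is stable under `N`, and `ℝ · (1,0)` is the only line with this property.
  · have h1 := hk.lie_mem hN hw
    rw [hc_lie] at h1
    simp only [mul_zero, zero_mul, sub_zero, add_zero, one_mul, zero_add] at h1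
    have h1 := h0 _ _ _ _ _ h1
    have hw2 : w₂ = 0 := by simpa using h1
    subst hw2
    have hw1 : w₁ ≠ 0 := by simpa using hw0
    have := h0 _ _ _ _ _ hM
    simpa [hw1] using this

/-- The subspaces `𝔪(i,j,2)` are determined by the elements with one non-zero coordinate. -/
theorem exists_m_two_iff (hY : ∀ y z, hc 0 0 0 0 0 0 0 y z ∈ k)
    (hV : ∀ {v p y z}, hc 0 0 0 0 v p 0 y z ∈ k → hc 0 0 0 0 v 0 0 0 0 ∈ k) :
    ∃ i j : Fin 2, (hc 0 0 0 0 1 0 0 0 0 ∈ k → i = 1) ∧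
      ∀ M, M ∈ m i j 2 ↔ M ∈ k ∧ ∃ v p y z, M = hc 0 0 0 0 v p 0 y z := by
  classical
  -- By `hY` and `hV` the `v`-, `u₁`- and `y`-parts of an element split off separately, so `i` and
  -- `j` need only record whether `v` and `u₁` occur.
  refine ⟨if hc 0 0 0 0 1 0 0 0 0 ∈ k then 1 else 0, if hc 0 0 0 0 0 1 0 0 0 ∈ k then 1 else 0,
    fun h0 => if_pos h0, fun M => ?_⟩
  rw [mem_m_two]
  constructor
  · rintro ⟨v, p, y, z, hv, hp, rfl⟩
    refine ⟨?_, _, _, _, _, rfl⟩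
    have h1 : hc 0 0 0 0 v 0 0 0 0 ∈ k := by
      by_cases h0 : hc 0 0 0 0 1 0 0 0 0 ∈ k
      · simpa [smul_hc] using k.smul_mem v h0
      · have := hv (if_neg h0)
        subst this
        exact hY 0 0
    have h2 : hc 0 0 0 0 0 p 0 0 0 ∈ k := by
      by_cases h0 : hc 0 0 0 0 0 1 0 0 0 ∈ k
      · simpa [smul_hc] using k.smul_mem p h0
      · have := hp (if_neg h0)
        subst this
        exact hY 0 0
    simpa [hc_add] using k.add_mem (k.add_mem h1 h2) (hY y z)
  · rintro ⟨hM, v, p, y, z, rfl⟩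
    have h1 := hV hM
    have h2 : hc 0 0 0 0 0 p 0 0 0 ∈ k := by
      have := k.add_mem (k.sub_mem hM h1) (hY (-y) (-z))
      rw [sub_eq_add_neg, ← neg_one_smul ℝ, smul_hc, hc_add, hc_add] at this
      convert this using 1
      congr 1 <;> ring
    refine ⟨v, p, y, z, fun h0 => ?_, fun h0 => ?_, rfl⟩
    · by_contra hv
      have := k.smul_mem v⁻¹ h1
      rw [smul_hc, inv_mul_cancel₀ hv] at this
      simp only [mul_zero] at this
      rw [if_pos this] at h0
      exact absurd h0 (by decide)
    · by_contra hv
      have := k.smul_mem p⁻¹ h2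
      rw [smul_hc, inv_mul_cancel₀ hv] at this
      simp only [mul_zero] at this
      rw [if_pos this] at h0
      exact absurd h0 (by decide)

/-- The adjoint action of the lift of `N` carries `u₁` to `v`, `v` to `y₂` and `y₂` to `y₁`, so a
single element of `k ∩ 𝔪` with `u₁ ≠ 0` or `v ≠ 0` is enough. The Berger condition supplies a
curvature tensor with non-zero component along `N`. Since its diagonal parts vanish, `s` or `t` is
non-zero, and the relations `m2`, `m4`, `m5` settle the cases `t ≠ 0`, `ζ ≠ 0`, `s ≠ 0` in turn. -/
theorem IsHIForm.hc_mem_of_N (hk : IsHIForm h k) (h_berger : IsBerger h)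
    (hshape : ∀ {a b c d v p q y z}, hc a b c d v p q y z ∈ k →
      a = 0 ∧ c = 0 ∧ d = 0 ∧ q = b) {v₀ p₀ y₀ z₀ : ℝ}
    (hN : hc 0 1 0 0 v₀ p₀ 1 y₀ z₀ ∈ k) (v y z : ℝ) : hc 0 0 0 0 v 0 0 y z ∈ k := by
  obtain ⟨r, hr, i, j, hne⟩ : ∃ r, IsCurv k r ∧ ∃ i j, r i j 1 2 ≠ 0 := by
    by_contra! H
    have := hk.form.eq_zero_of_curv h_berger (Matrix.entryLinearMap ℝ ℝ 1 2) H _ hN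
    simp [hc_eq] at this
  have hrel := hr.relations (k := k) ?_
  swap
  · intro M hM
    obtain ⟨a, b, c, d, v, p, q, y, z, rfl, hM⟩ := hk.exists_hc hM
    obtain ⟨rfl, rfl, rfl, rfl⟩ := hshape hM
    exact ⟨0, q, v, p, y, z, by simp⟩
  obtain ⟨p, q, s, t, ζ, ⟨e1, e2, e3, e4⟩, -, -, ⟨y₂, m2⟩, m3, ⟨v₄, y₄, z₄, m4⟩, ⟨y₅, z₅, m5⟩, -, h12⟩
    := hrel
  have hx : ∀ i j, r i j 2 2 = 0 := by
    intro i j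
    obtain ⟨a, b, c, d, v, p, q, y, z, hM, hM'⟩ := hk.exists_hc (hr.mem i j)
    obtain ⟨rfl, rfl, rfl, rfl⟩ := hshape hM'
    rw [hM]
    simp [hc_eq]
  obtain rfl : p = 0 := by rw [← e1, hx]
  obtain rfl : q = 0 := by rw [← e2, hx]
  have hst : s ≠ 0 ∨ t ≠ 0 := by
    by_contra! H
    exact hne (h12 rfl rfl H.1 H.2 i j)
  have hD : ∀ {v p y z}, hc 0 0 0 0 v p 0 y z ∈ k →
      hc 0 0 0 0 (-2 * p) 0 0 (z + 3 * (v * p₀ - v₀ * p)) (3 * v) ∈ k := by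
    intro v p y z hM
    have := hk.lie_mem hN hM
    rw [hc_lie] at this
    convert this using 1
    congr 1 <;> ring
  have hy : ∀ {y' : ℝ}, y' ≠ 0 → hc 0 0 0 0 0 0 0 y' 0 ∈ k → ∀ y, hc 0 0 0 0 0 0 0 y 0 ∈ k := by
    intro y' hy' hM y
    have := k.smul_mem (y / y') hM
    rw [smul_hc, div_mul_cancel₀ _ hy'] at this
    simpa using this
  have hz : ∀ {y' z' : ℝ}, z' ≠ 0 → hc 0 0 0 0 0 0 0 y' z' ∈ k →
      ∀ y z, hc 0 0 0 0 0 0 0 y z ∈ k := by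
    intro y' z' hz' hM y z
    have h1 := hD hM
    simp only [mul_zero, zero_mul, sub_zero, add_zero] at h1
    have h2 := hy hz' h1 (y - z / z' * y')
    have := k.add_mem (k.smul_mem (z / z') hM) h2
    rw [smul_hc, hc_add, div_mul_cancel₀ _ hz'] at this
    simpa using this
  have hv : ∀ {v' y' z' : ℝ}, v' ≠ 0 → hc 0 0 0 0 v' 0 0 y' z' ∈ k →
      ∀ v y z, hc 0 0 0 0 v 0 0 y z ∈ k := by
    intro v' y' z' hv' hM v y z
    have h1 := hD hM
    simp only [mul_zero, sub_zero] at h1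
    have h2 := hz (mul_ne_zero three_ne_zero hv') h1
    have := k.add_mem (k.smul_mem (v / v') hM) (h2 (y - v / v' * y') (z - v / v' * z'))
    rw [smul_hc, hc_add, div_mul_cancel₀ _ hv'] at this
    simpa using this
  simp only [mul_zero, zero_sub, sub_zero] at m2 m3 m4 m5
  by_cases ht : t = 0
  · subst ht
    simp only [neg_zero, neg_zero] at m2 m5 m4
    by_cases hζ : ζ = 0
    · subst hζ
      have hs : s ≠ 0 := by simpa using hst
      rw [zero_sub] at m5
      exact hv (neg_ne_zero.2 hs) m5 v y z
    · have h1 := hD m4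
      exact hv (by simpa using hζ) h1 v y z
  · exact hv (neg_ne_zero.2 ht) m2 v y z

/-- A shift along `u₂` first removes `p₀`. If `𝔪` is still not contained in the algebra, `u₂` is
`q₀` times the coefficient of `N`, and `q₀ = 0` would make `ℝ e₂` invariant. -/
theorem IsHIForm.classify_N (hk : IsHIForm h k) (h_sub : h ≤ g2star)
    (h_indec : IsIndecomposable h) (h_type : IsTypeI h) (h_berger : IsBerger h)
    (hproj : proj k = line N) :
    ∃ k', IsHIForm h k' ∧ proj k' = line N ∧ (mAll ≤ k' ∨
      ∃ j, IsSemidirect k' (Submodule.span ℝ {hMat N 0 ![0, 1] 0}) (m 1 j 2)) := by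
  have hshape : ∀ {k}, proj k = line N → ∀ {a b c d v p q y z}, hc a b c d v p q y z ∈ k →
      a = 0 ∧ c = 0 ∧ d = 0 := by
    intro k hproj a b c d v p q y z hM
    have := mem_proj_of hM
    rw [hproj, mem_line_N] at this
    simpa [eq_comm] using this
  obtain ⟨v₀, p₀, q₀, y₀, z₀, hN⟩ : ∃ v p q y z, hc 0 1 0 0 v p q y z ∈ k := by
    apply exists_hc_of_mem_proj
    rw [hproj, mem_line_N]
    exact ⟨1, rfl⟩
  obtain ⟨k₁, hk₁, hproj₁, H₁⟩ := hk.exists_expU₂_proj h_sub (-p₀)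
  rw [hproj] at hproj₁
  obtain ⟨v₁, y₁, z₁, hN₁⟩ := H₁ hN
  have hN₁ : hc 0 1 0 0 v₁ 0 q₀ y₁ z₁ ∈ k₁ := by
    convert hN₁ using 1
    congr 1 <;> ring
  by_cases hm : mAll ≤ k₁
  · exact ⟨k₁, hk₁, hproj₁, Or.inl hm⟩
  have hq : ∀ {a b c d v p q y z}, hc a b c d v p q y z ∈ k₁ →
      a = 0 ∧ c = 0 ∧ d = 0 ∧ q = b * q₀ := by
    intro a b c d v p q y z hM
    obtain ⟨rfl, rfl, rfl⟩ := hshape hproj₁ hM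
    have := k₁.add_mem hM (k₁.smul_mem (-b) hN₁)
    rw [smul_hc, hc_add] at this
    obtain ⟨_, _, _, h1⟩ :=
      exists_hc_of_eq this (by ring) (by ring) (by ring) (by ring) rfl rfl
    have := hk₁.second_eq_zero hN₁ hm h1
    exact ⟨rfl, rfl, rfl, by linarith⟩
  have hq0 : q₀ ≠ 0 := by
    rintro rfl
    refine hk₁.not_forall_eigenvector h_indec h_type (w₁ := 1) (w₂ := 0) (by simp) 0 ?_
    intro a b c d v p q y z hM
    obtain ⟨rfl, rfl, rfl, h4⟩ := hq hM
    exact ⟨0, by ring, by ring, by linear_combination -h4⟩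
  obtain ⟨k₂, hk₂, H₂, hproj₂⟩ := hk₁.exists_scale h_sub hq0
  rw [hproj₁] at hproj₂
  have hN₂ : hc 0 1 0 0 (v₁ / q₀ ^ 2) 0 1 (y₁ / q₀ ^ 3) (z₁ / q₀ ^ 3) ∈ k₂ := by
    rw [H₂]
    convert hN₁ using 1
    congr 1 <;> first | exact mul_zero _ | field_simp
  have hq₂ : ∀ {a b c d v p q y z}, hc a b c d v p q y z ∈ k₂ →
      a = 0 ∧ c = 0 ∧ d = 0 ∧ q = b := by
    intro a b c d v p q y z hM
    rw [H₂] at hM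
    obtain ⟨rfl, rfl, rfl, h4⟩ := hq hM
    exact ⟨rfl, rfl, rfl, mul_left_cancel₀ hq0 (by linarith)⟩
  have hV := hk₂.hc_mem_of_N h_berger hq₂ hN₂
  have hE : hc 0 1 0 0 0 0 1 0 0 ∈ k₂ := by
    have := k₂.add_mem hN₂ (hV (-(v₁ / q₀ ^ 2)) (-(y₁ / q₀ ^ 3)) (-(z₁ / q₀ ^ 3)))
    rw [hc_add] at this
    convert this using 1
    congr 1 <;> ring
  obtain ⟨i, j, hi, hn⟩ := exists_m_two_iff (hV 0) (fun _ => hV _ 0 0)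
  obtain rfl := hi (hV 1 0 0)
  refine ⟨k₂, hk₂, hproj₂, Or.inr ⟨j, ?_⟩⟩
  rw [hMat_eq_hc]
  simp only [N, Matrix.of_apply, Matrix.cons_val, Pi.zero_apply]
  have hform : ∀ X ∈ k₂, ∃ b v p y z, X = hc 0 b 0 0 v p b y z := by
    intro X hX
    obtain ⟨a, b, c, d, v, p, q, y, z, rfl, hX⟩ := hk₂.exists_hc hX
    obtain ⟨rfl, rfl, rfl, rfl⟩ := hq₂ hX
    exact ⟨_, _, _, _, _, rfl⟩
  refine isSemidirect_of_forall (fun X hX Y hY => hk₂.lie_mem hX hY) ?_ hn ?_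
    (fun X hX Y hY => lie_mem_span_singleton hX hY) ?_ ?_
  · intro X hX
    obtain ⟨b, v, p, y, z, rfl⟩ := hform X hX
    exact ⟨_, _, _, _, _, _, _, _, rfl⟩
  · rw [Submodule.span_singleton_le_iff_mem]
    exact hE
  · intro M hM
    obtain ⟨b, v, p, y, z, rfl⟩ := hform M hM
    refine ⟨_, Submodule.smul_mem _ b (Submodule.mem_span_singleton_self _), v, p, y, z, ?_⟩
    rw [smul_hc, sub_eq_iff_eq_add, hc_add]
    congr 1 <;> ring
  · intro M hM v p y z h2
    obtain ⟨t, rfl⟩ := Submodule.mem_span_singleton.1 hM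
    rw [smul_hc] at h2
    obtain ⟨-, e1, -⟩ := hc_inj h2
    have : t = 0 := by linarith
    rw [this, zero_smul]

end

/-! ### The projections `𝔰_λ` -/

section
variable {h : LieSubalgebra ℝ (Module.End ℝ V)} {k : Submodule ℝ M7}

theorem exists_of_proj_eq_s {t : ℝ} (hproj : proj k = s t) {a b c d v p q y z : ℝ}
    (hM : hc a b c d v p q y z ∈ k) : ∃ x, a = x * t ∧ c = 0 ∧ d = x * (t - 1) := by
  have := mem_proj_of hM
  rw [hproj, mem_s] at this
  obtain ⟨x, n, hx⟩ := this
  have e := fun i j => congrFun (congrFun hx i) j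
  exact ⟨x, by simpa using e 0 0, by simpa using e 1 0, by simpa using e 1 1⟩

theorem IsHIForm.second_of_proj_eq_s (hk : IsHIForm h k) {t v₀ p₀ q₀ y₀ z₀ v₁ p₁ q₁ y₁ z₁ : ℝ}
    (hproj : proj k = s t) (hm : ¬ mAll ≤ k) (hX : hc t 0 0 (t - 1) v₀ p₀ q₀ y₀ z₀ ∈ k)
    (hN : hc 0 1 0 0 v₁ p₁ q₁ y₁ z₁ ∈ k) {a b c d v p q y z : ℝ}
    (hM : hc a b c d v p q y z ∈ k) :
    ∃ x, a = x * t ∧ c = 0 ∧ d = x * (t - 1) ∧ q = x * q₀ + b * q₁ := by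
  obtain ⟨x, rfl, rfl, rfl⟩ := exists_of_proj_eq_s hproj hM
  have := k.add_mem (k.add_mem hM (k.smul_mem (-x) hX)) (k.smul_mem (-b) hN)
  rw [smul_hc, smul_hc, hc_add, hc_add] at this
  obtain ⟨_, _, _, h1⟩ :=
    exists_hc_of_eq this (by ring) (by ring) (by ring) (by ring) rfl rfl
  have := hk.second_eq_zero hN hm h1
  exact ⟨x, rfl, rfl, rfl, by linarith⟩

theorem IsHIForm.lie_of_proj_eq_s (hk : IsHIForm h k) {t v₀ p₀ q₀ y₀ z₀ v₁ p₁ q₁ y₁ z₁ : ℝ}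
    (hX : hc t 0 0 (t - 1) v₀ p₀ q₀ y₀ z₀ ∈ k) (hN : hc 0 1 0 0 v₁ p₁ q₁ y₁ z₁ ∈ k) :
    ∃ v y z, hc 0 0 0 0 v (t * p₁ - q₀ - p₁) ((t - 2) * q₁) y z ∈ k := by
  have := k.add_mem (hk.lie_mem hX hN) (k.smul_mem (-1) hN)
  rw [hc_lie, smul_hc, hc_add] at this
  exact exists_hc_of_eq this (by ring) (by ring) (by ring) (by ring) (by ring) (by ring)

/-- The relation `[X, N] = N` produces an element of `k ∩ 𝔪` with `u₂ = (t - 2) q₁`, which must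
vanish, so `q₁ ≠ 0` forces `t = 2`. If `q₁ = 0` and `q₀ = (t - 1) l` for some `l`, the line through
`e₂ + l e₁` is invariant; excluding this leaves `t = 1` and `q₀ ≠ 0`. -/
theorem IsHIForm.classify_s_aux (hk : IsHIForm h k) (h_indec : IsIndecomposable h)
    (h_type : IsTypeI h) {t v₀ p₀ q₀ y₀ z₀ v₁ p₁ q₁ y₁ z₁ : ℝ}
    (hproj : proj k = s t) (hm : ¬ mAll ≤ k) (hX : hc t 0 0 (t - 1) v₀ p₀ q₀ y₀ z₀ ∈ k)
    (hN : hc 0 1 0 0 v₁ p₁ q₁ y₁ z₁ ∈ k) : (t = 1 ∧ q₁ = 0 ∧ q₀ ≠ 0) ∨ (t = 2 ∧ q₁ ≠ 0) := by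
  have hQ := @IsHIForm.second_of_proj_eq_s _ _ hk _ _ _ _ _ _ _ _ _ _ _ hproj hm hX hN
  obtain ⟨_, _, _, h1⟩ := hk.lie_of_proj_eq_s hX hN
  have h2 := hk.second_eq_zero hN hm h1
  have hl : ∀ l, q₁ = 0 → q₀ ≠ (t - 1) * l := by
    intro l h0 h0'
    refine hk.not_forall_eigenvector h_indec h_type (w₁ := 1) (w₂ := 0) (by simp) l ?_
    intro a b c d v p q y z hM
    obtain ⟨x, rfl, rfl, rfl, rfl⟩ := hQ hM
    refine ⟨x * t, by ring, by ring, ?_⟩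
    rw [h0, h0']
    ring
  by_cases hq : q₁ = 0
  · left
    by_cases ht : t = 1
    · refine ⟨ht, hq, fun h0 => hl 0 hq (by rw [h0, mul_zero])⟩
    · have ht' : t - 1 ≠ 0 := sub_ne_zero.2 ht
      exact (hl (q₀ / (t - 1)) hq (by field_simp)).elim
  · right
    refine ⟨?_, hq⟩
    have := (mul_eq_zero.1 h2).resolve_right hq
    linarith

theorem mem_emb_line_N_sup {M : M7} : M ∈ emb (line N) ⊔ m 1 1 2 ↔
    ∃ b v p y z, M = hc 0 b 0 0 v p 0 y z := by
  simp only [Submodule.mem_sup, mem_emb, mem_line_N, mem_m_two]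
  constructor
  · rintro ⟨_, ⟨_, ⟨t, rfl⟩, rfl⟩, _, ⟨v, p, y, z, -, -, rfl⟩, rfl⟩
    exact ⟨t, v, p, y, z, by simp [hc_add]⟩
  · rintro ⟨b, v, p, y, z, rfl⟩
    exact ⟨_, ⟨_, ⟨b, rfl⟩, rfl⟩, _, ⟨v, p, y, z, by simp, by simp, rfl⟩, by simp [hc_add]⟩

theorem isSemidirect_emb_line_N :
    IsSemidirect (emb (line N) ⊔ m 1 1 2) (emb (line N)) (m 1 1 2) := by
  refine isSemidirect_of_forall ?_ ?_ ?_ le_sup_left ?_ ?_ ?_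
  · intro X hX Y hY
    obtain ⟨b, v, p, y, z, rfl⟩ := mem_emb_line_N_sup.1 hX
    obtain ⟨b', v', p', y', z', rfl⟩ := mem_emb_line_N_sup.1 hY
    rw [hc_lie, mem_emb_line_N_sup]
    simp only [zero_mul, mul_zero, sub_zero, add_zero]
    exact ⟨_, _, _, _, _, rfl⟩
  · intro X hX
    obtain ⟨b, v, p, y, z, rfl⟩ := mem_emb_line_N_sup.1 hX
    exact ⟨_, _, _, _, _, _, _, _, rfl⟩
  · intro M
    rw [mem_m_two, mem_emb_line_N_sup]
    constructor
    · rintro ⟨v, p, y, z, -, -, rfl⟩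
      exact ⟨⟨0, v, p, y, z, rfl⟩, v, p, y, z, rfl⟩
    · rintro ⟨-, v, p, y, z, rfl⟩
      exact ⟨v, p, y, z, by simp, by simp, rfl⟩
  · intro X hX Y hY
    obtain ⟨A, hA, rfl⟩ := mem_emb.1 hX
    obtain ⟨B, hB, rfl⟩ := mem_emb.1 hY
    obtain ⟨x, rfl⟩ := mem_line_N.1 hA
    obtain ⟨x', rfl⟩ := mem_line_N.1 hB
    rw [hc_lie]
    simp [← zero_eq_hc]
  · intro M hM
    obtain ⟨b, v, p, y, z, rfl⟩ := mem_emb_line_N_sup.1 hM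
    refine ⟨hc 0 b 0 0 0 0 0 0 0, mem_emb.2 ⟨_, mem_line_N.2 ⟨b, rfl⟩, by simp⟩, v, p, y, z, ?_⟩
    rw [sub_eq_iff_eq_add, hc_add]
    simp
  · intro M hM v p y z h2
    obtain ⟨A, hA, rfl⟩ := mem_emb.1 hM
    obtain ⟨x, rfl⟩ := mem_line_N.1 hA
    obtain ⟨-, e1, -⟩ := hc_inj h2
    rw [zero_eq_hc]
    simp at e1
    simp [e1]

/-- The difference `[X, N] - N` of lifts has `u = (-q₀, 0)`, a non-zero starting point for
`IsHIForm.hc_mem_of_dg`. -/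
theorem IsHIForm.classify_s_one (hk : IsHIForm h k) (h_sub : h ≤ g2star)
    {v₀ p₀ q₀ y₀ z₀ v₁ p₁ y₁ z₁ : ℝ}
    (hproj : proj k = s 1) (hm : ¬ mAll ≤ k) (hX : hc 1 0 0 0 v₀ p₀ q₀ y₀ z₀ ∈ k)
    (hN : hc 0 1 0 0 v₁ p₁ 0 y₁ z₁ ∈ k) (hq : q₀ ≠ 0) :
    ∃ k', IsHIForm h k' ∧ proj k' = s 1 ∧
      IsSemidirect k' (Submodule.span ℝ {hMat (dg 1 0) 0 ![0, 1] 0})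
        (emb (line N) ⊔ m 1 1 2) := by
  have hX' : hc 1 0 0 (1 - 1) v₀ p₀ q₀ y₀ z₀ ∈ k := by rwa [sub_self]
  obtain ⟨_, _, _, h1⟩ := hk.lie_of_proj_eq_s hX' hN
  rw [mul_zero] at h1
  have hmem := hk.hc_mem_of_dg hX h1 hq (by simpa using hq)
  obtain ⟨k', hk', H, hproj'⟩ := hk.exists_scale h_sub hq
  rw [hproj] at hproj'
  refine ⟨k', hk', hproj', ?_⟩
  have hmem' : ∀ v p y z, hc 0 0 0 0 v p 0 y z ∈ k' := by
    intro v p y z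
    rw [H, mul_zero]
    exact hmem _ _ _ _
  have hE : hc 1 0 0 0 0 0 1 0 0 ∈ k' := by
    rw [H]
    have := k.add_mem hX (hmem (-v₀) (-p₀) (-y₀) (-z₀))
    rw [hc_add] at this
    convert this using 1
    congr 1 <;> ring
  have hN' : hc 0 1 0 0 0 0 0 0 0 ∈ k' := by
    rw [H]
    have := k.add_mem hN (hmem (-v₁) (-p₁) (-y₁) (-z₁))
    rw [hc_add] at this
    convert this using 1
    congr 1 <;> ring
  have hform : ∀ X ∈ k', ∃ a b v p y z, X = hc a b 0 0 v p a y z := by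
    intro X hX₀
    obtain ⟨a, b, c, d, v, p, q, y, z, rfl, hM⟩ := hk'.exists_hc hX₀
    rw [H] at hM
    obtain ⟨x, rfl, rfl, rfl, e⟩ := hk.second_of_proj_eq_s hproj hm hX' hN hM
    have e' : q = x := mul_left_cancel₀ hq (by linarith)
    exact ⟨x, b, v, p, y, z, by rw [e', mul_one, sub_self, mul_zero]⟩
  have hmem'' : ∀ b v p y z, hc 0 b 0 0 v p 0 y z ∈ k' := by
    intro b v p y z
    have := k'.add_mem (k'.smul_mem b hN') (hmem' v p y z)
    rw [smul_hc, hc_add] at this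
    convert this using 1
    congr 1 <;> ring
  rw [hMat_eq_hc]
  simp only [dg, Matrix.of_apply, Matrix.cons_val, Pi.zero_apply]
  refine ⟨le_antisymm ?_ (sup_le ?_ ?_), ?_, fun X hX Y hY => lie_mem_span_singleton hX hY, ?_⟩
  · intro M hM
    obtain ⟨a, b, v, p, y, z, rfl⟩ := hform M hM
    refine Submodule.mem_sup.2 ⟨_, Submodule.smul_mem _ a (Submodule.mem_span_singleton_self _),
      hc 0 b 0 0 v p 0 y z, mem_emb_line_N_sup.2 ⟨_, _, _, _, _, rfl⟩, ?_⟩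
    rw [smul_hc, hc_add]
    congr 1 <;> ring
  · rw [Submodule.span_singleton_le_iff_mem]
    exact hE
  · intro M hM
    obtain ⟨b, v, p, y, z, rfl⟩ := mem_emb_line_N_sup.1 hM
    exact hmem'' _ _ _ _ _
  · rw [Submodule.disjoint_def]
    intro M h1 h2
    obtain ⟨b, v, p, y, z, h2⟩ := mem_emb_line_N_sup.1 h2
    obtain ⟨t, rfl⟩ := Submodule.mem_span_singleton.1 h1
    rw [smul_hc] at h2
    obtain ⟨e1, -⟩ := hc_inj h2
    have : t = 0 := by linarith
    rw [this, zero_smul]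
  · intro X hX Y hY
    obtain ⟨a, b, v, p, y, z, rfl⟩ := hform X hX
    obtain ⟨b', v', p', y', z', rfl⟩ := mem_emb_line_N_sup.1 hY
    rw [hc_lie, mem_emb_line_N_sup]
    simp only [zero_mul, mul_zero, sub_zero, add_zero]
    exact ⟨_, _, _, _, _, rfl⟩

/-- An element with `A = diag(2, 1)` can be conjugated to one with `v = 0` and `u = 0`. -/
theorem IsHIForm.exists_normalised (hk : IsHIForm h k) (h_sub : h ≤ g2star)
    {v₀ p₀ q₀ y₀ z₀ : ℝ} (hX : hc 2 0 0 1 v₀ p₀ q₀ y₀ z₀ ∈ k) :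
    ∃ k', IsHIForm h k' ∧ proj k' = proj k ∧ ∃ y z, hc 2 0 0 1 0 0 0 y z ∈ k' := by
  -- `diag(2,1)` is invertible on `u` and has trace 3 on `v`, so both components are coboundaries.
  -- `v` comes last because the shifts of `u` disturb it.
  obtain ⟨k₁, hk₁, hp₁, H₁⟩ := hk.exists_expU₁_proj h_sub (-p₀ / 2)
  obtain ⟨v₁, y₁, z₁, h1⟩ := H₁ hX
  obtain ⟨k₂, hk₂, hp₂, H₂⟩ := hk₁.exists_expU₂_proj h_sub (-q₀)
  obtain ⟨v₂, y₂, z₂, h2⟩ := H₂ h1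
  obtain ⟨k₃, hk₃, hp₃, H₃⟩ := hk₂.exists_expV_proj h_sub (-v₂ / 3)
  obtain ⟨y₃, z₃, h3⟩ := H₃ h2
  refine ⟨k₃, hk₃, by rw [hp₃, hp₂, hp₁], y₃, z₃, ?_⟩
  convert h3 using 1
  congr 1 <;> ring

/-- The Berger condition supplies a curvature tensor with non-zero component along `X`, so `p` or
`q` is non-zero. Each of the cases `q ≠ 0`, `t ≠ 0` and `p ≠ 0` with `q = t = 0` leads to an element
of `k` with only `y`-components and `y₂ ≠ 0`; the lift of `N` carries `y₂` to `y₁`. -/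
theorem IsHIForm.hc_mem_of_s_two (hk : IsHIForm h k) (h_berger : IsBerger h)
    (hshape : ∀ {a b c d v p q y z}, hc a b c d v p q y z ∈ k →
      a = 2 * d ∧ c = 0 ∧ q = b) {y₀ z₀ v₁ p₁ y₁ z₁ : ℝ}
    (hX : hc 2 0 0 1 0 0 0 y₀ z₀ ∈ k)
    (hN : hc 0 1 0 0 v₁ p₁ 1 y₁ z₁ ∈ k) (y z : ℝ) : hc 0 0 0 0 0 0 0 y z ∈ k := by
  obtain ⟨r, hr, i, j, hne⟩ : ∃ r, IsCurv k r ∧ ∃ i j, r i j 2 2 ≠ 0 := by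
    by_contra! H
    have := hk.form.eq_zero_of_curv h_berger (Matrix.entryLinearMap ℝ ℝ 2 2) H _ hX
    simp [hc_eq] at this
  have hrel := hr.relations (k := k) ?_
  swap
  · intro M hM
    obtain ⟨a, b, c, d, v, p, q, y, z, rfl, hM⟩ := hk.exists_hc hM
    obtain ⟨rfl, rfl, rfl⟩ := hshape hM
    exact ⟨d, q, v, p, y, z, rfl⟩
  obtain ⟨p, q, s, t, ζ, -, m0, ⟨y₂, m1⟩, ⟨y₃, m2⟩, -, -, -, h22, -⟩ := hrel
  have hpq : p ≠ 0 ∨ q ≠ 0 := by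
    by_contra! H
    exact hne (h22 H.1 H.2 i j)
  have hD : ∀ {v p y z}, hc 0 0 0 0 v p 0 y z ∈ k →
      hc 0 0 0 0 (-2 * p) 0 0 (z + 3 * (v * p₁ - v₁ * p)) (3 * v) ∈ k := by
    intro v p y z hM
    have := hk.lie_mem hN hM
    rw [hc_lie] at this
    convert this using 1
    congr 1 <;> ring
  have hz : ∀ {y' z' : ℝ}, z' ≠ 0 → hc 0 0 0 0 0 0 0 y' z' ∈ k →
      ∀ y z, hc 0 0 0 0 0 0 0 y z ∈ k := by
    intro y' z' hz' hM y z
    have h1 := hD hM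
    simp only [mul_zero, zero_mul, sub_zero, add_zero] at h1
    have := k.add_mem (k.smul_mem (z / z') hM) (k.smul_mem ((y - z / z' * y') / z') h1)
    rw [smul_hc, smul_hc, hc_add, div_mul_cancel₀ _ hz', div_mul_cancel₀ _ hz'] at this
    simpa using this
  by_cases hq : q = 0
  · subst hq
    have hp : p ≠ 0 := by simpa using hpq
    simp only [mul_zero] at m1 m2
    by_cases ht : t = 0
    · subst ht
      rw [sub_zero] at m2
      have h1 := hD m2
      simp only [mul_zero, sub_zero] at h1
      exact hz (mul_ne_zero three_ne_zero hp) h1 y z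
    · exact hz (neg_ne_zero.2 ht) m1 y z
  · exact hz hq m0 y z

theorem IsHIForm.classify_s_two (hk : IsHIForm h k) (h_sub : h ≤ g2star) (h_berger : IsBerger h)
    {y₀ z₀ v₁ p₁ q₁ y₁ z₁ : ℝ}
    (hproj : proj k = s 2) (hm : ¬ mAll ≤ k) (hX : hc 2 0 0 1 0 0 0 y₀ z₀ ∈ k)
    (hN : hc 0 1 0 0 v₁ p₁ q₁ y₁ z₁ ∈ k) (hq : q₁ ≠ 0) :
    ∃ k', IsHIForm h k' ∧ proj k' = s 2 ∧ ∃ i j,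
      IsSemidirect k' (Submodule.span ℝ {hMat (dg 2 1) 0 0 0, hMat N 0 ![0, 1] 0})
        (m i j 2) := by
  have hX' : hc 2 0 0 (2 - 1) 0 0 0 y₀ z₀ ∈ k := by norm_num; exact hX
  obtain ⟨k', hk', H, hproj'⟩ := hk.exists_scale h_sub hq
  rw [hproj] at hproj'
  refine ⟨k', hk', hproj', ?_⟩
  have hshape : ∀ {a b c d v p q y z}, hc a b c d v p q y z ∈ k' → a = 2 * d ∧ c = 0 ∧ q = b := by
    intro a b c d v p q y z hM
    rw [H] at hM
    obtain ⟨x, rfl, rfl, rfl, e⟩ := hk.second_of_proj_eq_s hproj hm hX' hN hM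
    exact ⟨by ring, rfl, mul_left_cancel₀ hq (by linarith)⟩
  have hX₁ : hc 2 0 0 1 0 0 0 (y₀ / q₁ ^ 3) (z₀ / q₁ ^ 3) ∈ k' := by
    rw [H]
    convert hX using 1
    congr 1 <;> first | exact mul_zero _ | field_simp
  have hN₁ : hc 0 1 0 0 (v₁ / q₁ ^ 2) (p₁ / q₁) 1 (y₁ / q₁ ^ 3) (z₁ / q₁ ^ 3) ∈ k' := by
    rw [H]
    convert hN using 1
    congr 1 <;> first | exact mul_zero _ | field_simp
  have hY := hk'.hc_mem_of_s_two h_berger hshape hX₁ hN₁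
  have hE₁ : hc 2 0 0 1 0 0 0 0 0 ∈ k' := by
    have := k'.add_mem hX₁ (hY (-(y₀ / q₁ ^ 3)) (-(z₀ / q₁ ^ 3)))
    rw [hc_add] at this
    convert this using 1
    congr 1 <;> ring
  -- `ad X` has eigenvalue 3 on `v` and 2 on `u₁`, so `ad X - 2` isolates `v` modulo `y`. This
  -- splitting is why `i` and `j` can be chosen independently.
  have hV : ∀ {v p y z}, hc 0 0 0 0 v p 0 y z ∈ k' → hc 0 0 0 0 v 0 0 0 0 ∈ k' := by
    intro v p y z hM
    have h1 := hk'.lie_mem hE₁ hM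
    rw [hc_lie] at h1
    have := k'.add_mem (k'.add_mem h1 (k'.smul_mem (-2) hM)) (hY (-3 * y) (-2 * z))
    rw [smul_hc, hc_add, hc_add] at this
    convert this using 1
    congr 1 <;> ring
  -- `N` and `u₂` have eigenvalue 1 under `ad X`, so `[X, N₁] - N₁` has only components `v`, `u₁`,
  -- `y`. Splitting it removes these components from the lift `N₁`.
  have hE₂ : hc 0 1 0 0 0 0 1 0 0 ∈ k' := by
    generalize v₁ / q₁ ^ 2 = v₂ at hN₁
    generalize p₁ / q₁ = p₂ at hN₁
    have h1 := k'.add_mem (hk'.lie_mem hE₁ hN₁) (k'.smul_mem (-1) hN₁)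
    rw [hc_lie, smul_hc, hc_add] at h1
    have h2 : hc 0 0 0 0 (2 * v₂) p₂ 0 (4 * (y₁ / q₁ ^ 3)) (3 * (z₁ / q₁ ^ 3)) ∈ k' := by
      convert h1 using 1
      congr 1 <;> ring
    have h3 := k'.add_mem (k'.add_mem hN₁ (k'.smul_mem (-1) h2))
      (k'.add_mem (k'.smul_mem (1 / 2) (hV h2)) (hY (3 * (y₁ / q₁ ^ 3)) (2 * (z₁ / q₁ ^ 3))))
    rw [smul_hc, smul_hc, hc_add, hc_add, hc_add] at h3
    convert h3 using 1
    congr 1 <;> ring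
  obtain ⟨i, j, -, hn⟩ := exists_m_two_iff hY hV
  refine ⟨i, j, ?_⟩
  rw [hMat_eq_hc, hMat_eq_hc]
  simp only [dg, N, Matrix.of_apply, Matrix.cons_val, Pi.zero_apply]
  have hform : ∀ X ∈ k', ∃ b d v p y z, X = hc (2 * d) b 0 d v p b y z := by
    intro X hX
    obtain ⟨a, b, c, d, v, p, q, y, z, rfl, hX⟩ := hk'.exists_hc hX
    obtain ⟨rfl, rfl, rfl⟩ := hshape hX
    exact ⟨_, _, _, _, _, _, rfl⟩
  refine isSemidirect_of_forall (fun X hX Y hY => hk'.lie_mem hX hY) ?_ hn ?_ ?_ ?_ ?_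
  · intro X hX
    obtain ⟨b, d, v, p, y, z, rfl⟩ := hform X hX
    exact ⟨_, _, _, _, _, _, _, _, rfl⟩
  · rw [Submodule.span_le]
    rintro M (rfl | rfl)
    · exact hE₁
    · exact hE₂
  · intro X hX Y hY
    obtain ⟨x₁, x₂, rfl⟩ := Submodule.mem_span_pair.1 hX
    obtain ⟨w₁, w₂, rfl⟩ := Submodule.mem_span_pair.1 hY
    refine Submodule.mem_span_pair.2 ⟨0, x₁ * w₂ - w₁ * x₂, ?_⟩
    simp only [smul_hc, hc_add, hc_lie]
    congr 1 <;> ring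
  · intro M hM
    obtain ⟨b, d, v, p, y, z, rfl⟩ := hform M hM
    refine ⟨_, Submodule.mem_span_pair.2 ⟨d, b, rfl⟩, v, p, y, z, ?_⟩
    rw [smul_hc, smul_hc, hc_add, sub_eq_iff_eq_add, hc_add]
    congr 1 <;> ring
  · intro M hM v p y z h2
    obtain ⟨x₁, x₂, rfl⟩ := Submodule.mem_span_pair.1 hM
    rw [smul_hc, smul_hc, hc_add] at h2
    obtain ⟨e1, e2, -⟩ := hc_inj h2
    have h1 : x₁ = 0 := by linarith
    have h2 : x₂ = 0 := by linarith
    rw [h1, h2, zero_smul, zero_smul, add_zero]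

theorem IsHIForm.classify_s (hk : IsHIForm h k) (h_sub : h ≤ g2star)
    (h_indec : IsIndecomposable h) (h_type : IsTypeI h) (h_berger : IsBerger h) {t : ℝ}
    (hproj : proj k = s t) :
    ∃ k', IsHIForm h k' ∧ proj k' = s t ∧ (mAll ≤ k' ∨
      (t = 1 ∧ IsSemidirect k' (Submodule.span ℝ {hMat (dg 1 0) 0 ![0, 1] 0})
        (emb (line N) ⊔ m 1 1 2)) ∨
      (t = 2 ∧ ∃ i j,
        IsSemidirect k' (Submodule.span ℝ {hMat (dg 2 1) 0 0 0, hMat N 0 ![0, 1] 0})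
          (m i j 2))) := by
  have hex : ∀ {k t}, proj k = s t → (∃ v p q y z, hc t 0 0 (t - 1) v p q y z ∈ k) ∧
      ∃ v p q y z, hc 0 1 0 0 v p q y z ∈ k := by
    intro k t hproj
    constructor
    · apply exists_hc_of_mem_proj
      rw [hproj, mem_s]
      exact ⟨1, 0, by simp⟩
    · apply exists_hc_of_mem_proj
      rw [hproj, mem_s]
      exact ⟨0, 1, by simp⟩
  by_cases hm : mAll ≤ k
  · exact ⟨k, hk, hproj, Or.inl hm⟩
  obtain ⟨⟨v₀, p₀, q₀, y₀, z₀, hX⟩, v₁, p₁, q₁, y₁, z₁, hN⟩ := hex hproj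
  rcases hk.classify_s_aux h_indec h_type hproj hm hX hN with ⟨rfl, rfl, hq⟩ | ⟨rfl, hq⟩
  · rw [sub_self] at hX
    obtain ⟨k', hk', hproj', hs⟩ := hk.classify_s_one h_sub hproj hm hX hN hq
    exact ⟨k', hk', hproj', Or.inr (Or.inl ⟨rfl, hs⟩)⟩
  · have h21 : (2 : ℝ) - 1 = 1 := by norm_num
    rw [h21] at hX
    obtain ⟨k', hk', hproj', y₂, z₂, hX'⟩ := hk.exists_normalised h_sub hX
    rw [hproj] at hproj'
    by_cases hm' : mAll ≤ k'
    · exact ⟨k', hk', hproj', Or.inl hm'⟩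
    -- Normalising `X` also alters the lift of `N`, so a new lift is chosen and the dichotomy is
    -- applied again.
    obtain ⟨-, v₃, p₃, q₃, y₃, z₃, hN'⟩ := hex hproj'
    have hX'' : hc 2 0 0 (2 - 1) 0 0 0 y₂ z₂ ∈ k' := by rwa [h21]
    rcases hk'.classify_s_aux h_indec h_type hproj' hm' hX'' hN' with ⟨h0, -⟩ | ⟨-, hq'⟩
    · norm_num at h0
    · obtain ⟨k'', hk'', hproj'', hs⟩ := hk'.classify_s_two h_sub h_berger hproj' hm' hX' hN' hq'
      exact ⟨k'', hk'', hproj'', Or.inr (Or.inr ⟨rfl, hs⟩)⟩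

end

/-! ### Subalgebras of `𝔤𝔩(2, ℝ)` up to conjugation -/

/-- `b = Q a P`, where `P Q = 1`. -/
def IsConjugate (a b : Submodule ℝ M2) : Prop :=
  ∃ P Q : M2, P * Q = 1 ∧ ∀ A, A ∈ b ↔ P * A * Q ∈ a

/-- `B = Q A P`, where `P Q = 1`. -/
def IsSimilar (A B : M2) : Prop :=
  ∃ P Q : M2, P * Q = 1 ∧ Q * A * P = B

theorem IsSimilar.trans {A B D : M2} (h₁ : IsSimilar A B) (h₂ : IsSimilar B D) :
    IsSimilar A D := by
  obtain ⟨P, Q, hPQ, rfl⟩ := h₁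
  obtain ⟨P', Q', hPQ', rfl⟩ := h₂
  refine ⟨P * P', Q' * Q, ?_, by simp only [Matrix.mul_assoc]⟩
  rw [Matrix.mul_assoc, ← Matrix.mul_assoc P', hPQ', Matrix.one_mul, hPQ]

theorem isSimilar_of_mul_eq {A B P : M2} (hP : P.det ≠ 0) (h : A * P = P * B) :
    IsSimilar A B := by
  refine ⟨P, P⁻¹, Matrix.mul_nonsing_inv _ (isUnit_iff_ne_zero.mpr hP), ?_⟩
  rw [Matrix.mul_assoc, h, ← Matrix.mul_assoc,
    Matrix.nonsing_inv_mul _ (isUnit_iff_ne_zero.mpr hP), Matrix.one_mul]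

theorem isSimilar_upper (x b y : ℝ) :
    (∃ x' y', IsSimilar !![x, b; 0, y] (dg x' y')) ∨
      ∃ x', IsSimilar !![x, b; 0, y] !![x', 1; 0, x'] := by
  rcases eq_or_ne x y with rfl | hxy
  · rcases eq_or_ne b 0 with rfl | hb
    · exact Or.inl ⟨x, x, 1, 1, by simp, by simp [dg]⟩
    · refine Or.inr ⟨x, isSimilar_of_mul_eq (P := dg b 1) (by simpa [dg]) ?_⟩
      ext i j; fin_cases i <;> fin_cases j <;> simp [dg, Matrix.mul_apply, mul_comm]
  · have hyx : y - x ≠ 0 := sub_ne_zero.mpr hxy.symm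
    refine Or.inl ⟨x, y, isSimilar_of_mul_eq (P := !![1, b / (y - x); 0, 1]) (by simp) ?_⟩
    ext i j; fin_cases i <;> fin_cases j <;> simp [dg, Matrix.mul_apply]
    field_simp
    ring

theorem isSimilar_normalForm (A : M2) :
    (∃ x y, IsSimilar A (dg x y)) ∨ (∃ x, IsSimilar A !![x, 1; 0, x]) ∨
      ∃ x y, y ≠ 0 ∧ IsSimilar A !![x, -y; y, x] := by
  obtain ⟨a, b, c, e, rfl⟩ : ∃ a b c e, A = !![a, b; c, e] :=
    ⟨_, _, _, _, Matrix.eta_fin_two A⟩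
  rcases le_or_gt 0 ((a - e) ^ 2 + 4 * (b * c)) with hD | hD
  · have h : (∃ x y, IsSimilar !![a, b; c, e] (dg x y)) ∨
        ∃ x, IsSimilar !![a, b; c, e] !![x, 1; 0, x] := by
      rcases eq_or_ne c 0 with rfl | hc
      · exact isSimilar_upper a b e
      obtain ⟨r, hr⟩ : ∃ r, r * r = (a - e) ^ 2 + 4 * (b * c) := ⟨_, Real.mul_self_sqrt hD⟩
      -- The first column of `P` is an eigenvector for `(a + e + r) / 2`; the second is the first
      -- standard vector.
      have hs : IsSimilar !![a, b; c, e] !![(a + e + r) / 2, 1; 0, (a + e - r) / 2] := by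
        refine isSimilar_of_mul_eq (P := !![(a - e + r) / 2, 1; c, 0]) (by simpa) ?_
        ext i j; fin_cases i <;> fin_cases j <;> simp [Matrix.mul_apply] <;> linarith
      rcases isSimilar_upper ((a + e + r) / 2) 1 ((a + e - r) / 2) with ⟨x, y, h'⟩ | ⟨x, h'⟩
      · exact Or.inl ⟨x, y, hs.trans h'⟩
      · exact Or.inr ⟨x, hs.trans h'⟩
    exact h.imp_right Or.inl
  · obtain ⟨r, hr⟩ : ∃ r, r * r = -((a - e) ^ 2 + 4 * (b * c)) :=
      ⟨_, Real.mul_self_sqrt (by linarith)⟩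
    have hr0 : r ≠ 0 := by rintro rfl; linarith
    have hc : c ≠ 0 := by rintro rfl; nlinarith [sq_nonneg (a - e)]
    refine Or.inr (Or.inr ⟨(a + e) / 2, r / 2, by simpa, ?_⟩)
    -- `B = A - (tr A)/2` has square `-r²/4`. With `ε` the first standard vector, the columns of `P`
    -- are `r ε` and `2 B ε`, which `B` rotates up to the factor `r/2`.
    refine isSimilar_of_mul_eq (P := !![r, a - e; 0, 2 * c]) (by simp [hr0, hc]) ?_
    ext i j; fin_cases i <;> fin_cases j <;> simp [Matrix.mul_apply] <;> linarith

theorem mul_conj_mul {P Q : M2} (hPQ : P * Q = 1) (A : M2) : P * (Q * A * P) * Q = A := by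
  rw [← Matrix.mul_assoc, ← Matrix.mul_assoc, hPQ, Matrix.one_mul, Matrix.mul_assoc, hPQ,
    Matrix.mul_one]

theorem isConjugate_span {P Q : M2} (hPQ : P * Q = 1) (t : Set M2) :
    IsConjugate (Submodule.span ℝ t) (Submodule.span ℝ ((fun A => Q * A * P) '' t)) := by
  have hQP : Q * P = 1 := mul_eq_one_comm.mp hPQ
  refine ⟨P, Q, hPQ, fun A => ?_⟩
  have h : (fun A => Q * A * P) =
      ⇑(LinearMap.mulRight ℝ P ∘ₗ LinearMap.mulLeft ℝ Q : M2 →ₗ[ℝ] M2) := by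
    ext; simp
  rw [h, Submodule.span_image, Submodule.mem_map]
  constructor
  · rintro ⟨B, hB, rfl⟩
    simpa [mul_conj_mul hPQ] using hB
  · intro hA
    refine ⟨_, hA, ?_⟩
    exact mul_conj_mul hQP A

theorem isConjugate_refl (a : Submodule ℝ M2) : IsConjugate a a :=
  ⟨1, 1, by simp, by simp⟩

/-- The representatives of the conjugacy classes of subalgebras of `𝔤𝔩(2, ℝ)`. -/
def IsStandard (b : Submodule ℝ M2) : Prop :=
  b = ⊥ ∨ b = sl2 ∨ b = ⊤ ∨ b = u1 ∨ b = b2 ∨ b = b2hat ∨ b = d ∨ (∃ c, b = line (C c)) ∨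
    b = line S ∨ (∃ t, b = s t) ∨ (∃ μ ∈ Set.Icc (-1 : ℝ) 1, b = line (dg 1 μ)) ∨ b = line N

theorem line_smul (A : M2) {c : ℝ} (hc : c ≠ 0) : line (c • A) = line A :=
  Submodule.span_singleton_smul_eq (isUnit_iff_ne_zero.mpr hc) A

theorem IsSimilar.isConjugate_line {A B : M2} (h : IsSimilar A B) :
    IsConjugate (line A) (line B) := by
  obtain ⟨P, Q, hPQ, rfl⟩ := h
  simpa [line] using isConjugate_span hPQ {A}

theorem line_dg_standard {x y : ℝ} (hx : x ≠ 0) (hxy : |y| ≤ |x|) : IsStandard (line (dg x y)) := by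
  have h : dg x y = x • dg 1 (y / x) := by
    ext i j; fin_cases i <;> fin_cases j <;> simp [dg]
    field_simp
  rw [h, line_smul _ hx]
  refine Or.inr <| Or.inr <| Or.inr <| Or.inr <| Or.inr <| Or.inr <| Or.inr <| Or.inr <| Or.inr <|
    Or.inr <| Or.inl ⟨_, ?_, rfl⟩
  rw [Set.mem_Icc, ← abs_le, abs_div]
  exact div_le_one_of_le₀ hxy (abs_nonneg x)

theorem exists_standard_line {A : M2} (hA : A ≠ 0) : ∃ b, IsConjugate (line A) b ∧ IsStandard b := by
  rcases isSimilar_normalForm A with ⟨x, y, h⟩ | ⟨x, h⟩ | ⟨x, y, hy, h⟩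
  · have hne : x ≠ 0 ∨ y ≠ 0 := by
      by_contra! h0
      obtain ⟨P, Q, hPQ, h⟩ := h
      have h1 : Q * A * P = 0 := by
        rw [h, h0.1, h0.2]; ext i j; fin_cases i <;> fin_cases j <;> simp [dg]
      apply hA
      calc A = P * (Q * A * P) * Q := (mul_conj_mul hPQ _).symm
        _ = 0 := by rw [h1]; simp
    -- Putting the eigenvalue of larger absolute value first makes the ratio lie in `[-1, 1]`.
    rcases le_total |y| |x| with hxy | hxy
    · have hx : x ≠ 0 := by
        rintro rfl
        simp at hxy
        simp [hxy] at hne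
      exact ⟨_, h.isConjugate_line, line_dg_standard hx hxy⟩
    · have hy : y ≠ 0 := by
        rintro rfl
        simp at hxy
        simp [hxy] at hne
      have hs : IsSimilar (dg x y) (dg y x) := by
        refine isSimilar_of_mul_eq (P := !![0, 1; 1, 0]) (by simp) ?_
        ext i j; fin_cases i <;> fin_cases j <;> simp [dg, Matrix.mul_apply]
      exact ⟨_, (h.trans hs).isConjugate_line, line_dg_standard hy hxy⟩
  · rcases eq_or_ne x 0 with rfl | hx
    · exact ⟨_, h.isConjugate_line, by simp [IsStandard, N]⟩
    · have hs : IsSimilar !![x, 1; 0, x] (x • S) := by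
        refine isSimilar_of_mul_eq (P := dg 1 x) (by simpa [dg]) ?_
        ext i j; fin_cases i <;> fin_cases j <;> simp [dg, S, Matrix.mul_apply]
      refine ⟨_, (h.trans hs).isConjugate_line, ?_⟩
      rw [line_smul _ hx]
      simp [IsStandard]
  · refine ⟨_, h.isConjugate_line, ?_⟩
    have h : !![x, -y; y, x] = y • C (x / y) := by
      ext i j; fin_cases i <;> fin_cases j <;> simp [C] <;> field_simp
    rw [h, line_smul _ hy]
    exact Or.inr <| Or.inr <| Or.inr <| Or.inr <| Or.inr <| Or.inr <| Or.inr <| Or.inl ⟨_, rfl⟩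

theorem IsSimilar.isConjugate_span_one {A B : M2} (h : IsSimilar A B) :
    IsConjugate (Submodule.span ℝ {1, A}) (Submodule.span ℝ {1, B}) := by
  obtain ⟨P, Q, hPQ, rfl⟩ := h
  simpa [Set.image_pair, mul_eq_one_comm.mp hPQ] using isConjugate_span hPQ {1, A}

theorem span_pair_eq {A B A' B' : M2} (h₁ : A ∈ Submodule.span ℝ {A', B'})
    (h₂ : B ∈ Submodule.span ℝ {A', B'}) (h₃ : A' ∈ Submodule.span ℝ {A, B})
    (h₄ : B' ∈ Submodule.span ℝ {A, B}) :
    Submodule.span ℝ {A, B} = Submodule.span ℝ {A', B'} := by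
  apply le_antisymm <;> rw [Submodule.span_le, Set.insert_subset_iff, Set.singleton_subset_iff]
  exacts [⟨h₁, h₂⟩, ⟨h₃, h₄⟩]

theorem exists_standard_span_one {A : M2} (hA : ∀ c : ℝ, A ≠ c • (1 : M2)) :
    ∃ b, IsConjugate (Submodule.span ℝ {1, A}) b ∧ IsStandard b := by
  rcases isSimilar_normalForm A with ⟨x, y, h⟩ | ⟨x, h⟩ | ⟨x, y, hy, h⟩
  · have hxy : x - y ≠ 0 := by
      intro h0
      obtain rfl : x = y := sub_eq_zero.mp h0
      obtain ⟨P, Q, hPQ, h⟩ := h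
      apply hA x
      calc A = P * (Q * A * P) * Q := (mul_conj_mul hPQ _).symm
        _ = P * (x • (1 : M2)) * Q := by
            rw [h]; congr 2; ext i j; fin_cases i <;> fin_cases j <;> simp [dg]
        _ = x • (1 : M2) := by simp [hPQ]
    refine ⟨_, h.isConjugate_span_one, ?_⟩
    have : Submodule.span ℝ {1, dg x y} = d := by
      apply span_pair_eq <;> rw [Submodule.mem_span_pair]
      · exact ⟨1, 1, by ext i j; fin_cases i <;> fin_cases j <;> simp [dg]⟩
      · exact ⟨x, y, by ext i j; fin_cases i <;> fin_cases j <;> simp [dg]⟩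
      · refine ⟨-y / (x - y), 1 / (x - y), ?_⟩
        ext i j; fin_cases i <;> fin_cases j <;> simp [dg] <;> field_simp <;> ring
      · refine ⟨x / (x - y), -1 / (x - y), ?_⟩
        ext i j; fin_cases i <;> fin_cases j <;> simp [dg] <;> field_simp <;> ring
    simp [this, IsStandard]
  · refine ⟨_, h.isConjugate_span_one, ?_⟩
    have : Submodule.span ℝ {1, !![x, 1; 0, x]} = b2hat := by
      apply span_pair_eq <;> rw [Submodule.mem_span_pair]
      · exact ⟨1, 0, by simp⟩
      · exact ⟨x, 1, by ext i j; fin_cases i <;> fin_cases j <;> simp [N]⟩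
      · exact ⟨1, 0, by simp⟩
      · exact ⟨-x, 1, by ext i j; fin_cases i <;> fin_cases j <;> simp [N]⟩
    simp [this, IsStandard]
  · refine ⟨_, h.isConjugate_span_one, ?_⟩
    have : Submodule.span ℝ {1, !![x, -y; y, x]} = u1 := by
      apply span_pair_eq <;> rw [Submodule.mem_span_pair]
      · exact ⟨1, 0, by ext i j; fin_cases i <;> fin_cases j <;> simp [dg]⟩
      · exact ⟨x, y, by ext i j; fin_cases i <;> fin_cases j <;> simp [dg, C]⟩
      · exact ⟨1, 0, by ext i j; fin_cases i <;> fin_cases j <;> simp [dg]⟩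
      · exact ⟨-x / y, 1 / y, by
          ext i j; fin_cases i <;> fin_cases j <;> simp [C] <;> field_simp <;> ring⟩
    simp [this, IsStandard]

theorem lie_conj {P Q : M2} (hPQ : P * Q = 1) (A B : M2) :
    ⁅Q * A * P, Q * B * P⁆ = Q * ⁅A, B⁆ * P := by
  have h : ∀ A B : M2, Q * A * P * (Q * B * P) = Q * (A * B) * P := fun A B => by
    calc Q * A * P * (Q * B * P) = Q * A * (P * Q) * B * P := by simp only [Matrix.mul_assoc]
      _ = _ := by rw [hPQ]; simp only [Matrix.mul_assoc, Matrix.mul_one]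
  rw [LieRing.of_associative_ring_bracket, LieRing.of_associative_ring_bracket, h, h,
    Matrix.mul_sub, Matrix.sub_mul]

/-- Among the normal forms only a nilpotent `Z` is compatible with `[X, Z] = Z`, so `Z` becomes `N`.
Then `X` is upper triangular with diagonal `(p, p - 1)`, and its remaining entry is absorbed by `N`.
-/
theorem exists_standard_span_of_lie_eq {X Z : M2} (hZ : Z ≠ 0) (h : ⁅X, Z⁆ = Z) :
    ∃ b, IsConjugate (Submodule.span ℝ {X, Z}) b ∧ IsStandard b := by
  suffices hs : ∃ P Q : M2, ∃ p q : ℝ, P * Q = 1 ∧ Q * Z * P = N ∧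
      Q * X * P = !![p, q; 0, p - 1] by
    obtain ⟨P, Q, p, q, hPQ, h₁, h₂⟩ := hs
    refine ⟨_, isConjugate_span hPQ _, ?_⟩
    rw [Set.image_pair, h₁, h₂]
    have : Submodule.span ℝ {!![p, q; 0, p - 1], N} = s p := by
      apply span_pair_eq <;> rw [Submodule.mem_span_pair]
      · exact ⟨1, q, by ext i j; fin_cases i <;> fin_cases j <;> simp [dg, N]⟩
      · exact ⟨0, 1, by simp⟩
      · exact ⟨1, -q, by ext i j; fin_cases i <;> fin_cases j <;> simp [dg, N]⟩
      · exact ⟨0, 1, by simp⟩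
    rw [this]
    simp [IsStandard]
  have key : ∀ P Q : M2, P * Q = 1 → ∀ Z' : M2, Q * Z * P = Z' →
      Z' ≠ 0 ∧ ∃ p q r e : ℝ, Q * X * P = !![p, q; r, e] ∧
        !![p, q; r, e] * Z' - Z' * !![p, q; r, e] = Z' := by
    rintro P Q hPQ Z' rfl
    constructor
    · intro h0
      apply hZ
      calc Z = P * (Q * Z * P) * Q := (mul_conj_mul hPQ _).symm
        _ = 0 := by rw [h0]; simp
    · refine ⟨_, _, _, _, Matrix.eta_fin_two _, ?_⟩
      rw [← Matrix.eta_fin_two, ← LieRing.of_associative_ring_bracket, lie_conj hPQ, h]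
  rcases isSimilar_normalForm Z with ⟨x, y, P, Q, hPQ, hs⟩ | ⟨x, P, Q, hPQ, hs⟩ |
    ⟨x, y, hy, P, Q, hPQ, hs⟩ <;> obtain ⟨h0, p, q, r, e, hX, he⟩ := key P Q hPQ _ hs <;>
    have h00 := congrFun (congrFun he 0) 0 <;> have h01 := congrFun (congrFun he 0) 1 <;>
    have h10 := congrFun (congrFun he 1) 0 <;> have h11 := congrFun (congrFun he 1) 1 <;>
    simp [dg] at h00 h01 h10 h11
  · exfalso
    apply h0
    have hx : x = 0 := by linarith
    have hy : y = 0 := by linarith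
    rw [hx, hy]
    ext i j; fin_cases i <;> fin_cases j <;> simp [dg]
  · have hx : x = 0 := by linarith
    subst hx
    have hr : r = 0 := by linarith
    subst hr
    refine ⟨P, Q, p, q, hPQ, by rw [hs, N], ?_⟩
    rw [hX]
    have : e = p - 1 := by linarith
    rw [this]
  · exact absurd (by linarith) hy

theorem exists_smul_add_smul_of_lie_eq_zero {A B : M2} (hA : ∀ c : ℝ, A ≠ c • (1 : M2))
    (h : ⁅A, B⁆ = 0) : ∃ x y : ℝ, B = x • (1 : M2) + y • A := by
  obtain ⟨a, b, c, e, rfl⟩ : ∃ a b c e, A = !![a, b; c, e] :=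
    ⟨_, _, _, _, Matrix.eta_fin_two A⟩
  obtain ⟨p, q, r, t, rfl⟩ : ∃ a b c e, B = !![a, b; c, e] :=
    ⟨_, _, _, _, Matrix.eta_fin_two B⟩
  rw [LieRing.of_associative_ring_bracket] at h
  have h00 := congrFun (congrFun h 0) 0
  have h01 := congrFun (congrFun h 0) 1
  have h10 := congrFun (congrFun h 1) 0
  simp at h00 h01 h10
  by_cases hb : b = 0
  · by_cases hc : c = 0
    · subst hb hc
      have hae : a - e ≠ 0 := by
        intro h0
        apply hA a
        obtain rfl : a = e := sub_eq_zero.mp h0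
        ext i j; fin_cases i <;> fin_cases j <;> simp
      have hq : q = 0 := by
        have : (a - e) * q = 0 := by linarith
        simpa [hae] using this
      have hr : r = 0 := by
        have : (a - e) * r = 0 := by linarith
        simpa [hae] using this
      refine ⟨p - (p - t) / (a - e) * a, (p - t) / (a - e), ?_⟩
      ext i j; fin_cases i <;> fin_cases j <;> simp [hq, hr]
      field_simp; ring
    · refine ⟨p - r / c * a, r / c, ?_⟩
      ext i j; fin_cases i <;> fin_cases j <;> simp <;> field_simp <;> linarith
  · refine ⟨p - q / b * a, q / b, ?_⟩
    ext i j; fin_cases i <;> fin_cases j <;> simp <;> field_simp <;> linarith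

/-- An abelian plane contains the identity, because the centraliser of a non-scalar `A` is spanned
by `1` and `A`. In a non-abelian plane `[A, B]` is an eigenvector of `ad A` and `ad B`, and a
multiple of one of them acts on it as the identity. -/
theorem exists_standard_span_pair {A B : M2} (hAB : LinearIndependent ℝ ![A, B])
    (h : ⁅A, B⁆ ∈ Submodule.span ℝ {A, B}) :
    ∃ b, IsConjugate (Submodule.span ℝ {A, B}) b ∧ IsStandard b := by
  rw [LinearIndependent.pair_iff] at hAB
  rcases eq_or_ne ⁅A, B⁆ 0 with h0 | h0
  · have key : ∀ {A B : M2}, (∀ x y : ℝ, x • A + y • B = 0 → x = 0 ∧ y = 0) → ⁅A, B⁆ = 0 →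
        (∀ c : ℝ, A ≠ c • (1 : M2)) →
        ∃ b, IsConjugate (Submodule.span ℝ {A, B}) b ∧ IsStandard b := by
      intro A B hAB h0 hA
      obtain ⟨x, y, rfl⟩ := exists_smul_add_smul_of_lie_eq_zero hA h0
      have hx : x ≠ 0 := by
        rintro rfl
        have := hAB y (-1) (by simp)
        norm_num at this
      have : Submodule.span ℝ {A, x • (1 : M2) + y • A} = Submodule.span ℝ {1, A} := by
        apply span_pair_eq <;> rw [Submodule.mem_span_pair]
        · exact ⟨0, 1, by simp⟩
        · exact ⟨x, y, rfl⟩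
        · refine ⟨-y / x, 1 / x, ?_⟩
          rw [smul_add, smul_smul, smul_smul, one_div_mul_cancel hx, one_smul, add_comm, add_assoc,
            ← add_smul]
          have : 1 / x * y + -y / x = 0 := by ring
          rw [this, zero_smul, add_zero]
        · exact ⟨1, 0, by simp⟩
      rw [this]
      exact exists_standard_span_one hA
    by_cases hA : ∀ c : ℝ, A ≠ c • (1 : M2)
    · exact key hAB h0 hA
    · push Not at hA
      obtain ⟨c, hc⟩ := hA
      rw [Set.pair_comm]
      refine key (fun x y hxy => (hAB y x (by rwa [add_comm])).symm) ?_ ?_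
      · rw [← lie_skew, h0, neg_zero]
      · intro c' hc'
        have h1 := hAB c' (-c) (by rw [hc, hc', smul_smul, smul_smul, ← add_smul]; ring_nf; simp)
        have hA0 : A = 0 := by rw [hc, neg_eq_zero.mp h1.2, zero_smul]
        simpa using hAB 1 0 (by simp [hA0])
  · obtain ⟨x, y, hxy⟩ := Submodule.mem_span_pair.mp h
    suffices hs : ∃ X, ⁅X, ⁅A, B⁆⁆ = ⁅A, B⁆ ∧
        Submodule.span ℝ {A, B} = Submodule.span ℝ {X, ⁅A, B⁆} by
      obtain ⟨X, hX, hs⟩ := hs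
      rw [hs]
      exact exists_standard_span_of_lie_eq h0 hX
    have hAZ : ⁅A, ⁅A, B⁆⁆ = y • ⁅A, B⁆ := by
      conv_lhs => rw [← hxy]
      simp
    have hBZ : ⁅B, ⁅A, B⁆⁆ = -x • ⁅A, B⁆ := by
      conv_lhs => rw [← hxy]
      rw [lie_add, lie_smul, lie_smul, lie_self, ← lie_skew A B, smul_zero, add_zero, smul_neg,
        neg_smul, neg_neg]
    rcases eq_or_ne y 0 with rfl | hy
    · have hx : x ≠ 0 := by
        rintro rfl
        apply h0
        rw [← hxy]
        simp
      refine ⟨(-1 / x) • B, ?_, ?_⟩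
      · rw [smul_lie, hBZ, smul_smul]
        have : -1 / x * -x = 1 := by field_simp
        rw [this, one_smul]
      · rw [← hxy]
        apply span_pair_eq <;> rw [Submodule.mem_span_pair]
        · exact ⟨0, 1 / x, by simp [smul_smul, hx]⟩
        · refine ⟨-x, 0, ?_⟩
          rw [smul_smul]
          have : -x * (-1 / x) = 1 := by field_simp
          simp [this]
        · exact ⟨0, -1 / x, by simp⟩
        · exact ⟨x, 0, by simp⟩
    · refine ⟨(1 / y) • A, ?_, ?_⟩
      · rw [smul_lie, hAZ, smul_smul, one_div_mul_cancel hy, one_smul]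
      · rw [← hxy]
        apply span_pair_eq <;> rw [Submodule.mem_span_pair]
        · exact ⟨y, 0, by simp [smul_smul, hy]⟩
        · refine ⟨-x, 1 / y, ?_⟩
          rw [smul_add, smul_smul, smul_smul, smul_smul, one_div_mul_cancel hy, one_smul, ← add_assoc,
            ← add_smul]
          have : -x * (1 / y) + 1 / y * x = 0 := by ring
          rw [this, zero_smul, zero_add]
        · exact ⟨1 / y, 0, by simp⟩
        · exact ⟨x, y, by simp⟩

/-- The trace form is non-degenerate, so a hyperplane has a normal vector `F`. -/
theorem exists_trace_mul_of_finrank {a : Submodule ℝ M2} (ha : Module.finrank ℝ a = 3) :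
    ∃ F : M2, F ≠ 0 ∧ ∀ A, A ∈ a ↔ (F * A).trace = 0 := by
  have h4 : Module.finrank ℝ M2 = 4 := by simp [Module.finrank_matrix]
  have hlt : a < ⊤ := by
    rw [lt_top_iff_ne_top]
    rintro rfl
    rw [finrank_top, h4] at ha
    norm_num at ha
  obtain ⟨f, hf, hle⟩ := Submodule.exists_le_ker_of_lt_top a hlt
  have hker : a = LinearMap.ker f := by
    apply Submodule.eq_of_le_of_finrank_le hle
    have := Submodule.finrank_lt (s := LinearMap.ker f)
      (by rwa [Ne, LinearMap.ker_eq_top])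
    omega
  let F : M2 := Matrix.of fun i j => f (Matrix.single j i 1)
  have hF : ∀ A, (F * A).trace = f A := by
    intro A
    conv_rhs => rw [Matrix.matrix_eq_sum_single A]
    have : ∀ i j, f (Matrix.single i j (A i j)) = A i j * F j i := by
      intro i j
      change _ = A i j • f (Matrix.single i j 1)
      rw [← map_smul, Matrix.smul_single, smul_eq_mul, mul_one]
    simp only [map_sum, this]
    simp [Matrix.trace_fin_two, Matrix.mul_apply, Fin.sum_univ_two]
    ring
  refine ⟨F, ?_, fun A => by rw [hF, hker, LinearMap.mem_ker]⟩
  intro h0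
  apply hf
  ext1 A
  rw [← hF, h0]
  simp

theorem mem_b2 {M : M2} : M ∈ b2 ↔ M 1 0 = 0 := by
  rw [b2, Submodule.mem_span_triple]
  constructor
  · rintro ⟨x, y, z, rfl⟩
    simp [dg, N]
  · intro h
    refine ⟨M 0 0, M 1 1, M 0 1, ?_⟩
    ext i j; fin_cases i <;> fin_cases j <;> simp [dg, N, h]

/-- The hyperplane is replaced by its normal vector `F`. Closure under the bracket, tested on one
pair of matrices for each normal form, leaves a scalar `F`, which gives `𝔰𝔩(2, ℝ)`, or a nilpotent
one, which gives `𝔟₂`. -/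
theorem exists_standard_of_finrank_eq_three {a : Submodule ℝ M2}
    (hl : ∀ A ∈ a, ∀ B ∈ a, ⁅A, B⁆ ∈ a) (ha : Module.finrank ℝ a = 3) :
    ∃ b, IsConjugate a b ∧ IsStandard b := by
  obtain ⟨F, hF, hm⟩ := exists_trace_mul_of_finrank ha
  have key : ∀ {G : M2}, IsSimilar F G → ∃ P Q : M2, P * Q = 1 ∧ G ≠ 0 ∧
      (∀ A, P * A * Q ∈ a ↔ (G * A).trace = 0) ∧
      ∀ A B, (G * A).trace = 0 → (G * B).trace = 0 → (G * ⁅A, B⁆).trace = 0 := by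
    rintro G ⟨P, Q, hPQ, rfl⟩
    have h₁ : ∀ A, P * A * Q ∈ a ↔ (Q * F * P * A).trace = 0 := by
      intro A
      rw [hm, ← Matrix.mul_assoc, Matrix.trace_mul_comm]
      simp only [Matrix.mul_assoc]
    refine ⟨P, Q, hPQ, ?_, h₁, ?_⟩
    · intro h0
      apply hF
      rw [← mul_conj_mul hPQ F, h0]
      simp
    · intro A B hA hB
      rw [← h₁] at *
      rw [← lie_conj (mul_eq_one_comm.mp hPQ)]
      exact hl _ hA _ hB
  rcases isSimilar_normalForm F with ⟨x, y, h⟩ | ⟨x, h⟩ | ⟨x, y, hy, h⟩ <;>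
    obtain ⟨P, Q, hPQ, h0, h₁, h₂⟩ := key h
  · have hxy := h₂ !![0, 1; 0, 0] !![0, 0; 1, 0] (by simp [dg, Matrix.trace_fin_two])
      (by simp [dg, Matrix.trace_fin_two])
    simp [dg, LieRing.of_associative_ring_bracket, Matrix.trace_fin_two] at hxy
    obtain rfl : x = y := by linarith
    have hx : x ≠ 0 := by
      rintro rfl
      apply h0
      ext i j; fin_cases i <;> fin_cases j <;> simp [dg]
    refine ⟨sl2, ⟨P, Q, hPQ, fun A => ?_⟩, by simp [IsStandard]⟩
    rw [h₁, Matrix.eta_fin_two A, mem_sl2]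
    simp [dg, Matrix.trace_fin_two, ← mul_add, hx]
  · have hx := h₂ !![1, 0; 0, -1] !![1, 0; -x, 0] (by simp [Matrix.trace_fin_two])
      (by simp [Matrix.trace_fin_two])
    simp [LieRing.of_associative_ring_bracket, Matrix.trace_fin_two] at hx
    obtain rfl : x = 0 := by linarith
    refine ⟨b2, ⟨P, Q, hPQ, fun A => ?_⟩, by simp [IsStandard]⟩
    rw [h₁, mem_b2, Matrix.eta_fin_two A]
    simp [Matrix.trace_fin_two]
  · have hy' := h₂ !![1, 0; 0, -1] !![0, 1; 1, 0] (by simp [Matrix.trace_fin_two])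
      (by simp [Matrix.trace_fin_two])
    simp [LieRing.of_associative_ring_bracket, Matrix.trace_fin_two] at hy'
    exact absurd (by linarith) hy

/-- Every subalgebra of `𝔤𝔩(2, ℝ)` is conjugate to a standard one. -/
theorem exists_isConjugate_isStandard {a : Submodule ℝ M2}
    (hl : ∀ A ∈ a, ∀ B ∈ a, ⁅A, B⁆ ∈ a) : ∃ b, IsConjugate a b ∧ IsStandard b := by
  have h4 : Module.finrank ℝ M2 = 4 := by simp [Module.finrank_matrix]
  have hle : Module.finrank ℝ a ≤ 4 := h4 ▸ Submodule.finrank_le a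
  have hspan : ∀ {n : ℕ} (c : Module.Basis (Fin n) ℝ a),
      a = Submodule.span ℝ (Set.range fun i => (c i : M2)) := by
    intro n c
    have := congrArg (Submodule.map a.subtype) c.span_eq
    rw [Submodule.map_span, ← Set.range_comp, Submodule.map_top, Submodule.range_subtype] at this
    exact this.symm
  interval_cases hr : Module.finrank ℝ a
  · exact ⟨a, isConjugate_refl a, Or.inl (Submodule.finrank_eq_zero.mp hr)⟩
  · have c := Module.finBasisOfFinrankEq ℝ a hr
    have ha : a = line (c 0 : M2) := by
      rw [line]
      conv_lhs => rw [hspan c]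
      congr 1
      ext; simp [eq_comm]
    have h0 : (c 0 : M2) ≠ 0 := by simpa using c.ne_zero 0
    rw [ha]
    exact exists_standard_line h0
  · have c := Module.finBasisOfFinrankEq ℝ a hr
    have ha : a = Submodule.span ℝ {(c 0 : M2), (c 1 : M2)} := by
      conv_lhs => rw [hspan c]
      congr 1
      ext; simp [Fin.exists_fin_two, eq_comm]
    have hi : LinearIndependent ℝ ![(c 0 : M2), (c 1 : M2)] := by
      have := c.linearIndependent.map' a.subtype (Submodule.ker_subtype a)
      have he : ![(c 0 : M2), (c 1 : M2)] = a.subtype ∘ c := by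
        ext1 i; fin_cases i <;> rfl
      rwa [he]
    have hm := hl _ (c 0).2 _ (c 1).2
    generalize (c 0 : M2) = A at *
    generalize (c 1 : M2) = B at *
    rw [ha] at hm ⊢
    exact exists_standard_span_pair hi hm
  · exact exists_standard_of_finrank_eq_three hl hr
  · refine ⟨a, isConjugate_refl a, ?_⟩
    have : a = ⊤ := Submodule.eq_top_of_finrank_eq (hr.trans h4.symm)
    simp [IsStandard, this]

/-! ### The classification -/

section
variable {h : LieSubalgebra ℝ (Module.End ℝ V)} {k : Submodule ℝ M7}

theorem IsHIForm.exists_proj_eq (hk : IsHIForm h k) (h_sub : h ≤ g2star) {b : Submodule ℝ M2}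
    (hb : IsConjugate (proj k) b) : ∃ k', IsHIForm h k' ∧ proj k' = b := by
  obtain ⟨P, Q, hPQ, hb⟩ := hb
  obtain ⟨k', hk', hm⟩ := hk.exists_levi h_sub hPQ
  have hmem : ∀ {k : Submodule ℝ M7} {A : M2}, A ∈ proj k ↔ ∃ v u y, hMat A v u y ∈ k := by
    intro k A
    simp only [proj, Submodule.mem_map, Submodule.mem_comap]
    exact ⟨by rintro ⟨x, hx, rfl⟩; exact ⟨_, _, _, hx⟩,
      by rintro ⟨v, u, y, hx⟩; exact ⟨(A, v, u, y), hx, rfl⟩⟩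
  have hdet : P.det * Q.det = 1 := by rw [← Matrix.det_mul, hPQ, Matrix.det_one]
  refine ⟨k', hk', ?_⟩
  ext A
  rw [hb, hmem, hmem]
  constructor
  · rintro ⟨v, u, y, hx⟩
    exact ⟨_, _, _, (hm _ _ _ _).mp hx⟩
  · rintro ⟨v, u, y, hx⟩
    refine ⟨Q.det * v, Q *ᵥ u, Q.det • Q *ᵥ y, (hm _ _ _ _).mpr ?_⟩
    rw [← mul_assoc, hdet, one_mul, Matrix.mulVec_mulVec, hPQ, Matrix.one_mulVec,
      Matrix.mulVec_smul, smul_smul, hdet, Matrix.mulVec_mulVec, hPQ, Matrix.one_mulVec, one_smul]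
    exact hx

end

section
variable {h : LieSubalgebra ℝ (Module.End ℝ V)} {k : Submodule ℝ M7}

/-- `k` is one of the listed algebras. -/
def IsListed (k : Submodule ℝ M7) : Prop :=
  ((proj k = ⊥ ∨ proj k = sl2 ∨ proj k = ⊤ ∨ proj k = u1 ∨ proj k = b2 ∨ proj k = b2hat ∨
      proj k = d ∨ (∃ c : ℝ, proj k = line (C c)) ∨ proj k = line S) ∧
    IsSemidirect k (emb (proj k)) mAll) ∨
  (∃ t : ℝ, proj k = s t ∧
    (IsSemidirect k (emb (proj k)) mAll ∨
    (t = 1 ∧ ∃ n : Submodule ℝ M7, IsSemidirect n (emb (line N)) (m 1 1 2) ∧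
      IsSemidirect k (Submodule.span ℝ {hMat (dg 1 0) 0 ![0, 1] 0}) n) ∨
    (t = 2 ∧ ∃ i j : Fin 2,
      IsSemidirect k (Submodule.span ℝ {hMat (dg 2 1) 0 0 0, hMat N 0 ![0, 1] 0}) (m i j 2)))) ∨
  (∃ μ : ℝ, proj k = line (dg 1 μ) ∧
    ((μ ∈ Set.Icc (-1 : ℝ) 1 ∧ IsSemidirect k (emb (proj k)) mAll) ∨
    (μ = 0 ∧ IsSemidirect k (Submodule.span ℝ {hMat (dg 1 0) 0 ![0, 1] 0}) (m 1 1 2)))) ∨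
  (proj k = line N ∧
    (IsSemidirect k (emb (proj k)) mAll ∨
    ∃ j : Fin 2, IsSemidirect k (Submodule.span ℝ {hMat N 0 ![0, 1] 0}) (m 1 j 2)))

theorem IsHIForm.exists_isListed (hk : IsHIForm h k) (h_sub : h ≤ g2star)
    (h_indec : IsIndecomposable h) (h_berger : IsBerger h) (h_type : IsTypeI h)
    (hs : IsStandard (proj k)) : ∃ k', IsHIForm h k' ∧ IsListed k' := by
  have hfull : mAll ≤ k → IsSemidirect k (emb (proj k)) mAll := hk.isSemidirect_of_mAll_le
  have hone : ∀ {b : Submodule ℝ M2}, proj k = b → (1 : M2) ∈ b →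
      IsSemidirect k (emb (proj k)) mAll := fun hb h1 =>
    hfull (hk.mAll_le_of_one_mem h_indec h_type (by rwa [hb]))
  rcases hs with hb | hb | hb | hb | hb | hb | hb | ⟨c, hb⟩ | hb | ⟨t, hb⟩ | ⟨μ, hμ, hb⟩ | hb
  · exact ⟨k, hk, Or.inl ⟨Or.inl hb,
      hfull (hk.mAll_le_of_proj_eq_bot h_indec h_type hb)⟩⟩
  · exact ⟨k, hk, Or.inl ⟨by simp [hb],
      hfull (hk.mAll_le_of_proj_eq_sl2 h_indec h_type hb)⟩⟩
  · exact ⟨k, hk, Or.inl ⟨by simp [hb], hone hb trivial⟩⟩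
  · refine ⟨k, hk, Or.inl ⟨by simp [hb], hone hb (Submodule.mem_span_pair.mpr ⟨1, 0, ?_⟩)⟩⟩
    simp [dg, Matrix.one_fin_two]
  · refine ⟨k, hk, Or.inl ⟨by simp [hb], hone hb (mem_b2.mpr (by simp))⟩⟩
  · exact ⟨k, hk, Or.inl ⟨by simp [hb], hone hb (Submodule.subset_span (by simp))⟩⟩
  · refine ⟨k, hk, Or.inl ⟨by simp [hb], hone hb (Submodule.mem_span_pair.mpr ⟨1, 1, ?_⟩)⟩⟩
    simp [dg, Matrix.one_fin_two]
  · refine ⟨k, hk, Or.inl ⟨?_, hfull (hk.mAll_le_of_proj_eq_line h_indec h_type hb ?_)⟩⟩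
    · iterate 7 apply Or.inr
      exact Or.inl ⟨c, hb⟩
    · rw [C, Matrix.det_fin_two_of]
      nlinarith [mul_self_nonneg c]
  · refine ⟨k, hk, Or.inl ⟨by simp [hb], hfull (hk.mAll_le_of_proj_eq_line h_indec h_type hb ?_)⟩⟩
    simp [S]
  · obtain ⟨k', hk', hb', hm | ⟨rfl, hs⟩ | ⟨rfl, i, j, hs⟩⟩ :=
      hk.classify_s h_sub h_indec h_type h_berger hb
    · exact ⟨k', hk', Or.inr (Or.inl ⟨t, hb', Or.inl (hk'.isSemidirect_of_mAll_le hm)⟩)⟩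
    · exact ⟨k', hk', Or.inr (Or.inl ⟨1, hb',
        Or.inr (Or.inl ⟨rfl, _, isSemidirect_emb_line_N, hs⟩)⟩)⟩
    · exact ⟨k', hk', Or.inr (Or.inl ⟨2, hb', Or.inr (Or.inr ⟨rfl, i, j, hs⟩)⟩)⟩
  · rcases eq_or_ne μ 0 with rfl | hμ0
    · rcases hk.classify_dg h_sub h_indec h_type hb with hm | ⟨k', hk', hb', hs⟩
      · exact ⟨k, hk, Or.inr (Or.inr (Or.inl ⟨0, hb, Or.inl ⟨hμ, hfull hm⟩⟩))⟩
      · exact ⟨k', hk', Or.inr (Or.inr (Or.inl ⟨0, hb', Or.inr ⟨rfl, hs⟩⟩))⟩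
    · refine ⟨k, hk, Or.inr (Or.inr (Or.inl ⟨μ, hb, Or.inl ⟨hμ,
        hfull (hk.mAll_le_of_proj_eq_line h_indec h_type hb ?_)⟩⟩))⟩
      simpa [dg]
  · obtain ⟨k', hk', hb', hm | hs⟩ := hk.classify_N h_sub h_indec h_type h_berger hb
    · exact ⟨k', hk', Or.inr (Or.inr (Or.inr ⟨hb', Or.inl (hk'.isSemidirect_of_mAll_le hm)⟩))⟩
    · exact ⟨k', hk', Or.inr (Or.inr (Or.inr ⟨hb', Or.inr hs⟩))⟩

end

end GTwoStar

end

theorem theorem2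
    (h : LieSubalgebra ℝ (Module.End ℝ GTwoStar.V))
    (h_sub : h ≤ GTwoStar.g2star)
    (h_indec : GTwoStar.IsIndecomposable h)
    (h_berger : GTwoStar.IsBerger h)
    (h_type : GTwoStar.IsTypeI h) :
    ∃ (b : Module.Basis (Fin 7) ℝ GTwoStar.V)
      (k : Submodule ℝ GTwoStar.M7) (a : Submodule ℝ GTwoStar.M2),
      GTwoStar.IsAdapted b ∧ k = GTwoStar.matrices h b ∧ k ≤ GTwoStar.hI ∧
      a = GTwoStar.proj k ∧
      -- (1)
      (((a = ⊥ ∨ a = GTwoStar.sl2 ∨ a = ⊤ ∨ a = GTwoStar.u1 ∨ a = GTwoStar.b2 ∨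
            a = GTwoStar.b2hat ∨ a = GTwoStar.d ∨ (∃ c : ℝ, a = GTwoStar.line (GTwoStar.C c)) ∨
            a = GTwoStar.line GTwoStar.S) ∧
          GTwoStar.IsSemidirect k (GTwoStar.emb a) GTwoStar.mAll) ∨
      -- (2)
        (∃ t : ℝ, a = GTwoStar.s t ∧
          (GTwoStar.IsSemidirect k (GTwoStar.emb a) GTwoStar.mAll ∨
          (t = 1 ∧ ∃ n : Submodule ℝ GTwoStar.M7,
            GTwoStar.IsSemidirect n (GTwoStar.emb (GTwoStar.line GTwoStar.N))
              (GTwoStar.m 1 1 2) ∧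
            GTwoStar.IsSemidirect k
              (Submodule.span ℝ {GTwoStar.hMat (GTwoStar.dg 1 0) 0 ![0, 1] 0}) n) ∨
          (t = 2 ∧ ∃ i j : Fin 2,
            GTwoStar.IsSemidirect k
              (Submodule.span ℝ {GTwoStar.hMat (GTwoStar.dg 2 1) 0 0 0,
                GTwoStar.hMat GTwoStar.N 0 ![0, 1] 0})
              (GTwoStar.m i j 2)))) ∨
      -- (3)
        (∃ μ : ℝ, a = GTwoStar.line (GTwoStar.dg 1 μ) ∧
          ((μ ∈ Set.Icc (-1 : ℝ) 1 ∧ GTwoStar.IsSemidirect k (GTwoStar.emb a) GTwoStar.mAll) ∨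
          (μ = 0 ∧
            GTwoStar.IsSemidirect k
              (Submodule.span ℝ {GTwoStar.hMat (GTwoStar.dg 1 0) 0 ![0, 1] 0})
              (GTwoStar.m 1 1 2)))) ∨
      -- (4)
        (a = GTwoStar.line GTwoStar.N ∧
          (GTwoStar.IsSemidirect k (GTwoStar.emb a) GTwoStar.mAll ∨
          ∃ j : Fin 2,
            GTwoStar.IsSemidirect k
              (Submodule.span ℝ {GTwoStar.hMat GTwoStar.N 0 ![0, 1] 0})
              (GTwoStar.m 1 j 2)))) := by
  obtain ⟨k₀, hk₀⟩ := GTwoStar.exists_isHIForm h_sub h_indec h_type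
  obtain ⟨a, ha, hs⟩ := GTwoStar.exists_isConjugate_isStandard
    fun A hA B hB => hk₀.lie_mem_proj hA hB
  obtain ⟨k₁, hk₁, rfl⟩ := hk₀.exists_proj_eq h_sub ha
  obtain ⟨k, hk, hl⟩ := hk₁.exists_isListed h_sub h_indec h_berger h_type hs
  obtain ⟨b, hb, hkb⟩ := hk.form.exists_basis
  exact ⟨b, k, _, hb, hkb, hk.le, rfl, hl⟩
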